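/- Conventions. A Hamiltonian $H$ on $n$ qubits is $k$-local if $H=\sum_{i=1}^{N}H_i$ with Hermitian terms $H_i$, each acting non-trivially on at most $k$ qubits. It is *globally stoquastic* if $\langle x|H|y\rangle$ is real and $\le 0$ for all distinct bit strings $x\neq y$, and *termwise stoquastic* if every $H_i$ has this property. Effort is counted on a randomized machine with exact real arithmetic: real operations and matrix elements of the $H_i$ have unit cost (up to factors $n$ for handling $n$-bit strings), a draw from a given finite distribution has linear cost, and dense linear algebra (exponential, Perron–Frobenius vectors, singular value decomposition, Moore–Penrose inverse, product, eigenvalues) has cubic cost in the matrix size. For $E,\tilde E\in\mathbb R^S$ let $d(E,\tilde E)=\frac1{2\pi}\min_{\pi\in\mathrm{Perm}_S}\max_j|\tilde E_{\pi(j)}-E_j|$. Theorem. Fix $k$, $S_0$ and polynomials $p,r$. There are polynomials $M,m,T$, depending only on these, such that the following holds for every $n$ and every $\delta\in(0,1)$. Let $H=\sum_{i=1}^N H_i$ be a $k$-local Hamiltonian on $n$ qubits, termwise or globally stoquastic, with $N\le p(n)$ and $\|H_i\|\le p(n)$. Let $\Phi=\sum_x\Phi(x)|x\rangle$ be a normalized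 state such that a sample $x$ from the distribution $|\Phi(x)|^2$ can be drawn at cost at most $p(n)$, and such that $\Phi(y)/\Phi(x)$ can be computed for given $x,y$ at cost at most $p(n)$. Suppose that $\Phi$ is a linear combination of $S\le S_0$ orthonormal eigenvectors $\psi_1,\dots,\psi_S$ of $H$, with $|\langle\psi_j|\Phi\rangle|^2\ge 1/p(n)$ for all $j$, whose eigenvalues $E_1,\dots,E_S\in[0,2\pi)$ satisfy $\frac1{2\pi}|E_i-E_j|\ge 1/p(n)$ for $i\ne j$. Consider the following algorithm, which is given $n$, $k$, $S$, the bound $p(n)$ on the norms, and the terms $H_i$. Let $c=N2^kp(n)$, $\Lambda=(N+1)2^kp(n)$ and $\hat H=(H+c)/\Lambda$, so that the eigenvalues of $\hat H$ lie in $[0,2]\subset[0,2\pi)$. (i) *Monte Carlo stage.* For $\kappa=0,\dots,2S$ estimate the imaginary-time signal $g(\kappa)=\langle\Phi|e^{-\kappa\hat H}|\Phi\rangle$ as follows. Split $H+c=\sum_aA_a$ into stoquastic positive semidefinite pieces (in the termwise case $A_i=H_i+2^kp(n)$; in the global case, for every set $s$ of between $1$ and $k$ qubits, the part $H_s$ of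 $H$ that flips exactly the bits in $s$ plus the diagonal matrix with entries $-\langle x|H|x\oplus s\rangle$, together with the diagonal matrix that remains). Put $G_a=e^{-\kappa A_a/(\Lambda M(n))}$ and replace $e^{-\kappa\hat H}$ by the first-order Trotter product $(\prod_aG_a)^{M(n)}=:G_1G_2\cdots G_L$. Draw $x_0$ from $|\Phi(x_0)|^2$ and then $x_l$ with probability $\langle x_{l-1}|G_l|x_l\rangle\,\phi_l(x_l)/(\lambda_l\phi_l(x_{l-1}))$, where $\phi_l>0$ is the Perron–Frobenius vector and $\lambda_l$ the largest eigenvalue of the irreducible block of $G_l$ that contains $x_{l-1}$, and evaluate $\mathrm{Re}\big(\tfrac{\Phi(x_L)}{\Phi(x_0)}\big)\prod_{l}\lambda_l\phi_l(x_{l-1})/\phi_l(x_l)$. The estimate $y(\kappa)$ of $g(\kappa)$ is the median of the means of $q=\lceil 8\log((2S+1)/\delta)\rceil$ groups of $m(n)$ such samples. (ii) *ESPRIT stage.* Let $U$ be the matrix of left singular vectors, for decreasing singular values, of the $(S+1)\times(S+1)$ Hankel matrix $(y(i+j))_{0\le i,j\le S}$. Let $U_0$ and $U_1$ consist of the first $S$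 and of the last $S$ rows of the first $S$ columns of $U$. Compute the eigenvalues $\tilde z_1,\dots,\tilde z_S$ of $U_0^{+}U_1$ and output $\tilde E_j=-\Lambda\,\mathrm{Re}\log\tilde z_j-c$. Then the Monte Carlo stage costs at most $T(n+\lceil\log(1/\delta)\rceil)$ and the ESPRIT stage at most $T(n)$, and with probability at least $1-\delta$ one has $d(\{E_i\},\{\tilde E_j\})\le 1/r(n)$. -/

import Mathlib

noncomputable section

namespace StoqMC

/-! ### Qubits, local Hamiltonians, stoquasticity -/

/-- `n`-bit strings, labelling the computational basis of `n` qubits. -/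
abbrev Bits (n : ℕ) : Type := Fin n → Bool

/-- The string `x` with the bits in `s` flipped. -/
def flipAt {n : ℕ} (s : Finset (Fin n)) (x : Bits n) : Bits n :=
  fun i => if i ∈ s then !(x i) else x i

/-- `A` acts non-trivially only on the qubits in `Q`, i.e. `A = a ⊗ 1` with `a` acting on `Q`. -/
def ActsOn {n : ℕ} (Q : Finset (Fin n)) (A : Matrix (Bits n) (Bits n) ℂ) : Prop :=
  ∃ a : Matrix (Q → Bool) (Q → Bool) ℂ, ∀ x y : Bits n,
    A x y = if ∀ i, i ∉ Q → x i = y i then a (fun i => x i) (fun i => y i) else 0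

/-- The operator (spectral) norm of a matrix. -/
def opNorm {n : ℕ} (A : Matrix (Bits n) (Bits n) ℂ) : ℝ :=
  ‖Matrix.toEuclideanCLM (𝕜 := ℂ) A‖

/-- The off-diagonal entries are real and non-positive. (A Hermitian matrix has a real diagonal,
so that a stoquastic Hermitian matrix is real.) -/
def IsStoquastic {n : ℕ} (A : Matrix (Bits n) (Bits n) ℂ) : Prop :=
  ∀ x y, x ≠ y → (A x y).im = 0 ∧ (A x y).re ≤ 0

/-- A `k`-local Hamiltonian on `n` qubits, given as a sum of `N` Hermitian terms. -/
structure LocalHamiltonian (n k N : ℕ) where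
  supp : Fin N → Finset (Fin n)
  card_supp_le : ∀ i, (supp i).card ≤ k
  term : Fin N → Matrix (Bits n) (Bits n) ℂ
  isHermitian : ∀ i, (term i).IsHermitian
  actsOn : ∀ i, ActsOn (supp i) (term i)

/-- The Hamiltonian itself. -/
def LocalHamiltonian.total {n k N : ℕ} (H : LocalHamiltonian n k N) :
    Matrix (Bits n) (Bits n) ℂ :=
  ∑ i, H.term i

/-- The two notions of stoquasticity of a local Hamiltonian. -/
inductive Scheme
  | termwise
  | globally

/-- Stoquastic in the sense `σ`: each local term is stoquastic, or only the total is. -/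
def LocalHamiltonian.Stoquastic {n k N : ℕ} (H : LocalHamiltonian n k N) : Scheme → Prop
  | .termwise => ∀ i, IsStoquastic (H.term i)
  | .globally => IsStoquastic H.total

/-- An input: a local Hamiltonian, a normalized state `Φ`, and the costs of one call of the two
routines that give access to `Φ`. -/
structure Input (n k N : ℕ) where
  ham : LocalHamiltonian n k N
  Φ : Bits n → ℂ
  norm_Φ : ∑ x, ‖Φ x‖ ^ 2 = 1
  sampleCost : ℕ
  ratioCost : ℕ

/-- `Φ` is supported on the orthonormal eigenvectors `ψ` of `A`, with eigenvalues `E`. -/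
structure SupportedOn {n S : ℕ} (A : Matrix (Bits n) (Bits n) ℂ) (Φ : Bits n → ℂ)
    (E : Fin S → ℝ) (ψ : Fin S → Bits n → ℂ) : Prop where
  orthonormal : ∀ i j, star (ψ i) ⬝ᵥ ψ j = if i = j then 1 else 0
  eigen : ∀ j, A.mulVec (ψ j) = (E j : ℂ) • ψ j
  expansion : Φ = ∑ j, (star (ψ j) ⬝ᵥ Φ) • ψ j

/-! ### Numerical linear algebra on small dense matrices -/

/-- `A = U Σ W` is a singular value decomposition, with decreasing singular values `s`. -/
def IsSVD {m : ℕ} (A U : Matrix (Fin m) (Fin m) ℝ) (s : Fin m → ℝ)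
    (W : Matrix (Fin m) (Fin m) ℝ) : Prop :=
  U.transpose * U = 1 ∧ W.transpose * W = 1 ∧ Antitone s ∧ (∀ i, 0 ≤ s i) ∧
    A = U * Matrix.diagonal s * W

/-- A singular value decomposition `(U, Σ, W)` of `A`. -/
def svd {m : ℕ} (A : Matrix (Fin m) (Fin m) ℝ) :
    Matrix (Fin m) (Fin m) ℝ × (Fin m → ℝ) × Matrix (Fin m) (Fin m) ℝ :=
  Classical.epsilon fun d => IsSVD A d.1 d.2.1 d.2.2

/-- The four Penrose equations. -/
def IsPinv {m l : ℕ} (A : Matrix (Fin m) (Fin l) ℝ) (B : Matrix (Fin l) (Fin m) ℝ) : Prop :=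
  A * B * A = A ∧ B * A * B = B ∧ (A * B).transpose = A * B ∧ (B * A).transpose = B * A

/-- The Moore–Penrose inverse. -/
def pinv {m l : ℕ} (A : Matrix (Fin m) (Fin l) ℝ) : Matrix (Fin l) (Fin m) ℝ :=
  Classical.epsilon (IsPinv A)

/-- The complex eigenvalues of a real matrix, listed with algebraic multiplicity. -/
def eigenvalueList {m : ℕ} (A : Matrix (Fin m) (Fin m) ℝ) : Fin m → ℂ :=
  Classical.epsilon fun z =>
    (A.map (algebraMap ℝ ℂ)).charpoly = ∏ j, (Polynomial.X - Polynomial.C (z j))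

/-- Perron–Frobenius data of a symmetric non-negative matrix: a strictly positive vector `φ` that
is an eigenvector on each irreducible block `b`, the eigenvalue being the constant value of `lam`
on `b`. -/
def IsPerron {m : ℕ} (G : Matrix (Fin m) (Fin m) ℝ) (φ lam : Fin m → ℝ) : Prop :=
  (∀ i, 0 < φ i) ∧ (∀ i j, G i j ≠ 0 → lam i = lam j) ∧ ∀ i, G.mulVec φ i = lam i * φ i

/-- Perron–Frobenius data `(φ, lam)` of `G`. -/
def perron {m : ℕ} (G : Matrix (Fin m) (Fin m) ℝ) : (Fin m → ℝ) × (Fin m → ℝ) :=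
  Classical.epsilon fun d => IsPerron G d.1 d.2

/-- The positions of a median in a list of `q` numbers. -/
def medianPos {q : ℕ} (v : Fin q → ℝ) : Finset (Fin q) := by
  classical
  exact Finset.univ.filter fun i =>
    q ≤ 2 * (Finset.univ.filter fun j => v j ≤ v i).card ∧
    q ≤ 2 * (Finset.univ.filter fun j => v i ≤ v j).card

/-- The median: the entry at the first median position (`0` for an empty list). -/
def median {q : ℕ} (v : Fin q → ℝ) : ℝ := by
  classical
  exact if h : (medianPos v).Nonempty then v ((medianPos v).min' h) else 0

/-! ### Probabilistic programs and their cost -/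

/-- The instructions of a classical randomized machine with exact real arithmetic, with the type
of the value that they return. -/
inductive Instr (n N : ℕ) : Type → Type
  /-- a sample from `|Φ(x)|²` -/
  | sample : Instr n N (Bits n)
  /-- the ratio `Φ(y) / Φ(x)` -/
  | ratio (x y : Bits n) : Instr n N ℂ
  /-- the matrix element `⟨x|H_i|y⟩` of a local term -/
  | entry (i : Fin N) (x y : Bits n) : Instr n N ℂ
  /-- flip the bits of `x` in `s` -/
  | flipBits (s : Finset (Fin n)) (x : Bits n) : Instr n N (Bits n)
  | add (a b : ℝ) : Instr n N ℝ
  | sub (a b : ℝ) : Instr n N ℝ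
  | mul (a b : ℝ) : Instr n N ℝ
  | div (a b : ℝ) : Instr n N ℝ
  /-- `log |z|`, the real part of the logarithm -/
  | logAbs (z : ℂ) : Instr n N ℝ
  /-- a random index, with probabilities proportional to `w` -/
  | draw {m : ℕ} (w : Fin (m + 1) → ℝ) : Instr n N (Fin (m + 1))
  | median {q : ℕ} (v : Fin q → ℝ) : Instr n N ℝ
  /-- the matrix exponential `exp (- t A)` -/
  | expNeg {m : ℕ} (t : ℝ) (A : Matrix (Fin m) (Fin m) ℝ) : Instr n N (Matrix (Fin m) (Fin m) ℝ)
  | perron {m : ℕ} (G : Matrix (Fin m) (Fin m) ℝ) : Instr n N ((Fin m → ℝ) × (Fin m → ℝ))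
  | svd {m : ℕ} (A : Matrix (Fin m) (Fin m) ℝ) :
      Instr n N (Matrix (Fin m) (Fin m) ℝ × (Fin m → ℝ) × Matrix (Fin m) (Fin m) ℝ)
  | pinv {m l : ℕ} (A : Matrix (Fin m) (Fin l) ℝ) : Instr n N (Matrix (Fin l) (Fin m) ℝ)
  | matMul {m l r : ℕ} (A : Matrix (Fin m) (Fin l) ℝ) (B : Matrix (Fin l) (Fin r) ℝ) :
      Instr n N (Matrix (Fin m) (Fin r) ℝ)
  | eigenvalues {m : ℕ} (A : Matrix (Fin m) (Fin m) ℝ) : Instr n N (Fin m → ℂ)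

/-- The distribution `|Φ(x)|²`. -/
def bornPMF {n k N : ℕ} (I : Input n k N) : PMF (Bits n) :=
  PMF.ofFintype (fun x => ENNReal.ofReal (‖I.Φ x‖ ^ 2)) (by
    rw [← ENNReal.ofReal_sum_of_nonneg (fun x _ => by positivity), I.norm_Φ, ENNReal.ofReal_one])

/-- The distribution on indices proportional to the weights `w`. -/
def drawPMF {m : ℕ} (w : Fin (m + 1) → ℝ) : PMF (Fin (m + 1)) := by
  classical
  exact if h : ∑' i, ENNReal.ofReal (w i) ≠ 0 then
    PMF.normalize (fun i => ENNReal.ofReal (w i)) h (by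
      rw [tsum_fintype]
      exact (ENNReal.sum_lt_top.2 fun i _ => ENNReal.ofReal_lt_top).ne)
  else PMF.pure 0

/-- What an instruction returns on the input `I`. -/
def Instr.exec {n k N : ℕ} (I : Input n k N) : {β : Type} → Instr n N β → PMF β
  | _, .sample => bornPMF I
  | _, .ratio x y => PMF.pure (I.Φ y / I.Φ x)
  | _, .entry i x y => PMF.pure (I.ham.term i x y)
  | _, .flipBits s x => PMF.pure (flipAt s x)
  | _, .add a b => PMF.pure (a + b)
  | _, .sub a b => PMF.pure (a - b)
  | _, .mul a b => PMF.pure (a * b)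
  | _, .div a b => PMF.pure (a / b)
  | _, .logAbs z => PMF.pure (Real.log ‖z‖)
  | _, .draw w => drawPMF w
  | _, .median v => PMF.pure (StoqMC.median v)
  | _, .expNeg t A => PMF.pure (NormedSpace.exp (-(t • A)))
  | _, .perron G => PMF.pure (StoqMC.perron G)
  | _, .svd A => PMF.pure (StoqMC.svd A)
  | _, .pinv A => PMF.pure (StoqMC.pinv A)
  | _, .matMul A B => PMF.pure (A * B)
  | _, .eigenvalues A => PMF.pure (eigenvalueList A)

/-- The cost of an instruction: unit cost for real arithmetic, linear cost for handling strings and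
lists of weights, quadratic cost for a median, cubic cost for dense linear algebra, and the cost
given by the input for a call of one of the two routines for `Φ`. -/
def Instr.cost {n k N : ℕ} (I : Input n k N) : {β : Type} → Instr n N β → ℕ
  | _, .sample => I.sampleCost + 1
  | _, .ratio _ _ => I.ratioCost + 1
  | _, .entry _ _ _ => n + 1
  | _, .flipBits _ _ => n + 1
  | _, .add _ _ => 1
  | _, .sub _ _ => 1
  | _, .mul _ _ => 1
  | _, .div _ _ => 1
  | _, .logAbs _ => 1
  | _, .draw (m := m) _ => m + 1
  | _, .median (q := q) _ => (q + 1) ^ 2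
  | _, .expNeg (m := m) _ _ => (m + 1) ^ 3
  | _, .perron (m := m) _ => (m + 1) ^ 3
  | _, .svd (m := m) _ => (m + 1) ^ 3
  | _, .pinv (m := m) (l := l) _ => (m + l + 1) ^ 3
  | _, .matMul (m := m) (l := l) (r := r) _ _ => (m + l + r + 1) ^ 3
  | _, .eigenvalues (m := m) _ => (m + 1) ^ 3

/-- Programs: finite sequences of instructions, each of which may use the earlier results. -/
inductive Prog (n N : ℕ) (α : Type) : Type 1
  | ret (a : α) : Prog n N α
  | step {β : Type} (i : Instr n N β) (f : β → Prog n N α) : Prog n N α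

def Prog.bind {n N : ℕ} {α γ : Type} : Prog n N α → (α → Prog n N γ) → Prog n N γ
  | .ret a, g => g a
  | .step i f, g => .step i fun b => (f b).bind g

instance {n N : ℕ} : Monad (Prog n N) where
  pure := Prog.ret
  bind := Prog.bind

/-- A single instruction as a program. -/
def op {n N : ℕ} {β : Type} (i : Instr n N β) : Prog n N β := .step i .ret

/-- The joint distribution of the result and of the total cost of a program. -/
def Prog.run {n k N : ℕ} (I : Input n k N) {α : Type} : Prog n N α → PMF (α × ℕ)
  | .ret a => PMF.pure (a, 0)
  | .step i f => (i.exec I).bind fun b => ((f b).run I).map fun o => (o.1, i.cost I + o.2)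

/-- The probability that the result of a program lies in `s`. -/
def Prog.prob {n k N : ℕ} (I : Input n k N) {α : Type} (P : Prog n N α) (s : Set α) : ENNReal :=
  (P.run I).toOuterMeasure {o | o.1 ∈ s}

/-- The program costs at most `c`, whatever the random choices. -/
def Prog.CostLE {n k N : ℕ} (I : Input n k N) {α : Type} (P : Prog n N α) (c : ℕ) : Prop :=
  ∀ o ∈ (P.run I).support, o.2 ≤ c

/-- Run `f 0, …, f (m - 1)` one after the other and collect the results. -/
def tab {n N : ℕ} {α : Type} : {m : ℕ} → (Fin m → Prog n N α) → Prog n N (Fin m → α)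
  | 0, _ => pure Fin.elim0
  | _ + 1, f => do
      let a ← f 0
      let v ← tab fun j => f j.succ
      pure (Fin.cons a v)

/-- The sum of the results of `f a`, for `a` in a list. -/
def sumOver {n N : ℕ} {ι : Type} (f : ι → Prog n N ℝ) : List ι → Prog n N ℝ
  | [] => pure 0
  | a :: l => do
      let v ← f a
      let s ← sumOver f l
      op (.add v s)

/-- Pass a value through `f a`, for the successive `a` in a list. -/
def passThrough {n N : ℕ} {ι σ : Type} (f : ι → σ → Prog n N σ) : List ι → σ → Prog n N σ
  | [], x => pure x
  | a :: l, x => do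
      let x' ← f a x
      passThrough f l x'

/-! ### The Monte Carlo estimator of the imaginary-time signal -/

/-- The parameters of the algorithm: the locality `k`, a bound `b` on the norms of the local terms,
the supports of the local terms, and the notion of stoquasticity. -/
structure Params (n N : ℕ) where
  k : ℕ
  b : ℕ
  supp : Fin N → Finset (Fin n)
  scheme : Scheme

/-- The shift `c`: `H + c` is positive semidefinite. -/
def Params.shift {n N : ℕ} (p : Params n N) : ℕ := N * (2 ^ p.k * p.b)

/-- The rescaling `Λ`: the eigenvalues of `(H + c) / Λ` lie in `[0, 2] ⊆ [0, 2π)`. -/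
def Params.scale {n N : ℕ} (p : Params n N) : ℕ := (N + 1) * (2 ^ p.k * p.b)

/-- The sets of between `1` and `k` qubits. -/
def Params.hops {n N : ℕ} (p : Params n N) : List (Finset (Fin n)) :=
  (Finset.univ.filter fun s : Finset (Fin n) => 1 ≤ s.card ∧ s.card ≤ p.k).toList

/-- The pieces `A` into which `H + c` is split for the Trotter product; each of them is stoquastic
and positive semidefinite.
* `term i` (used if `H` is termwise stoquastic) is `H_i` plus a constant;
* `hop s` and `diag` (used if `H` is only globally stoquastic): `hop s` is the part of `H` that
  flips exactly the bits in `s`, made positive semidefinite by the diagonal entries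
  `-⟨x|H|x ⊕ s⟩`, and `diag` is the diagonal matrix that remains. -/
inductive Piece (n N : ℕ)
  | term (i : Fin N)
  | hop (s : Finset (Fin n))
  | diag

def Params.pieces {n N : ℕ} (p : Params n N) : List (Piece n N) :=
  match p.scheme with
  | .termwise => (List.finRange N).map Piece.term
  | .globally => Piece.diag :: p.hops.map Piece.hop

/-- The non-empty sets `s` such that a piece may connect `x` with `x ⊕ s`. -/
def Params.moves {n N : ℕ} (p : Params n N) : Piece n N → List (Finset (Fin n))
  | .term i => ((p.supp i).powerset.erase ∅).toList
  | .hop s => [s]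
  | .diag => []

/-- The matrix element `⟨x|H|y⟩` of a real Hamiltonian. -/
def hamEntry {n N : ℕ} (x y : Bits n) : Prog n N ℝ :=
  sumOver (fun i => do
    let z ← op (.entry i x y)
    pure z.re) (List.finRange N)

/-- The matrix element `⟨x|A|y⟩` of a piece `A`, for a `y` to which it may be connected. -/
def Params.pieceEntry {n N : ℕ} (p : Params n N) (A : Piece n N) (x y : Bits n) : Prog n N ℝ :=
  match A with
  | .term i => do
      let z ← op (.entry i x y)
      if x = y then op (.add z.re (2 ^ p.k * p.b : ℕ)) else pure z.re
  | .hop s =>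
      if x = y then do
        let x' ← op (.flipBits s x)
        let h ← hamEntry x x'
        op (.sub 0 h)
      else hamEntry x y
  | .diag => do
      let d ← sumOver (fun s => do
        let x' ← op (.flipBits s x)
        hamEntry x x') (∅ :: p.hops)
      op (.add d p.shift)

/-- One step `x → y` of the random walk for the propagator `G = exp (- t A)`. The block of `A`
that contains `x` is read and exponentiated, `y` is drawn with probability
`⟨x|G|y⟩ φ(y) / (λ φ(x))`, and the weight is multiplied by `λ φ(x) / φ(y)`. -/
def Params.walkStep {n N : ℕ} (p : Params n N) (t : ℝ) (A : Piece n N) (xR : Bits n × ℝ) :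
    Prog n N (Bits n × ℝ) := do
  let l := p.moves A
  let y ← tab fun j : Fin (l.length + 1) => op (.flipBits ((∅ :: l).get j) xR.1)
  let a ← tab fun i => tab fun j => p.pieceEntry A (y i) (y j)
  let G ← op (.expNeg t (Matrix.of a))
  let (φ, lam) ← op (.perron G)
  let w ← tab fun j => do
    let u ← op (.mul (G 0 j) (φ j))
    let v ← op (.mul (lam 0) (φ 0))
    op (.div u v)
  let j ← op (.draw w)
  let u ← op (.mul (lam 0) (φ 0))
  let v ← op (.div u (φ j))
  let R ← op (.mul xR.2 v)
  pure (y j, R)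

/-- One sample of the real part of the estimator of `⟨Φ|(∏ exp (- t A))^M|Φ⟩`. -/
def Params.pathSample {n N : ℕ} (p : Params n N) (M : ℕ) (t : ℝ) : Prog n N ℝ := do
  let x₀ ← op .sample
  let xR ← passThrough (fun (_ : ℕ) => passThrough (p.walkStep t) p.pieces) (List.range M) (x₀, 1)
  let ρ ← op (.ratio x₀ xR.1)
  op (.mul ρ.re xR.2)

/-- The median of the means of `q` groups of `m` samples. -/
def Params.medianOfMeans {n N : ℕ} (p : Params n N) (M m q : ℕ) (t : ℝ) : Prog n N ℝ := do
  let f ← tab fun _ : Fin q => do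
    let s ← sumOver (fun (_ : ℕ) => p.pathSample M t) (List.range m)
    op (.div s m)
  op (.median f)

/-- The Monte Carlo estimates of the imaginary-time signal `⟨Φ| exp (- κ (H + c) / Λ) |Φ⟩` at
`κ = 0, …, K`, with `M` Trotter steps, and `q` groups of `m` samples for each `κ`. -/
def Params.mcSignal {n N : ℕ} (p : Params n N) (M m q K : ℕ) : Prog n N (Fin (K + 1) → ℝ) :=
  tab fun κ => do
    let d ← op (.mul p.scale M)
    let t ← op (.div (κ : ℕ) d)
    p.medianOfMeans M m q t

/-! ### ESPRIT -/

/-- The Hankel matrix of a signal. -/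
def hankel {L : ℕ} (y : Fin (2 * L + 1) → ℝ) : Matrix (Fin (L + 1)) (Fin (L + 1)) ℝ :=
  Matrix.of fun i j => y ⟨i + j, by omega⟩

/-- ESPRIT for a signal of length `K + 1` with `K = 2 L` and `S` decay rates. -/
def esprit {n N L S : ℕ} (hS : S ≤ L) (y : Fin (2 * L + 1) → ℝ) : Prog n N (Fin S → ℂ) := do
  let (U, _, _) ← op (.svd (hankel y))
  let US : Matrix (Fin (L + 1)) (Fin S) ℝ := U.submatrix id (Fin.castLE (by omega))
  let U₀ : Matrix (Fin L) (Fin S) ℝ := US.submatrix Fin.castSucc id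
  let U₁ : Matrix (Fin L) (Fin S) ℝ := US.submatrix Fin.succ id
  let P ← op (.pinv U₀)
  let Ψ ← op (.matMul P U₁)
  op (.eigenvalues Ψ)

/-- Energy estimates from the signal: ESPRIT, then `Ẽ = - Λ Re (log z̃) - c`. -/
def Params.energies {n N L S : ℕ} (p : Params n N) (hS : S ≤ L) (y : Fin (2 * L + 1) → ℝ) :
    Prog n N (Fin S → ℝ) := do
  let z ← esprit hS y
  tab fun j => do
    let u ← op (.logAbs (z j))
    let v ← op (.mul p.scale u)
    let w ← op (.sub 0 v)
    op (.sub w p.shift)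

/-- The parameters of the algorithm on the input `I`, with a bound `b` on the norms of the terms. -/
def Input.params {n k N : ℕ} (I : Input n k N) (b : ℕ) (σ : Scheme) : Params n N :=
  ⟨k, b, I.ham.supp, σ⟩

/-- The Monte Carlo stage: the signal at `κ = 0, …, 2 S`, with `8 log ((2 S + 1) / δ)` groups. -/
def Params.monteCarlo {n N : ℕ} (p : Params n N) (S M m : ℕ) (δ : ℝ) :
    Prog n N (Fin (2 * S + 1) → ℝ) :=
  p.mcSignal M m ⌈8 * Real.log ((2 * S + 1) / δ)⌉₊ (2 * S)

/-- The post-processing stage: the energies from ESPRIT with `K = 2 S`. -/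
def Params.energyStage {n N : ℕ} (p : Params n N) {S : ℕ} (y : Fin (2 * S + 1) → ℝ) :
    Prog n N (Fin S → ℝ) :=
  p.energies le_rfl y

/-- The optimal matching distance, `1 / (2π)` times the minimum over permutations `π` of the
maximum over `j` of `|F (π j) - E j|`. -/
def matchingDist {S : ℕ} (E F : Fin S → ℝ) : ℝ :=
  1 / (2 * Real.pi) * ⨅ π : Equiv.Perm (Fin S), ⨆ j, |F (π j) - E j|

end StoqMC

end

noncomputable section
namespace StoqMC

/-! ### Expectations of program results -/

section Semantics

variable {n k N : ℕ} (I : Input n k N)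

/-! Put `z_j = exp(-(E_j + c)/Λ)` and `w_j = |⟨ψ_j|Φ⟩|²`. The imaginary-time signal is `g(κ) = ∑ w_j
z_j^κ`. The shift and the scale place the rescaled eigenvalues in `[0, 2]`, so all `z_j` lie in
`[1/8, 1]`: the signal is not damped exponentially, and the gaps between the `z_j` stay inverse
polynomial. It remains to sample `2S + 1` values of `g` to inverse polynomial accuracy, and to show
that ESPRIT amplifies the error only polynomially when `S` is bounded.

Sampling. The pieces of `H + c` are diagonally dominant with non-positive off-diagonal entries, so
every `G = exp(-tA)` is a contraction with non-negative entries. The path weights are unbiased for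
the Trotter product. What makes the method efficient is the second moment: with Perron-guided steps,
probability times squared weight is the kernel `T(x,z) = G(x,z) λ φ(x)/φ(z)`, whose column sums are
`λ² ≤ 1` (`Params.walkStep_moments`). Products of such kernels keep column sums at most one, and
`|Φ(x₀)|² |Φ(x_L)/Φ(x₀)|² ≤ |Φ(x_L)|²`, so the second moment of a sample is at most `∑ |Φ|² = 1` for
any number of steps (`Params.pathSample_moments`). Chebyshev's inequality and a median of means
(`ev_mean_le`, `ev_median_le`) control the statistical error, and `norm_trotter_le` controls the
bias.

ESPRIT. The exact Hankel matrix is `∑ w_j v_j v_jᵀ` with `v_j = (1, z_j, …, z_j^S)`. No perturbation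
theory of singular subspaces is used, only the last left singular vector of the noisy matrix. Its
singular value is small because the coefficients of `∏ (X - z_j)` annihilate the exact matrix; hence
it is nearly orthogonal to each `v_j` (`last_singular_vector_le`), and `v_j` nearly lies in the span
of the first `S` columns. Deleting the last or the first entry of `v_j` gives vectors that differ by
the factor `z_j`, so `z_j U₀ - U₁` nearly annihilates a vector that is not small, and the
characteristic polynomial of `U₀⁻¹U₁` is small at `z_j` (`abs_charpoly_esprit_le`). Its value is `∏
(z_j - z̃_i)`, so some `z̃_i` is close to `z_j`; the gaps make this matching a permutation
(`esprit_stable`). All losses are powers with exponents bounded in terms of `S₀`.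

Program semantics enter only through the expectation `Prog.ev`, the predicate `Prog.Det` for steps
without randomness, and compositional cost bounds. -/

theorem Instr.finite_support_exec {β : Type} (i : Instr n N β) :
    (i.exec I).support.Finite := by
  cases i <;> simp only [Instr.exec, PMF.support_pure, Set.finite_singleton] <;> exact Set.toFinite _

/-- The expectation of `f` of the result of a program. -/
def Prog.ev {α : Type} : Prog n N α → (α → ℝ) → ℝ
  | .ret a, f => f a
  | .step i g, f => ∑' b, (i.exec I b).toReal * (g b).ev f

theorem Instr.tsum_eq_sum {β : Type} (i : Instr n N β) (f : β → ℝ) :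
    ∑' b, (i.exec I b).toReal * f b =
      ∑ b ∈ (i.finite_support_exec I).toFinset, (i.exec I b).toReal * f b := by
  apply _root_.tsum_eq_sum
  intro b hb
  have : i.exec I b = 0 := by simpa [PMF.mem_support_iff] using hb
  simp [this]

theorem Instr.sum_toReal {β : Type} (i : Instr n N β) :
    ∑ b ∈ (i.finite_support_exec I).toFinset, (i.exec I b).toReal = 1 := by
  have h : ∑' b, i.exec I b = ∑ b ∈ (i.finite_support_exec I).toFinset, i.exec I b :=
    _root_.tsum_eq_sum fun b hb => by simpa [PMF.mem_support_iff] using hb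
  rw [← ENNReal.toReal_sum fun b _ => PMF.apply_ne_top _ _, ← h, PMF.tsum_coe, ENNReal.toReal_one]

/-- Outcome distributions have finite support, so expectations are finite sums and linearity needs
no summability. -/
theorem Prog.ev_step {α β : Type} (i : Instr n N β) (g : β → Prog n N α) (f : α → ℝ) :
    (Prog.step i g).ev I f =
      ∑ b ∈ (i.finite_support_exec I).toFinset, (i.exec I b).toReal * (g b).ev I f :=
  i.tsum_eq_sum I _

@[simp] theorem Prog.ev_pure {α : Type} (a : α) (f : α → ℝ) :
    (pure a : Prog n N α).ev I f = f a := rfl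

theorem Prog.ev_bind {α γ : Type} (P : Prog n N α) (g : α → Prog n N γ) (f : γ → ℝ) :
    (P >>= g).ev I f = P.ev I fun a => (g a).ev I f := by
  change (P.bind g).ev I f = _
  induction P with
  | ret a => rfl
  | step i h ih => simp only [Prog.bind, Prog.ev, ih]

theorem Prog.ev_op {β : Type} (i : Instr n N β) (f : β → ℝ) :
    (op i).ev I f = ∑' b, (i.exec I b).toReal * f b := rfl

theorem Prog.ev_add {α : Type} (P : Prog n N α) (f g : α → ℝ) :
    P.ev I (fun a => f a + g a) = P.ev I f + P.ev I g := by
  induction P with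
  | ret a => rfl
  | step i h ih => simp only [Prog.ev_step, ih, mul_add, Finset.sum_add_distrib]

theorem Prog.ev_const_mul {α : Type} (P : Prog n N α) (c : ℝ) (f : α → ℝ) :
    P.ev I (fun a => c * f a) = c * P.ev I f := by
  induction P with
  | ret a => rfl
  | step i h ih =>
    simp only [Prog.ev_step, ih, Finset.mul_sum]
    exact Finset.sum_congr rfl fun b _ => by ring

theorem Prog.ev_mul_const {α : Type} (P : Prog n N α) (c : ℝ) (f : α → ℝ) :
    P.ev I (fun a => f a * c) = P.ev I f * c := by
  simpa only [mul_comm] using P.ev_const_mul I c f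

theorem Prog.ev_const {α : Type} (P : Prog n N α) (c : ℝ) : P.ev I (fun _ => c) = c := by
  induction P with
  | ret a => rfl
  | step i h ih => simp only [Prog.ev_step, ih, ← Finset.sum_mul, i.sum_toReal, one_mul]

theorem Prog.ev_mono {α : Type} (P : Prog n N α) {f g : α → ℝ} (h : ∀ a, f a ≤ g a) :
    P.ev I f ≤ P.ev I g := by
  induction P with
  | ret a => exact h a
  | step i h' ih =>
    simp only [Prog.ev_step]
    exact Finset.sum_le_sum fun b _ => mul_le_mul_of_nonneg_left (ih b) ENNReal.toReal_nonneg

theorem Prog.ev_nonneg {α : Type} (P : Prog n N α) {f : α → ℝ} (h : ∀ a, 0 ≤ f a) :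
    0 ≤ P.ev I f := by
  simpa only [P.ev_const] using P.ev_mono I (f := fun _ => 0) h

theorem Prog.ev_sum {α ι : Type} (P : Prog n N α) (s : Finset ι) (f : ι → α → ℝ) :
    P.ev I (fun a => ∑ j ∈ s, f j a) = ∑ j ∈ s, P.ev I (f j) := by
  classical
  induction s using Finset.induction_on with
  | empty => simpa using P.ev_const I 0
  | insert j s hj ih => simp only [Finset.sum_insert hj, P.ev_add, ih]

/-- The probability of an event is the expectation of its indicator function. -/
theorem Prog.prob_toReal {α : Type} (P : Prog n N α) (s : Set α) :
    (P.prob I s).toReal = P.ev I (s.indicator 1) := by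
  induction P with
  | ret a =>
    classical
    by_cases h : a ∈ s <;>
      simp [Prog.prob, Prog.run, Prog.ev, PMF.toOuterMeasure_pure_apply, Set.indicator, h]
  | step i g ih =>
    have hstep : (Prog.step i g).prob I s = ∑' b, i.exec I b * (g b).prob I s := by
      simp only [Prog.prob, Prog.run, PMF.toOuterMeasure_bind_apply,
        PMF.toOuterMeasure_map_apply]
      rfl
    have hone : ∀ b, (g b).prob I s ≠ ⊤ := fun b =>
      ne_top_of_le_ne_top ENNReal.one_ne_top
        ((((g b).run I).toOuterMeasure.mono (Set.subset_univ _)).trans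
          (((PMF.toOuterMeasure_apply_eq_one_iff _ _).2 (Set.subset_univ _)).le))
    rw [hstep, ENNReal.tsum_toReal_eq fun b =>
      ENNReal.mul_ne_top (PMF.apply_ne_top _ _) (hone b)]
    simp only [ENNReal.toReal_mul, ih, Prog.ev]

/-! ### Deterministic programs -/

/-- The program returns `a` with certainty. -/
def Prog.Det {α : Type} (P : Prog n N α) (a : α) : Prop := ∀ f, P.ev I f = f a

theorem Prog.Det.ev {α : Type} {P : Prog n N α} {a : α} (h : P.Det I a) (f : α → ℝ) :
    P.ev I f = f a := h f

theorem det_pure {α : Type} (a : α) : (pure a : Prog n N α).Det I a := fun _ => rfl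

theorem Prog.Det.bind {α γ : Type} {P : Prog n N α} {a : α} (h : P.Det I a)
    {g : α → Prog n N γ} {c : γ} (hg : (g a).Det I c) : (P >>= g).Det I c := fun f => by
  rw [Prog.ev_bind, h, hg]

theorem det_op {β : Type} (i : Instr n N β) (b : β) (h : i.exec I = PMF.pure b) :
    (op i).Det I b := fun f => by
  classical
  rw [Prog.ev_op, tsum_eq_single b]
  · simp [h]
  · intro c hc
    simp [h, PMF.pure_apply, hc]

theorem det_tab {α : Type} {m : ℕ} {f : Fin m → Prog n N α} {a : Fin m → α}
    (h : ∀ j, (f j).Det I (a j)) : (tab f).Det I a := by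
  induction m with
  | zero =>
    have : a = Fin.elim0 := Subsingleton.elim _ _
    subst this
    exact det_pure I _
  | succ m ih =>
    have hd : (tab f).Det I (Fin.cons (a 0) fun j => a j.succ) :=
      (h 0).bind I ((ih fun j => h j.succ).bind I (det_pure I _))
    have e : (Fin.cons (a 0) fun j => a j.succ) = a := Fin.cons_self_tail a
    rwa [e] at hd

theorem det_sumOver {ι : Type} {f : ι → Prog n N ℝ} {a : ι → ℝ} (h : ∀ j, (f j).Det I (a j))
    (l : List ι) : (sumOver f l).Det I (l.map a).sum := by
  induction l with
  | nil => exact det_pure I _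
  | cons j l ih => exact (h j).bind I (ih.bind I (det_op I _ _ rfl))

/-! ### Costs -/

theorem Prog.CostLE.mono {α : Type} {P : Prog n N α} {c d : ℕ} (h : P.CostLE I c) (hcd : c ≤ d) :
    P.CostLE I d := fun o ho => (h o ho).trans hcd

theorem costLE_pure {α : Type} (a : α) : (pure a : Prog n N α).CostLE I 0 := by
  intro o ho
  have : o = (a, 0) := by simpa [pure, Prog.run] using ho
  simp [this]

theorem Prog.CostLE.step {α β : Type} {i : Instr n N β} {g : β → Prog n N α} {c : ℕ}
    (h : ∀ b, (g b).CostLE I c) : (Prog.step i g).CostLE I (i.cost I + c) := by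
  intro o ho
  simp only [Prog.run, PMF.mem_support_bind_iff, PMF.mem_support_map_iff] at ho
  obtain ⟨b, -, o', ho', rfl⟩ := ho
  exact Nat.add_le_add_left (h b o' ho') _

theorem costLE_op {β : Type} (i : Instr n N β) : (op i).CostLE I (i.cost I) :=
  Prog.CostLE.step I (c := 0) fun b => costLE_pure I b

theorem Prog.CostLE.bind {α γ : Type} {P : Prog n N α} {g : α → Prog n N γ} {c d : ℕ}
    (hP : P.CostLE I c) (hg : ∀ a, (g a).CostLE I d) : (P >>= g).CostLE I (c + d) := by
  -- The induction compares individual runs, because a uniform bound `c` for `P` does not split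
  -- between its first instruction and the continuations.
  have key : ∀ o ∈ ((P.bind g).run I).support, ∃ o' ∈ (P.run I).support, o.2 ≤ o'.2 + d := by
    clear hP
    induction P with
    | ret a => exact fun o ho => ⟨(a, 0), by simp [Prog.run], by simpa using hg a o ho⟩
    | step i h ih =>
      intro o ho
      simp only [Prog.bind, Prog.run, PMF.mem_support_bind_iff, PMF.mem_support_map_iff] at ho
      obtain ⟨b, hb, o', ho', rfl⟩ := ho
      obtain ⟨o'', h1, h2⟩ := ih b o' ho'
      refine ⟨(o''.1, i.cost I + o''.2), ?_, by dsimp only; omega⟩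
      simp only [Prog.run, PMF.mem_support_bind_iff, PMF.mem_support_map_iff]
      exact ⟨b, hb, o'', h1, rfl⟩
  intro o ho
  obtain ⟨o', h1, h2⟩ := key o ho
  exact h2.trans (Nat.add_le_add_right (hP o' h1) d)

theorem costLE_tab {α : Type} {m c : ℕ} {f : Fin m → Prog n N α} (h : ∀ j, (f j).CostLE I c) :
    (tab f).CostLE I (m * c) := by
  induction m with
  | zero => rw [Nat.zero_mul]; exact costLE_pure I _
  | succ m ih =>
    refine ((h 0).bind I fun a => (ih fun j => h j.succ).bind I fun v =>
      costLE_pure I _).mono I ?_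
    rw [Nat.succ_mul]; omega

theorem costLE_sumOver {ι : Type} {c : ℕ} {f : ι → Prog n N ℝ} (h : ∀ j, (f j).CostLE I c)
    (l : List ι) : (sumOver f l).CostLE I (l.length * (c + 1)) := by
  induction l with
  | nil => rw [List.length_nil, Nat.zero_mul]; exact costLE_pure I _
  | cons j l ih =>
    refine Prog.CostLE.mono I (P := f j >>= fun v => sumOver f l >>= fun s => op (.add v s))
      ((h j).bind I fun a => ih.bind I fun v => costLE_op I _) ?_
    simp only [List.length_cons, Nat.succ_mul]; omega

theorem costLE_passThrough {ι σ : Type} {c : ℕ} {f : ι → σ → Prog n N σ} (l : List ι)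
    (h : ∀ j ∈ l, ∀ x, (f j x).CostLE I c) (x : σ) :
    (passThrough f l x).CostLE I (l.length * c) := by
  induction l generalizing x with
  | nil => rw [List.length_nil, Nat.zero_mul]; exact costLE_pure I _
  | cons j l ih =>
    refine ((h j (by simp) x).bind I fun a => ih (fun j hj => h j (by simp [hj])) a).mono I ?_
    rw [List.length_cons, Nat.succ_mul, Nat.add_comm]

/-! ### Independent repetitions -/

/-- This is independence: no program in the table sees the results of the others, so product test
functions factor. -/
theorem ev_tab_prod {α : Type} {m : ℕ} (f : Fin m → Prog n N α) (h : Fin m → α → ℝ) :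
    (tab f).ev I (fun v => ∏ j, h j (v j)) = ∏ j, (f j).ev I (h j) := by
  induction m with
  | zero => exact Eq.trans (by rfl) rfl
  | succ m ih =>
    change (f 0 >>= fun a => tab (fun j => f j.succ) >>= fun v =>
      pure (Fin.cons (α := fun _ => α) a v)).ev I _ = _
    simp only [Prog.ev_bind, Prog.ev_pure, Fin.prod_univ_succ, Fin.cons_zero, Fin.cons_succ,
      Prog.ev_const_mul, Prog.ev_mul_const, ih fun j => f j.succ]

/-- The marginal of one entry comes from `ev_tab_prod` with every other factor equal to one. -/
theorem ev_tab_apply {α : Type} {m : ℕ} (f : Fin m → Prog n N α) (j : Fin m) (h : α → ℝ) :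
    (tab f).ev I (fun v => h (v j)) = (f j).ev I h := by
  have := ev_tab_prod I f fun i a => if i = j then h a else 1
  rw [Finset.prod_eq_single j] at this
  · simp only [if_true] at this
    rw [← this]
    congr 1
    ext v
    rw [Finset.prod_eq_single j] <;> simp +contextual
  · intro i _ hi
    simp [hi, Prog.ev_const]
  · simp

/-- The mean and the second moment of a sum of independent samples. -/
theorem ev_sumOver_sq {ι : Type} {f : ι → Prog n N ℝ} {μ V : ℝ}
    (h1 : ∀ j, (f j).ev I (fun v => v - μ) = 0) (h2 : ∀ j, (f j).ev I (fun v => (v - μ) ^ 2) ≤ V)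
    (l : List ι) :
    (sumOver f l).ev I (fun s => s - l.length * μ) = 0 ∧
      (sumOver f l).ev I (fun s => (s - l.length * μ) ^ 2) ≤ l.length * V := by
  induction l with
  | nil => simp [sumOver]
  | cons j l ih =>
    have e1 : ∀ F : ℝ → ℝ, (sumOver f (j :: l)).ev I F =
        (f j).ev I fun v => (sumOver f l).ev I fun s => F (v + s) := by
      intro F
      change (f j >>= fun v => sumOver f l >>= fun s => op (.add v s)).ev I F = _
      rw [Prog.ev_bind]
      congr 1; ext v
      rw [Prog.ev_bind]
      congr 1; ext s
      exact det_op I (.add v s) (v + s) rfl F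
    have s1 : ∀ v s : ℝ, v + s - ((j :: l).length : ℕ) * μ = (v - μ) + (s - l.length * μ) := by
      intro v s; push_cast [List.length_cons]; ring
    -- The cross term disappears in expectation because the sum over the tail is centred.
    have s2 : ∀ v s : ℝ, (v + s - ((j :: l).length : ℕ) * μ) ^ 2 =
        (v - μ) ^ 2 + (2 * (v - μ) * (s - l.length * μ) + (s - l.length * μ) ^ 2) := by
      intro v s; rw [s1]; ring
    constructor
    · rw [e1]
      simp only [s1, Prog.ev_add, Prog.ev_const, ih.1, h1, add_zero]
    · rw [e1]
      simp only [s2, Prog.ev_add, Prog.ev_const, Prog.ev_const_mul, ih.1, mul_zero, zero_add]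
      have := add_le_add (h2 j) ih.2
      rw [List.length_cons]; push_cast; linarith

open Classical in
/-- Chebyshev's inequality for the mean of `m` independent samples. -/
theorem ev_mean_le {f : Prog n N ℝ} {μ V ε : ℝ} {m : ℕ} (hm : 0 < m) (hε : 0 < ε)
    (h1 : f.ev I (fun v => v) = μ) (h2 : f.ev I (fun v => v ^ 2) ≤ V) :
    (sumOver (fun _ : ℕ => f) (List.range m) >>= fun s => op (.div s m)).ev I
      (fun v => if ε < |v - μ| then 1 else 0) ≤ V / (m * ε ^ 2) := by
  have c1 : f.ev I (fun v => v - μ) = 0 := by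
    have := f.ev_add I (fun v => v) (fun _ => -μ)
    simp only [← sub_eq_add_neg, Prog.ev_const, h1] at this
    rw [this]; ring
  have c2 : f.ev I (fun v => (v - μ) ^ 2) ≤ V := by
    have e : (fun v : ℝ => (v - μ) ^ 2) = fun v => (v ^ 2 + (-2 * μ) * v) + μ ^ 2 := by ext; ring
    rw [e, Prog.ev_add, Prog.ev_add, Prog.ev_const_mul, Prog.ev_const, h1]
    nlinarith [sq_nonneg μ]
  have h3 := (ev_sumOver_sq I (f := fun _ : ℕ => f) (fun _ => c1) (fun _ => c2) (List.range m)).2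
  rw [List.length_range] at h3
  rw [Prog.ev_bind]
  have e : ∀ s : ℝ, (op (n := n) (N := N) (.div s m)).ev I
      (fun v => if ε < |v - μ| then 1 else 0) = if ε < |s / m - μ| then 1 else 0 := fun s =>
    det_op I (.div s m) (s / m) rfl _
  simp only [e]
  have hm' : (0 : ℝ) < m := by exact_mod_cast hm
  -- Markov's inequality for the squared deviation: the indicator is at most `(s - mμ)² / (mε)²`.
  refine (Prog.ev_mono I _ (g := fun s => (1 / (m * ε) ^ 2) * (s - m * μ) ^ 2) ?_).trans ?_
  · intro s
    split_ifs with h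
    · have e2 : s - m * μ = m * (s / m - μ) := by field_simp
      rw [e2, mul_pow, mul_pow, ← sq_abs (s / m - μ), one_div, inv_mul_eq_div,
        le_div_iff₀ (by positivity)]
      have : ε ^ 2 ≤ |s / m - μ| ^ 2 := by gcongr
      nlinarith [sq_nonneg (m : ℝ), mul_le_mul_of_nonneg_left this (sq_nonneg (m : ℝ))]
    · positivity
  · rw [Prog.ev_const_mul]
    refine (mul_le_mul_of_nonneg_left h3 (by positivity)).trans (le_of_eq ?_)
    field_simp

end Semantics

/-! ### Medians -/

/-- Take the smallest entry that has at least half of the list at or below it. Fewer than half of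
the entries are strictly smaller, since otherwise the largest of those would already qualify. -/
theorem medianPos_nonempty {q : ℕ} (hq : 0 < q) (v : Fin q → ℝ) : (medianPos v).Nonempty := by
  classical
  have hne : (Finset.univ : Finset (Fin q)).Nonempty := ⟨⟨0, hq⟩, Finset.mem_univ _⟩
  let A := Finset.univ.filter fun i : Fin q =>
    q ≤ 2 * (Finset.univ.filter fun j => v j ≤ v i).card
  have hA : A.Nonempty := by
    obtain ⟨i, -, hi⟩ := Finset.exists_max_image Finset.univ v hne
    refine ⟨i, Finset.mem_filter.2 ⟨Finset.mem_univ _, ?_⟩⟩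
    rw [Finset.filter_true_of_mem fun j _ => hi j (Finset.mem_univ _), Finset.card_univ,
      Fintype.card_fin]
    omega
  obtain ⟨i, hi, hmin⟩ := Finset.exists_min_image A v hA
  refine ⟨i, Finset.mem_filter.2 ⟨Finset.mem_univ _, (Finset.mem_filter.1 hi).2, ?_⟩⟩
  have hcard : (Finset.univ.filter fun j => v j < v i).card +
      (Finset.univ.filter fun j => v i ≤ v j).card = q := by
    have := Finset.card_filter_add_card_filter_not (s := (Finset.univ : Finset (Fin q)))
      (fun j => v j < v i)
    simpa [not_lt] using this
  rcases (Finset.univ.filter fun j => v j < v i).eq_empty_or_nonempty with h | h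
  · rw [h, Finset.card_empty] at hcard
    omega
  · obtain ⟨i', hi', hmax⟩ := Finset.exists_max_image _ v h
    have hlt : v i' < v i := (Finset.mem_filter.1 hi').2
    have hn : i' ∉ A := fun h' => absurd (hmin i' h') (not_le.2 hlt)
    have hsub : (Finset.univ.filter fun j => v j < v i) ⊆
        Finset.univ.filter fun j => v j ≤ v i' := fun j hj =>
      Finset.mem_filter.2 ⟨Finset.mem_univ _, hmax j hj⟩
    have := Finset.card_le_card hsub
    have h2 : 2 * (Finset.univ.filter fun j => v j ≤ v i').card < q := by
      simpa [A] using hn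
    omega

open Classical in
/-- If the median is off by more than `ε`, then so are at least half of the numbers. -/
theorem card_bad_of_median_bad {q : ℕ} (hq : 0 < q) (v : Fin q → ℝ) {μ ε : ℝ}
    (h : ε < |median v - μ|) : q ≤ 2 * (Finset.univ.filter fun j => ε < |v j - μ|).card := by
  have hne := medianPos_nonempty hq v
  have hi := Finset.min'_mem _ hne
  set i := (medianPos v).min' hne
  have hm : median v = v i := by
    unfold median; rw [dif_pos hne]
  rw [hm] at h
  obtain ⟨-, h1, h2⟩ := Finset.mem_filter.1 hi
  rcases lt_abs.1 h with h | h
  · refine le_trans (b := 2 * (Finset.univ.filter fun j => v i ≤ v j).card) (by convert h2) ?_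
    gcongr 2 * ?_
    refine Finset.card_le_card fun j hj => ?_
    have := (Finset.mem_filter.1 hj).2
    exact Finset.mem_filter.2 ⟨Finset.mem_univ _, lt_abs.2 (Or.inl (by linarith))⟩
  · refine le_trans (b := 2 * (Finset.univ.filter fun j => v j ≤ v i).card) (by convert h1) ?_
    gcongr 2 * ?_
    refine Finset.card_le_card fun j hj => ?_
    have := (Finset.mem_filter.1 hj).2
    exact Finset.mem_filter.2 ⟨Finset.mem_univ _, lt_abs.2 (Or.inr (by linarith))⟩

/-- The rate in the Chernoff bound for the median: the base squares to `3/4 = 1 - 1/4 ≤ exp(-1/4)`.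
-/
theorem sqrt_three_pow_le (q : ℕ) : (3 / 2 : ℝ) ^ q / Real.sqrt 3 ^ q ≤ Real.exp (-(q / 8)) := by
  have h0 : (3 / 2 : ℝ) / Real.sqrt 3 ≤ Real.exp (-(1 / 8)) := by
    have h1 : ((3 / 2 : ℝ) / Real.sqrt 3) ^ 2 ≤ Real.exp (-(1 / 8)) ^ 2 := by
      rw [div_pow, Real.sq_sqrt (by norm_num), ← Real.exp_nat_mul]
      have := Real.add_one_le_exp (((2 : ℕ) : ℝ) * -(1 / 8))
      refine le_trans ?_ this
      norm_num
    exact (pow_le_pow_iff_left₀ (by positivity) (Real.exp_pos _).le two_ne_zero).1 h1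
  rw [← div_pow, show -((q : ℝ) / 8) = q * (-(1 / 8)) by ring, Real.exp_nat_mul]
  exact pow_le_pow_left₀ (by positivity) h0 q

open Classical in
/-- The median of `q` independent numbers, each of which is off with probability at most `1/4`. -/
theorem ev_median_le {n k N : ℕ} (I : Input n k N) {q : ℕ} (hq : 0 < q) {f : Prog n N ℝ}
    {μ ε : ℝ} (h : f.ev I (fun v => if ε < |v - μ| then 1 else 0) ≤ 1 / 4) :
    (tab (fun _ : Fin q => f) >>= fun v => op (.median v)).ev I
      (fun v => if ε < |v - μ| then 1 else 0) ≤ Real.exp (-(q / 8)) := by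
  have e : ∀ v : Fin q → ℝ, (op (n := n) (N := N) (.median v)).ev I
      (fun v => if ε < |v - μ| then 1 else 0) = if ε < |median v - μ| then 1 else 0 := fun v =>
    det_op I (.median v) (median v) rfl _
  rw [Prog.ev_bind]
  simp only [e]
  -- Chernoff weights: 3 for a bad number and 1 for a good one. A bad median needs at least `q/2`
  -- bad numbers, so the product is at least `√3 ^ q`, while each factor has mean at most `1 + 2/4 =
  -- 3/2`.
  let w : ℝ → ℝ := fun v => 1 + 2 * if ε < |v - μ| then 1 else 0
  have hw : ∀ v, w v = if ε < |v - μ| then 3 else 1 := fun v => by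
    simp only [w]; split_ifs <;> norm_num
  have h3 : (0 : ℝ) < Real.sqrt 3 := Real.sqrt_pos.2 (by norm_num)
  refine (Prog.ev_mono I _ (g := fun v => (1 / Real.sqrt 3 ^ q) * ∏ j, w (v j)) ?_).trans ?_
  · intro v
    have hnn : ∀ j, 0 ≤ w (v j) := fun j => by rw [hw]; split_ifs <;> norm_num
    split_ifs with hb
    · have hc := card_bad_of_median_bad hq v hb
      have hp : ∏ j, w (v j) = 3 ^ (Finset.univ.filter fun j => ε < |v j - μ|).card := by
        simp only [hw]
        rw [← Finset.prod_filter_mul_prod_filter_not Finset.univ (fun j => ε < |v j - μ|),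
          Finset.prod_congr rfl (g := fun _ => (3 : ℝ)) (fun j hj => if_pos (Finset.mem_filter.1 hj).2),
          Finset.prod_congr rfl (s₁ := Finset.univ.filter fun j => ¬ ε < |v j - μ|)
            (g := fun _ => (1 : ℝ)) (fun j hj => if_neg (Finset.mem_filter.1 hj).2)]
        simp
      rw [hp, one_div, inv_mul_eq_div, one_le_div (by positivity)]
      calc Real.sqrt 3 ^ q
          ≤ Real.sqrt 3 ^ (2 * (Finset.univ.filter fun j => ε < |v j - μ|).card) :=
            pow_le_pow_right₀ (Real.one_le_sqrt.2 (by norm_num)) hc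
        _ = _ := by rw [pow_mul, Real.sq_sqrt (by norm_num)]
    · exact mul_nonneg (by positivity) (Finset.prod_nonneg fun j _ => hnn j)
  · rw [Prog.ev_const_mul, ev_tab_prod I (fun _ => f) fun _ => w]
    have hle : f.ev I w ≤ 3 / 2 := by
      simp only [w, Prog.ev_add, Prog.ev_const, Prog.ev_const_mul]
      linarith
    have h0 : 0 ≤ f.ev I w := f.ev_nonneg I fun v => by rw [hw]; split_ifs <;> norm_num
    rw [Finset.prod_const, Finset.card_univ, Fintype.card_fin]
    refine le_trans ?_ (sqrt_three_pow_le q)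
    rw [one_div, inv_mul_eq_div]
    gcongr

/-! ### Matrix exponentials -/

section Exponential

open scoped Matrix.Norms.L2Operator

/-- An intertwining relation passes to powers and then to the exponential series. `V` is rectangular
so that the lemma serves both for invariant coordinate blocks and for a partial list of
eigenvectors. -/
theorem exp_mul_eq_mul_exp {𝕜 ι κ : Type*} [RCLike 𝕜] [Fintype ι] [DecidableEq ι] [Fintype κ]
    [DecidableEq κ] {A : Matrix ι ι 𝕜} {B : Matrix κ κ 𝕜} {V : Matrix ι κ 𝕜} (h : A * V = V * B) :
    NormedSpace.exp A * V = V * NormedSpace.exp B := by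
  have hp : ∀ j : ℕ, A ^ j * V = V * B ^ j := by
    intro j
    induction j with
    | zero => simp
    | succ j ih => rw [pow_succ, Matrix.mul_assoc, h, ← Matrix.mul_assoc, ih, Matrix.mul_assoc,
        ← pow_succ]
  have hA := (NormedSpace.exp_series_hasSum_exp' (𝕂 := 𝕜) A).map
    (⟨⟨fun X => X * V, Matrix.zero_mul _⟩, fun X Y => Matrix.add_mul X Y V⟩ :
      Matrix ι ι 𝕜 →+ Matrix ι κ 𝕜) (continuous_id.matrix_mul continuous_const)
  have hB := (NormedSpace.exp_series_hasSum_exp' (𝕂 := 𝕜) B).map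
    (⟨⟨fun X => V * X, Matrix.mul_zero _⟩, fun X Y => Matrix.mul_add V X Y⟩ :
      Matrix κ κ 𝕜 →+ Matrix ι κ 𝕜) (continuous_const.matrix_mul continuous_id)
  refine hA.unique (hB.congr_fun fun j => ?_)
  simp [hp]

theorem exp_map_ofReal {ι : Type*} [Fintype ι] [DecidableEq ι] (A : Matrix ι ι ℝ) :
    (NormedSpace.exp A).map (algebraMap ℝ ℂ) = NormedSpace.exp (A.map (algebraMap ℝ ℂ)) := by
  have hA := (NormedSpace.exp_series_hasSum_exp' (𝕂 := ℝ) A).map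
    ((algebraMap ℝ ℂ).mapMatrix : Matrix ι ι ℝ →+* Matrix ι ι ℂ)
    (continuous_id.matrix_map Complex.continuous_ofReal)
  have hB := NormedSpace.exp_series_hasSum_exp' (𝕂 := ℂ) (A.map (algebraMap ℝ ℂ))
  refine hA.unique (hB.congr_fun fun j => ?_)
  have e : (A.map (algebraMap ℝ ℂ)) ^ j = (A ^ j).map (algebraMap ℝ ℂ) :=
    (map_pow (algebraMap ℝ ℂ).mapMatrix A j).symm
  rw [e]
  ext a b
  simp

variable {ι : Type*} [Fintype ι] [DecidableEq ι]

theorem sum_sq_mulVec_le (A : Matrix ι ι ℝ) (v : ι → ℝ) :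
    ∑ i, A.mulVec v i ^ 2 ≤ ‖A‖ ^ 2 * ∑ i, v i ^ 2 := by
  have h := A.l2_opNorm_mulVec (WithLp.toLp 2 v)
  have h2 := pow_le_pow_left₀ (norm_nonneg _) h 2
  rw [mul_pow, EuclideanSpace.norm_sq_eq, EuclideanSpace.norm_sq_eq] at h2
  simpa using h2

theorem dotProduct_mulVec_le_norm (A : Matrix ι ι ℝ) (v : ι → ℝ) :
    |v ⬝ᵥ A.mulVec v| ≤ ‖A‖ * ∑ i, v i ^ 2 := by
  have h1 : (v ⬝ᵥ A.mulVec v) ^ 2 ≤ (∑ i, v i ^ 2) * ∑ i, A.mulVec v i ^ 2 :=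
    Finset.sum_mul_sq_le_sq_mul_sq _ _ _
  have h0 : 0 ≤ ∑ i, v i ^ 2 := Finset.sum_nonneg fun i _ => sq_nonneg _
  refine abs_le_of_sq_le_sq (h1.trans ?_) (by positivity)
  calc _ ≤ (∑ i, v i ^ 2) * (‖A‖ ^ 2 * ∑ i, v i ^ 2) :=
        mul_le_mul_of_nonneg_left (sum_sq_mulVec_le A v) h0
    _ = _ := by ring

/-- The Schur test for a symmetric matrix. -/
theorem norm_le_of_row_sum_le {A : Matrix ι ι ℝ} (hA : A.IsSymm) {β : ℝ} (hβ : 0 ≤ β)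
    (h : ∀ i, ∑ j, |A i j| ≤ β) : ‖A‖ ≤ β := by
  rw [← Matrix.l2_opNorm_toEuclideanCLM]
  refine ContinuousLinearMap.opNorm_le_bound _ hβ fun v => ?_
  refine abs_le_of_sq_le_sq' ?_ (by positivity) |>.2
  rw [mul_pow, EuclideanSpace.norm_sq_eq, EuclideanSpace.norm_sq_eq]
  simp only [Matrix.ofLp_toEuclideanCLM, Real.norm_eq_abs, sq_abs]
  have h1 : ∀ i, A.mulVec v i ^ 2 ≤ β * ∑ j, |A i j| * v j ^ 2 := by
    intro i
    -- The entry is split as `√|A i j| · √|A i j|`, so that one factor of Cauchy–Schwarz is the row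
    -- sum.
    have e : |A.mulVec v i| ≤ ∑ j, Real.sqrt |A i j| * (Real.sqrt |A i j| * |v j|) := by
      refine (Finset.abs_sum_le_sum_abs _ _).trans (le_of_eq (Finset.sum_congr rfl fun j _ => ?_))
      rw [← mul_assoc, Real.mul_self_sqrt (abs_nonneg _), abs_mul]
    have e2 := pow_le_pow_left₀ (abs_nonneg _) e 2
    rw [sq_abs] at e2
    refine e2.trans ((Finset.sum_mul_sq_le_sq_mul_sq _ _ _).trans ?_)
    simp only [mul_pow, Real.sq_sqrt (abs_nonneg _), sq_abs]
    exact mul_le_mul_of_nonneg_right (h i)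
      (Finset.sum_nonneg fun j _ => mul_nonneg (abs_nonneg _) (sq_nonneg _))
  refine (Finset.sum_le_sum fun i _ => h1 i).trans ?_
  rw [← Finset.mul_sum, Finset.sum_comm, pow_two, mul_assoc]
  refine mul_le_mul_of_nonneg_left ?_ hβ
  rw [Finset.mul_sum]
  refine Finset.sum_le_sum fun j _ => ?_
  rw [← Finset.sum_mul]
  refine mul_le_mul_of_nonneg_right ?_ (sq_nonneg _)
  refine le_trans (le_of_eq ?_) (h j)
  exact Finset.sum_congr rfl fun i _ => by rw [hA.apply]

/-- A symmetric diagonally dominant matrix is positive semidefinite. -/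
theorem posSemidef_of_diag_dominant {A : Matrix ι ι ℝ} (hA : A.IsSymm)
    (h : ∀ i, ∑ j ∈ Finset.univ.erase i, |A i j| ≤ A i i) : A.PosSemidef := by
  refine Matrix.PosSemidef.of_dotProduct_mulVec_nonneg (by rwa [Matrix.isHermitian_iff_isSymm]) fun v => ?_
  have e : star v ⬝ᵥ A.mulVec v = ∑ i, ∑ j, A i j * (v i * v j) := by
    simp only [dotProduct, Matrix.mulVec, Finset.mul_sum, Pi.star_apply, star_trivial]
    exact Finset.sum_congr rfl fun i _ => Finset.sum_congr rfl fun j _ => by ring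
  rw [e]
  let B : ι → ι → ℝ := fun i j => if j = i then 0 else |A i j|
  have hB : ∀ i, ∑ j, B i j ≤ A i i := fun i => by
    refine le_trans (le_of_eq ?_) (h i)
    rw [← Finset.sum_erase (a := i) Finset.univ (by simp [B])]
    exact Finset.sum_congr rfl fun j hj => by simp [B, (Finset.mem_erase.1 hj).1]
  have hBs : ∀ i j, B i j = B j i := fun i j => by simp only [B, hA.apply i j, eq_comm]
  -- From `2|v_i v_j| ≤ v_i² + v_j²`. After symmetrization, row `i` charges its off-diagonal sum to
  -- `v_i²`, which the diagonal entry can pay.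
  have h1 : ∀ i j, (if j = i then A i i * v i ^ 2 else 0) - B i j * (v i ^ 2 / 2 + v j ^ 2 / 2) ≤
      A i j * (v i * v j) := by
    intro i j
    by_cases hij : j = i
    · subst hij; simp [B, pow_two]
    · simp only [B, if_neg hij]
      have h2 : |A i j * (v i * v j)| ≤ |A i j| * (v i ^ 2 / 2 + v j ^ 2 / 2) := by
        rw [abs_mul]
        refine mul_le_mul_of_nonneg_left ?_ (abs_nonneg _)
        rw [abs_le]; constructor <;> nlinarith [sq_nonneg (v i + v j), sq_nonneg (v i - v j)]
      linarith [neg_abs_le (A i j * (v i * v j))]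
  refine le_trans ?_ (Finset.sum_le_sum fun i _ => Finset.sum_le_sum fun j _ => h1 i j)
  have e2 : ∑ i, ∑ j, B i j * (v j ^ 2 / 2) = ∑ i, ∑ j, B i j * (v i ^ 2 / 2) := by
    rw [Finset.sum_comm]
    exact Finset.sum_congr rfl fun i _ => Finset.sum_congr rfl fun j _ => by rw [hBs]
  simp only [Finset.sum_sub_distrib, mul_add, Finset.sum_add_distrib, e2,
    Finset.sum_ite_eq', Finset.mem_univ, if_true]
  rw [← Finset.sum_add_distrib, ← Finset.sum_sub_distrib]
  refine Finset.sum_nonneg fun i _ => ?_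
  rw [← Finset.sum_mul]
  nlinarith [mul_le_mul_of_nonneg_right (hB i) (sq_nonneg (v i))]

/-- By functional calculus these are the scalar bounds for `exp(-x)`, `1 - exp(-x)` and `exp(-x) - 1
+ x` on the spectrum, which lies in `[0, ‖A‖]`. -/
theorem exp_neg_sub_bounds {A : Matrix ι ι ℝ} (hA : A.PosSemidef) :
    ‖NormedSpace.exp (-A)‖ ≤ 1 ∧ ‖1 - NormedSpace.exp (-A)‖ ≤ ‖A‖ ∧
      ‖NormedSpace.exp (-A) - 1 + A‖ ≤ ‖A‖ ^ 2 := by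
  have hsa : IsSelfAdjoint A := hA.isHermitian
  have hexp : cfc (fun x : ℝ => Real.exp (-x)) A = NormedSpace.exp (-A) := by
    rw [← CFC.real_exp_eq_normedSpace_exp hsa.neg, cfc_comp_neg Real.exp A]
  have hspec : ∀ x ∈ spectrum ℝ A, 0 ≤ x ∧ x ≤ ‖A‖ := by
    intro x hx
    have h0 := (Matrix.posSemidef_iff_isHermitian_and_spectrum_nonneg.1 hA).2 hx
    have : Nonempty ι := by
      by_contra hne
      rw [not_nonempty_iff] at hne
      have : Subsingleton (Matrix ι ι ℝ) := inferInstance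
      simp [spectrum.of_subsingleton] at hx
    refine ⟨h0, (le_abs_self x).trans ?_⟩
    have := norm_apply_le_norm_cfc (fun x : ℝ => x) A hx
    rwa [cfc_id' ℝ A] at this
  have h1 : cfc (fun x : ℝ => 1 - Real.exp (-x)) A = 1 - NormedSpace.exp (-A) := by
    rw [cfc_sub (fun _ => 1) (fun x : ℝ => Real.exp (-x)) A, hexp, cfc_const_one ℝ A]
  have h2 : cfc (fun x : ℝ => Real.exp (-x) - 1 + x) A = NormedSpace.exp (-A) - 1 + A := by
    rw [cfc_add A (fun x : ℝ => Real.exp (-x) - 1) (fun x => x),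
      cfc_sub (fun x : ℝ => Real.exp (-x)) (fun _ => 1) A, hexp, cfc_const_one ℝ A, cfc_id' ℝ A]
  refine ⟨?_, ?_, ?_⟩
  · rw [← hexp]
    refine norm_cfc_le zero_le_one fun x hx => ?_
    rw [Real.norm_eq_abs, Real.abs_exp]
    exact Real.exp_le_one_iff.2 (by linarith [(hspec x hx).1])
  · rw [← h1]
    refine norm_cfc_le (norm_nonneg _) fun x hx => ?_
    obtain ⟨h0, hle⟩ := hspec x hx
    rw [Real.norm_eq_abs, abs_of_nonneg (by simpa using h0)]
    linarith [Real.add_one_le_exp (-x)]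
  · rw [← h2]
    refine norm_cfc_le (sq_nonneg _) fun x hx => ?_
    obtain ⟨h0, hle⟩ := hspec x hx
    have h3 := Real.add_one_le_exp (-x)
    rw [Real.norm_eq_abs, abs_of_nonneg (by linarith)]
    -- Multiply by `exp x ≥ 1 + x + x²/2`: the product `(1 - x + x²)(1 + x + x²/2)` is `1` plus
    -- non-negative terms.
    have h4 : Real.exp (-x) ≤ 1 - x + x ^ 2 := by
      have h5 := Real.quadratic_le_exp_of_nonneg h0
      have h6 : Real.exp (-x) * Real.exp x = 1 := by rw [← Real.exp_add]; simp
      have h7 : (1 - x + x ^ 2) * Real.exp x ≥ 1 := by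
        nlinarith [mul_le_mul_of_nonneg_left h5 (show 0 ≤ 1 - x + x ^ 2 by nlinarith),
          pow_nonneg h0 3, pow_nonneg h0 4]
      nlinarith [Real.exp_pos x]
    nlinarith

/-- The first-order Trotter formula, for one step. -/
theorem norm_list_prod_exp_le {a : Type*} (A : a → Matrix ι ι ℝ) {β : ℝ}
    (l : List a) (hA : ∀ i ∈ l, (A i).PosSemidef ∧ ‖A i‖ ≤ β) :
    ‖(l.map fun i => NormedSpace.exp (-(A i))).prod - 1 + (l.map A).sum‖ ≤ (l.length * β) ^ 2 := by
  induction l with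
  | nil => simp
  | cons i l ih =>
    have hl := ih fun j hj => hA j (List.mem_cons_of_mem _ hj)
    obtain ⟨hp, hb⟩ := hA i (by simp)
    have hβ : 0 ≤ β := (norm_nonneg _).trans hb
    obtain ⟨e1, e2, e3⟩ := exp_neg_sub_bounds hp
    set P := (l.map fun i => NormedSpace.exp (-(A i))).prod
    set Tl := (l.map A).sum
    have hT : ‖Tl‖ ≤ l.length * β := by
      have hs : ∀ l' : List a, (∀ j ∈ l', ‖A j‖ ≤ β) → ‖(l'.map A).sum‖ ≤ l'.length * β := by
        intro l' h'
        induction l' with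
        | nil => simp
        | cons j l' ih' =>
          rw [List.map_cons, List.sum_cons, List.length_cons]
          refine (norm_add_le _ _).trans ?_
          have := ih' fun i hi => h' i (List.mem_cons_of_mem _ hi)
          have := h' j (by simp)
          push_cast; linarith
      exact hs l fun j hj => (hA j (List.mem_cons_of_mem _ hj)).2
    rw [List.map_cons, List.prod_cons, List.map_cons, List.sum_cons, List.length_cons]
    set X := NormedSpace.exp (-(A i))
    -- The three summands cost `(ℓβ)²`, `β²` and `ℓβ²`, where `ℓ` is the length of the tail;
    -- together they are at most `((ℓ+1)β)²`.
    have e : X * P - 1 + (A i + Tl) = X * (P - 1 + Tl) + (X - 1 + A i) + (1 - X) * Tl := by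
      noncomm_ring
    rw [e]
    have n1 : ‖X * (P - 1 + Tl)‖ ≤ (l.length * β) ^ 2 :=
      (norm_mul_le _ _).trans ((mul_le_mul e1 hl (norm_nonneg _) zero_le_one).trans (by rw [one_mul]))
    have n2 : ‖X - 1 + A i‖ ≤ β ^ 2 := e3.trans (pow_le_pow_left₀ (norm_nonneg _) hb 2)
    have n3 : ‖(1 - X) * Tl‖ ≤ β * (l.length * β) :=
      (norm_mul_le _ _).trans (mul_le_mul (e2.trans hb) hT (norm_nonneg _) hβ)
    refine (norm_add₃_le).trans ?_
    push_cast
    nlinarith [mul_nonneg (Nat.cast_nonneg (α := ℝ) l.length) (sq_nonneg β)]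

/-- Telescoping for contractions: replacing one factor at a time costs `‖P - Q‖` each time. -/
theorem norm_pow_sub_pow_le {P Q : Matrix ι ι ℝ} (hP : ‖P‖ ≤ 1) (hQ : ‖Q‖ ≤ 1) (M : ℕ) :
    ‖P ^ M - Q ^ M‖ ≤ M * ‖P - Q‖ := by
  by_cases hne : Nonempty ι
  swap
  · have : IsEmpty ι := not_nonempty_iff.1 hne
    have h0 : P ^ M - Q ^ M = 0 := Subsingleton.elim _ _
    rw [h0, norm_zero]; positivity
  have hpow : ∀ j : ℕ, ‖P ^ j‖ ≤ 1 := fun j => by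
    induction j with
    | zero => rw [pow_zero, ← Matrix.diagonal_one, Matrix.l2_opNorm_diagonal]
              exact (pi_norm_le_iff_of_nonneg zero_le_one).2 fun i => by simp
    | succ j ih =>
      rw [pow_succ]
      exact (norm_mul_le _ _).trans (mul_le_one₀ ih (norm_nonneg _) hP)
  induction M with
  | zero => simp
  | succ M ih =>
    have e : P ^ (M + 1) - Q ^ (M + 1) = P ^ M * (P - Q) + (P ^ M - Q ^ M) * Q := by
      rw [pow_succ, pow_succ]; noncomm_ring
    rw [e]
    refine (norm_add_le _ _).trans ?_
    have n1 : ‖P ^ M * (P - Q)‖ ≤ 1 * ‖P - Q‖ :=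
      (norm_mul_le _ _).trans (mul_le_mul_of_nonneg_right (hpow M) (norm_nonneg _))
    have n2 : ‖(P ^ M - Q ^ M) * Q‖ ≤ (M * ‖P - Q‖) * 1 :=
      (norm_mul_le _ _).trans (mul_le_mul ih hQ (norm_nonneg _) (by positivity))
    push_cast; linarith

theorem norm_list_prod_le_one {a : Type*} [Nonempty ι] (G : a → Matrix ι ι ℝ) (l : List a)
    (hG : ∀ i ∈ l, ‖G i‖ ≤ 1) : ‖(l.map G).prod‖ ≤ 1 := by
  induction l with
  | nil =>
    rw [List.map_nil, List.prod_nil, ← Matrix.diagonal_one, Matrix.l2_opNorm_diagonal]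
    exact (pi_norm_le_iff_of_nonneg zero_le_one).2 fun i => by simp
  | cons i l ih =>
    rw [List.map_cons, List.prod_cons]
    exact (norm_mul_le _ _).trans (mul_le_one₀ (hG i (by simp)) (norm_nonneg _)
      (ih fun j hj => hG j (List.mem_cons_of_mem _ hj)))

/-- The first-order Trotter formula. -/
theorem norm_trotter_le {a : Type*} [Nonempty ι] (A : a → Matrix ι ι ℝ) {β : ℝ} (l : List a)
    (hA : ∀ i ∈ l, (A i).PosSemidef ∧ ‖A i‖ ≤ β) (M : ℕ) :
    ‖(l.map fun i => NormedSpace.exp (-(A i))).prod ^ M -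
      NormedSpace.exp (-(M • (l.map A).sum))‖ ≤ M * (2 * (l.length * β) ^ 2) := by
  have hs : ∀ l' : List a, (∀ i ∈ l', (A i).PosSemidef ∧ ‖A i‖ ≤ β) →
      ((l'.map A).sum).PosSemidef ∧ ‖(l'.map A).sum‖ ≤ l'.length * β := by
    intro l' h'
    induction l' with
    | nil => simpa using Matrix.PosSemidef.zero
    | cons i l' ih =>
      have h1 := ih fun j hj => h' j (List.mem_cons_of_mem _ hj)
      have h2 := h' i (by simp)
      rw [List.map_cons, List.sum_cons, List.length_cons]
      refine ⟨h2.1.add h1.1, (norm_add_le _ _).trans ?_⟩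
      push_cast; linarith
  obtain ⟨hp, hb⟩ := hs l hA
  obtain ⟨e1, -, e3⟩ := exp_neg_sub_bounds hp
  have hexp : NormedSpace.exp (-(M • (l.map A).sum)) = NormedSpace.exp (-(l.map A).sum) ^ M := by
    rw [← Matrix.exp_nsmul, smul_neg]
  have h1 := norm_list_prod_exp_le A l hA
  have hP : ‖(l.map fun i => NormedSpace.exp (-(A i))).prod‖ ≤ 1 :=
    norm_list_prod_le_one _ l fun i hi => (exp_neg_sub_bounds (hA i hi).1).1
  rw [hexp]
  refine (norm_pow_sub_pow_le hP e1 M).trans (mul_le_mul_of_nonneg_left ?_ (Nat.cast_nonneg M))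
  set P := (l.map fun i => NormedSpace.exp (-(A i))).prod
  set Q := NormedSpace.exp (-(l.map A).sum)
  -- Both one-step propagators agree with `1 - ∑ A` up to second order; this gives the factor 2.
  have e : P - Q = (P - 1 + (l.map A).sum) - (Q - 1 + (l.map A).sum) := by abel
  rw [e]
  refine (norm_sub_le _ _).trans ?_
  have := e3.trans (pow_le_pow_left₀ (norm_nonneg _) hb 2)
  linarith

/-- If `A ≤ 0` off the diagonal, then `exp (-A) ≥ 0`, with positive diagonal. -/
theorem exp_neg_nonneg {A : Matrix ι ι ℝ} (hA : ∀ i j, i ≠ j → A i j ≤ 0) :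
    (∀ i j, 0 ≤ NormedSpace.exp (-A) i j) ∧ ∀ i, 0 < NormedSpace.exp (-A) i i := by
  -- With this `c` the matrix `c - A` has non-negative entries, so each term of its exponential
  -- series does too, and the zeroth term makes the diagonal positive. The scalar factor `exp(-c)`
  -- is positive.
  let c : ℝ := ∑ i, |A i i|
  let B : Matrix ι ι ℝ := c • 1 - A
  have hB : ∀ i j, 0 ≤ B i j := by
    intro i j
    by_cases h : i = j
    · subst h
      have : |A i i| ≤ c :=
        Finset.single_le_sum (f := fun i => |A i i|) (fun j _ => abs_nonneg _) (Finset.mem_univ i)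
      simp [B]; linarith [le_abs_self (A i i)]
    · simpa [B, h] using hA i j h
  have hpow : ∀ (m : ℕ) i j, 0 ≤ (B ^ m) i j := by
    intro m
    induction m with
    | zero => intro i j; rw [pow_zero, Matrix.one_apply]; split_ifs <;> norm_num
    | succ m ih =>
      intro i j
      rw [pow_succ, Matrix.mul_apply]
      exact Finset.sum_nonneg fun l _ => mul_nonneg (ih i l) (hB l j)
  have hsum : ∀ i j, HasSum (fun m : ℕ => ((m.factorial : ℝ)⁻¹ • B ^ m) i j)
      (NormedSpace.exp B i j) := fun i j =>
    (NormedSpace.exp_series_hasSum_exp' (𝕂 := ℝ) B).map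
      (⟨⟨fun X => X i j, rfl⟩, fun X Y => rfl⟩ : Matrix ι ι ℝ →+ ℝ) (continuous_id.matrix_elem i j)
  have hterm : ∀ (m : ℕ) i j, 0 ≤ ((m.factorial : ℝ)⁻¹ • B ^ m) i j := fun m i j => by
    rw [Matrix.smul_apply, smul_eq_mul]
    exact mul_nonneg (by positivity) (hpow m i j)
  have hexp : NormedSpace.exp (-A) = Real.exp (-c) • NormedSpace.exp B := by
    have e : -A = (-c) • (1 : Matrix ι ι ℝ) + B := by simp only [B, neg_smul]; abel
    rw [e, Matrix.exp_add_of_commute _ _ ((Commute.one_left B).smul_left _)]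
    have e2 : NormedSpace.exp ((-c) • (1 : Matrix ι ι ℝ)) = Real.exp (-c) • 1 := by
      rw [Matrix.smul_one_eq_diagonal, Matrix.exp_diagonal, Matrix.smul_one_eq_diagonal]
      rw [Pi.exp_def, Real.exp_eq_exp_ℝ]
    rw [e2, Matrix.smul_mul, Matrix.one_mul]
  have hpos := Real.exp_pos (-c)
  constructor
  · intro i j
    rw [hexp, Matrix.smul_apply, smul_eq_mul]
    exact mul_nonneg hpos.le ((hsum i j).nonneg fun m => hterm m i j)
  · intro i
    rw [hexp, Matrix.smul_apply, smul_eq_mul]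
    refine mul_pos hpos (lt_of_lt_of_le one_pos ?_)
    have := le_hasSum (hsum i i) 0 fun m _ => hterm m i i
    simpa using this

end Exponential

/-! ### Perron–Frobenius data -/

section Perron

variable {ι : Type*} [Fintype ι]

/-- A non-negative eigenvector supported on a union `C` of irreducible blocks. -/
theorem exists_nonneg_eigenvector {G : Matrix ι ι ℝ} (hs : G.IsSymm) (h0 : ∀ i j, 0 ≤ G i j)
    {C : Set ι} (hC : ∀ i j, G i j ≠ 0 → i ∈ C → j ∈ C) {i₀ : ι} (hi₀ : i₀ ∈ C) :
    ∃ (v : ι → ℝ) (lam : ℝ), (∀ i, 0 ≤ v i) ∧ v ≠ 0 ∧ (∀ i, i ∉ C → v i = 0) ∧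
      G.mulVec v = lam • v := by
  classical
  -- The eigenvector is found by maximizing the quadratic form over unit vectors supported on `C`.
  let Q : (ι → ℝ) → ℝ := fun v => v ⬝ᵥ G.mulVec v
  let K : Set (ι → ℝ) := {v | ∑ i, v i ^ 2 = 1 ∧ ∀ i, i ∉ C → v i = 0}
  have hQ : Continuous Q := by unfold Q; fun_prop
  have hK : IsCompact K := by
    refine (isCompact_closedBall (0 : ι → ℝ) 1).of_isClosed_subset ?_ ?_
    · have e : K = {v | ∑ i, v i ^ 2 = 1} ∩ ⋂ i, ⋂ (_ : i ∉ C), {v | v i = 0} := by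
        ext v; simp [K]
      rw [e]
      exact (isClosed_eq (by fun_prop) continuous_const).inter (isClosed_iInter fun i =>
        isClosed_iInter fun _ => isClosed_eq (continuous_apply i) continuous_const)
    · intro v hv
      rw [mem_closedBall_zero_iff, pi_norm_le_iff_of_nonneg zero_le_one]
      intro i
      have h1 : v i ^ 2 ≤ 1 := hv.1 ▸
        Finset.single_le_sum (f := fun i => v i ^ 2) (fun j _ => sq_nonneg _) (Finset.mem_univ i)
      exact abs_le_one_iff_mul_self_le_one.2 (by nlinarith)
  have hne : K.Nonempty := by
    refine ⟨Pi.single i₀ 1, ?_, fun i hi => ?_⟩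
    · simp [Pi.single_apply, ite_pow]
    · have : i ≠ i₀ := fun h => hi (h ▸ hi₀)
      simp [this]
  obtain ⟨w, hw, hmax⟩ := hK.exists_isMaxOn hne hQ.continuousOn
  set lam := Q w
  -- As the entries of `G` are non-negative, passing to absolute values does not decrease the form,
  -- so `v` is a maximizer as well.
  let v : ι → ℝ := fun i => |w i|
  have hv1 : ∑ i, v i ^ 2 = 1 := by simpa [v, sq_abs] using hw.1
  have hvC : ∀ i, i ∉ C → v i = 0 := fun i hi => by simp [v, hw.2 i hi]
  have hscale : ∀ (c : ℝ) (u : ι → ℝ), Q (c • u) = c ^ 2 * Q u := fun c u => by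
    simp only [Q, Matrix.mulVec_smul, smul_dotProduct, dotProduct_smul, smul_eq_mul]; ring
  have hle : ∀ u : ι → ℝ, (∀ i, i ∉ C → u i = 0) → Q u ≤ lam * ∑ i, u i ^ 2 := by
    intro u hu
    rcases (Finset.sum_nonneg fun i (_ : i ∈ Finset.univ) => sq_nonneg (u i)).eq_or_lt with h | h
    · have hz : u = 0 := by
        ext i
        have := (Finset.sum_eq_zero_iff_of_nonneg fun i _ => sq_nonneg (u i)).1 h.symm i
          (Finset.mem_univ i)
        simpa using this
      simp [hz, Q]
    · set s := ∑ i, u i ^ 2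
      have hs0 : 0 < Real.sqrt s := Real.sqrt_pos.2 h
      have hmem : (Real.sqrt s)⁻¹ • u ∈ K := by
        refine ⟨?_, fun i hi => by simp [hu i hi]⟩
        simp only [Pi.smul_apply, smul_eq_mul, mul_pow, ← Finset.mul_sum, inv_pow,
          Real.sq_sqrt h.le]
        exact inv_mul_cancel₀ h.ne'
      have h2 := hmax hmem
      simp only [Set.mem_ofPred_eq, hscale, inv_pow, Real.sq_sqrt h.le] at h2
      rw [inv_mul_le_iff₀ h] at h2
      linarith
  have hQv : lam ≤ Q v := by
    simp only [lam, Q, dotProduct, Matrix.mulVec, Finset.mul_sum]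
    refine Finset.sum_le_sum fun i _ => Finset.sum_le_sum fun j _ => ?_
    have := mul_le_mul_of_nonneg_left (le_abs_self (w i * w j)) (h0 i j)
    rw [abs_mul] at this
    simp only [v]; linarith
  have hQv' : Q v = lam := le_antisymm (by simpa [hv1] using hle v hvC) hQv
  refine ⟨v, lam, fun i => abs_nonneg _, ?_, hvC, ?_⟩
  · rintro h
    simp [h] at hv1
  · ext i
    by_cases hi : i ∈ C
    · have hquad : ∀ t : ℝ, 0 ≤ (lam - G i i) * (t * t) + 2 * (lam * v i - G.mulVec v i) * t + 0 := by
        intro t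
        have h1 := hle (v + t • Pi.single i 1) fun j hj => by
          have : j ≠ i := fun h => hj (h ▸ hi)
          simp [hvC j hj, this]
        have hsymm : ∀ u u' : ι → ℝ, u ⬝ᵥ G.mulVec u' = u' ⬝ᵥ G.mulVec u := fun u u' => by
          rw [Matrix.dotProduct_mulVec, ← Matrix.mulVec_transpose, hs.eq, dotProduct_comm]
        have e1 : Q (v + t • Pi.single i 1) = lam + 2 * t * G.mulVec v i + t ^ 2 * G i i := by
          rw [← hQv']
          simp only [Q, Matrix.mulVec_add, add_dotProduct, dotProduct_add, Matrix.mulVec_smul,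
            smul_dotProduct, dotProduct_smul, smul_eq_mul, hsymm v (Pi.single i 1)]
          simp
          ring
        have e2 : ∑ j, (v + t • (Pi.single i 1 : ι → ℝ)) j ^ 2 = 1 + 2 * t * v i + t ^ 2 := by
          have : ∀ j, (v + t • (Pi.single i 1 : ι → ℝ)) j ^ 2 =
              v j ^ 2 + (if j = i then 2 * t * v i + t ^ 2 else 0) := by
            intro j
            by_cases h : j = i
            · subst h; simp; ring
            · simp [h]
          simp only [this, Finset.sum_add_distrib, hv1]
          simp; ring
        rw [e1, e2] at h1
        nlinarith
      have := discrim_le_zero hquad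
      unfold discrim at this
      have h3 : lam * v i - G.mulVec v i = 0 := by nlinarith
      simp only [Pi.smul_apply, smul_eq_mul]; linarith
    · rw [Pi.smul_apply, hvC i hi, smul_zero]
      refine Finset.sum_eq_zero fun j _ => ?_
      by_cases hj : j ∈ C
      · have : G i j = 0 := by
          by_contra hG
          exact hi (hC j i (by rwa [hs.apply]) hj)
        simp [this]
      · simp [hvC j hj]

/-- The irreducible blocks are the classes of the equivalence relation generated by `G i j ≠ 0`. A
non-negative eigenvector is chosen on each class. If it vanishes at a point it vanishes at all
neighbours, since its image there is a vanishing sum of non-negative terms, hence on the whole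
class; so it is strictly positive there, and the pieces can be glued. -/
theorem exists_perron {G : Matrix ι ι ℝ} (hs : G.IsSymm) (h0 : ∀ i j, 0 ≤ G i j) :
    ∃ φ lam : ι → ℝ, (∀ i, 0 < φ i) ∧ (∀ i j, G i j ≠ 0 → lam i = lam j) ∧
      ∀ i, G.mulVec φ i = lam i * φ i := by
  classical
  let st : Setoid ι := Relation.EqvGen.setoid fun i j => G i j ≠ 0
  have hadj : ∀ i j, G i j ≠ 0 → (Quotient.mk st i) = Quotient.mk st j := fun i j h =>
    Quotient.sound (Relation.EqvGen.rel _ _ h)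
  have hex : ∀ q : Quotient st, ∃ (v : ι → ℝ) (lam : ℝ), (∀ i, 0 ≤ v i) ∧ v ≠ 0 ∧
      (∀ i, i ∉ {j | Quotient.mk st j = q} → v i = 0) ∧ G.mulVec v = lam • v := by
    intro q
    obtain ⟨i, rfl⟩ := Quotient.exists_rep q
    exact exists_nonneg_eigenvector hs h0 (i₀ := i)
      (fun a b hab (ha : _ = _) => (hadj a b hab).symm.trans ha) rfl
  choose v lam hv hv0 hvC hG using hex
  have hpos : ∀ i, 0 < v (Quotient.mk st i) i := by
    intro i
    set q := Quotient.mk st i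
    have hstep : ∀ a b, G a b ≠ 0 → v q a = 0 → v q b = 0 := by
      intro a b hab ha
      have h1 : G.mulVec (v q) a = 0 := by rw [hG, Pi.smul_apply, ha, smul_zero]
      have h2 := (Finset.sum_eq_zero_iff_of_nonneg fun j _ =>
        mul_nonneg (h0 a j) (hv q j)).1 h1 b (Finset.mem_univ b)
      exact (mul_eq_zero.1 h2).resolve_left hab
    have hrel : ∀ a b, Relation.EqvGen (fun i j => G i j ≠ 0) a b → (v q a = 0 ↔ v q b = 0) := by
      intro a b hab
      induction hab with
      | rel a b h => exact ⟨hstep a b h, hstep b a (by rwa [hs.apply])⟩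
      | refl => exact Iff.rfl
      | symm a b _ ih => exact ih.symm
      | trans a b c _ _ ih1 ih2 => exact ih1.trans ih2
    refine (hv q i).lt_of_ne' fun hz => hv0 q ?_
    ext j
    by_cases hj : Quotient.mk st j = q
    · exact (hrel i j (Quotient.exact hj.symm)).1 hz
    · exact hvC q j hj
  refine ⟨fun i => v (Quotient.mk st i) i, fun i => lam (Quotient.mk st i), hpos,
    fun i j h => congrArg lam (hadj i j h), fun i => ?_⟩
  have := congrFun (hG (Quotient.mk st i)) i
  rw [Pi.smul_apply, smul_eq_mul] at this
  rw [← this]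
  refine Finset.sum_congr rfl fun j _ => ?_
  by_cases h : G i j = 0
  · simp [h]
  · simp only [hadj i j h]

/-- Perron–Frobenius data are unique, up to a factor on each irreducible block. -/
theorem perron_unique {G : Matrix ι ι ℝ} (hs : G.IsSymm) (h0 : ∀ i j, 0 ≤ G i j)
    {φ lam ψ μ : ι → ℝ} (hφ : ∀ i, 0 < φ i) (hlam : ∀ i j, G i j ≠ 0 → lam i = lam j)
    (hGφ : ∀ i, G.mulVec φ i = lam i * φ i) (hψ : ∀ i, 0 < ψ i)
    (hμ : ∀ i j, G i j ≠ 0 → μ i = μ j) (hGψ : ∀ i, G.mulVec ψ i = μ i * ψ i) :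
    lam = μ ∧ ∀ i j, G i j ≠ 0 → φ i * ψ j = φ j * ψ i := by
  -- The ground-state identity: the Dirichlet form of `ψ/φ`, weighted by an `f` that is constant on
  -- blocks, measures the difference of the eigenvalues.
  have key : ∀ {φ lam ψ μ : ι → ℝ}, (∀ i, 0 < φ i) → (∀ i, G.mulVec φ i = lam i * φ i) →
      (∀ i, G.mulVec ψ i = μ i * ψ i) → ∀ f : ι → ℝ, (∀ i j, G i j ≠ 0 → f i = f j) →
      ∑ i, ∑ j, G i j * φ i * φ j * f i * (ψ i / φ i - ψ j / φ j) ^ 2 =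
        2 * ∑ i, f i * (lam i - μ i) * ψ i ^ 2 := by
    intro φ lam ψ μ hφ hGφ hGψ f hf
    have e1 : ∀ i j, G i j * φ i * φ j * f i * (ψ i / φ i - ψ j / φ j) ^ 2 =
        f i * ψ i ^ 2 / φ i * (G i j * φ j) + f j * ψ j ^ 2 / φ j * (G j i * φ i) -
          2 * (f i * ψ i * (G i j * ψ j)) := by
      intro i j
      have hi := (hφ i).ne'
      have hj := (hφ j).ne'
      by_cases h : G i j = 0
      · have h' : G j i = 0 := by rw [hs.apply, h]
        simp [h, h']
      · rw [← hf i j h, hs.apply]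
        field_simp
        ring
    have e2 : ∀ i, ∑ j, f i * ψ i ^ 2 / φ i * (G i j * φ j) = f i * lam i * ψ i ^ 2 := by
      intro i
      rw [← Finset.mul_sum, show ∑ j, G i j * φ j = _ from hGφ i]
      have hi := (hφ i).ne'
      field_simp
    have e3 : ∀ i, ∑ j, 2 * (f i * ψ i * (G i j * ψ j)) = 2 * (f i * μ i * ψ i ^ 2) := by
      intro i
      rw [← Finset.mul_sum, ← Finset.mul_sum, show ∑ j, G i j * ψ j = _ from hGψ i]
      ring
    simp only [e1, Finset.sum_add_distrib, Finset.sum_sub_distrib]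
    rw [Finset.sum_comm (f := fun i j => f j * ψ j ^ 2 / φ j * (G j i * φ i))]
    simp only [e2, e3]
    rw [← Finset.sum_add_distrib, ← Finset.sum_sub_distrib, Finset.mul_sum]
    exact Finset.sum_congr rfl fun i _ => by ring
  have hle : ∀ {φ lam ψ μ : ι → ℝ}, (∀ i, 0 < φ i) → (∀ i j, G i j ≠ 0 → lam i = lam j) →
      (∀ i, G.mulVec φ i = lam i * φ i) → (∀ i, 0 < ψ i) →
      (∀ i j, G i j ≠ 0 → μ i = μ j) → (∀ i, G.mulVec ψ i = μ i * ψ i) → ∀ i, μ i ≤ lam i := by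
    intro φ lam ψ μ hφ hlam hGφ hψ hμ hGψ i
    -- With the positive part of `μ - lam` as weight, the left side is non-negative and the right
    -- side non-positive, so the positive part vanishes.
    have h1 := key hφ hGφ hGψ (fun i => max (μ i - lam i) 0) fun i j h => by
      rw [hlam i j h, hμ i j h]
    have hl : 0 ≤ 2 * ∑ i, max (μ i - lam i) 0 * (lam i - μ i) * ψ i ^ 2 := by
      rw [← h1]
      refine Finset.sum_nonneg fun i _ => Finset.sum_nonneg fun j _ => ?_
      have := h0 i j
      have := (hφ i).le
      have := (hφ j).le
      have := le_max_right (μ i - lam i) 0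
      positivity
    have hterm : ∀ i ∈ Finset.univ, max (μ i - lam i) 0 * (lam i - μ i) * ψ i ^ 2 ≤ 0 := by
      intro i _
      rcases le_total (μ i - lam i) 0 with h | h
      · simp [max_eq_right h]
      · rw [max_eq_left h]
        nlinarith [mul_nonneg (mul_nonneg h h) (sq_nonneg (ψ i))]
    have hz := (Finset.sum_eq_zero_iff_of_nonpos hterm).1
      (le_antisymm (Finset.sum_nonpos hterm) (by linarith)) i (Finset.mem_univ i)
    by_contra hlt
    rw [not_le] at hlt
    rw [max_eq_left (by linarith)] at hz
    have : 0 < (μ i - lam i) * (μ i - lam i) * ψ i ^ 2 :=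
      mul_pos (mul_pos (by linarith) (by linarith)) (pow_pos (hψ i) 2)
    nlinarith
  have heq : lam = μ := funext fun i => le_antisymm (hle hψ hμ hGψ hφ hlam hGφ i)
    (hle hφ hlam hGφ hψ hμ hGψ i)
  refine ⟨heq, fun i j hij => ?_⟩
  -- Now that the eigenvalues agree, the unweighted Dirichlet form is zero, so `ψ/φ` takes equal
  -- values at indices joined by a non-zero entry.
  have h1 := key hφ hGφ hGψ (fun _ => 1) fun _ _ _ => rfl
  simp only [heq, sub_self, mul_zero, zero_mul, Finset.sum_const_zero] at h1
  have hnn : ∀ i j, 0 ≤ G i j * φ i * φ j * 1 * (ψ i / φ i - ψ j / φ j) ^ 2 := fun i j => by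
    have := h0 i j
    have := (hφ i).le
    have := (hφ j).le
    positivity
  have h2 := (Finset.sum_eq_zero_iff_of_nonneg fun i _ =>
    Finset.sum_nonneg fun j _ => hnn i j).1 h1 i (Finset.mem_univ i)
  have h3 := (Finset.sum_eq_zero_iff_of_nonneg fun j _ => hnn i j).1 h2 j (Finset.mem_univ j)
  have hi := (hφ i).ne'
  have hj := (hφ j).ne'
  have h4 : ψ i / φ i - ψ j / φ j = 0 := by
    simpa [hij, hi, hj] using h3
  rw [sub_eq_zero, div_eq_div_iff hi hj] at h4
  linarith

-- Cutting `φ` down to a level set of `lam` gives a genuine eigenvector, because `G` does not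
-- connect different level sets; its eigenvalue is then bounded by the norm.
open scoped Matrix.Norms.L2Operator in
theorem perron_abs_le_one [DecidableEq ι] {G : Matrix ι ι ℝ} (hn : ‖G‖ ≤ 1)
    {φ lam : ι → ℝ} (hφ : ∀ i, 0 < φ i) (hlam : ∀ i j, G i j ≠ 0 → lam i = lam j)
    (hGφ : ∀ i, G.mulVec φ i = lam i * φ i) (i : ι) : lam i ^ 2 ≤ 1 := by
  let u : ι → ℝ := fun j => if lam j = lam i then φ j else 0
  have hu : ∀ j, G.mulVec u j = lam i * u j := by
    intro j
    by_cases h : lam j = lam i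
    · simp only [u, if_pos h]
      rw [← h, ← hGφ j]
      refine Finset.sum_congr rfl fun l _ => ?_
      by_cases hG : G j l = 0
      · simp [hG]
      · simp only [(hlam j l hG).symm, if_true]
    · simp only [u, if_neg h, mul_zero]
      refine Finset.sum_eq_zero fun l _ => ?_
      by_cases hG : G j l = 0
      · simp [hG]
      · simp only [(hlam j l hG).symm, h, if_false, mul_zero]
  have h1 := sum_sq_mulVec_le G u
  simp only [hu, mul_pow, ← Finset.mul_sum] at h1
  have hpos : 0 < ∑ j, u j ^ 2 := by
    refine Finset.sum_pos' (fun j _ => sq_nonneg _) ⟨i, Finset.mem_univ i, ?_⟩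
    simp only [u, if_true]
    exact pow_pos (hφ i) 2
  have h2 := le_of_mul_le_mul_right h1 hpos
  exact h2.trans (pow_le_one₀ (norm_nonneg _) hn)

end Perron

/-! ### Bit flips, and the moments of the random walk -/

theorem flipAt_injective {n : ℕ} (x : Bits n) : Function.Injective fun s => flipAt s x := by
  intro s s' h
  ext i
  have := congrFun h i
  simp only [flipAt] at this
  by_cases h1 : i ∈ s <;> by_cases h2 : i ∈ s' <;> simp_all

@[simp] theorem flipAt_empty {n : ℕ} (x : Bits n) : flipAt ∅ x = x := by
  ext i; simp [flipAt]

theorem flipAt_flipAt {n : ℕ} (s : Finset (Fin n)) (x : Bits n) : flipAt s (flipAt s x) = x := by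
  ext i; by_cases h : i ∈ s <;> simp [flipAt, h]

section Walk

variable {n k N : ℕ} (I : Input n k N)

theorem ev_draw {m : ℕ} (w : Fin (m + 1) → ℝ) (h0 : ∀ j, 0 ≤ w j) (h1 : ∑ j, w j = 1)
    (f : Fin (m + 1) → ℝ) : (op (.draw w)).ev I f = ∑ j, w j * f j := by
  have hs : ∑' i, ENNReal.ofReal (w i) = 1 := by
    rw [tsum_fintype, ← ENNReal.ofReal_sum_of_nonneg fun i _ => h0 i, h1, ENNReal.ofReal_one]
  rw [Prog.ev_op, tsum_fintype]
  refine Finset.sum_congr rfl fun j _ => ?_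
  congr 1
  simp only [Instr.exec, drawPMF]
  rw [dif_pos (by rw [hs]; exact one_ne_zero), PMF.normalize_apply, hs, inv_one, mul_one,
    ENNReal.toReal_ofReal (h0 j)]

theorem ev_mul (a b : ℝ) (f : ℝ → ℝ) : (op (.mul a b)).ev I f = f (a * b) :=
  det_op I (.mul a b) _ rfl f

theorem ev_div (a b : ℝ) (f : ℝ → ℝ) : (op (.div a b)).ev I f = f (a / b) :=
  det_op I (.div a b) _ rfl f

theorem ev_ratio (x y : Bits n) (f : ℂ → ℝ) : (op (.ratio x y)).ev I f = f (I.Φ y / I.Φ x) :=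
  det_op I (.ratio x y) _ rfl f

theorem ev_sample (f : Bits n → ℝ) :
    (op (.sample)).ev I f = ∑ x, ‖I.Φ x‖ ^ 2 * f x := by
  rw [Prog.ev_op, tsum_fintype]
  refine Finset.sum_congr rfl fun x _ => ?_
  congr 1
  simp only [Instr.exec, bornPMF, PMF.ofFintype_apply]
  exact ENNReal.toReal_ofReal (sq_nonneg _)

/-- The matrix `a` is the one that the algorithm reads for the piece `A`: it is a positive
semidefinite matrix with non-positive off-diagonal entries, and it decomposes into the blocks
that are spanned by the moves of `A`. -/
structure Params.Represents (p : Params n N) (A : Piece n N) (a : Matrix (Bits n) (Bits n) ℝ) :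
    Prop where
  posSemidef : a.PosSemidef
  off_diag : ∀ x y, x ≠ y → a x y ≤ 0
  nodup : (∅ :: p.moves A).Nodup
  entry : ∀ x, ∀ s ∈ ∅ :: p.moves A, ∀ s' ∈ ∅ :: p.moves A,
    (p.pieceEntry A (flipAt s x) (flipAt s' x)).Det I (a (flipAt s x) (flipAt s' x))
  closed : ∀ x, ∀ s ∈ ∅ :: p.moves A, ∀ z, a (flipAt s x) z ≠ 0 →
    ∃ s' ∈ ∅ :: p.moves A, z = flipAt s' x

/-- The matrix exponential of a block is a block of the matrix exponential. -/
theorem exp_submatrix {ι κ : Type*} [Fintype ι] [DecidableEq ι] [Fintype κ] [DecidableEq κ]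
    {a : Matrix ι ι ℝ} (ha : a.IsSymm) {y : κ → ι} (hy : Function.Injective y)
    (hc : ∀ j z, z ∉ Set.range y → a (y j) z = 0) :
    (∀ i j, NormedSpace.exp (a.submatrix y y) i j = NormedSpace.exp a (y i) (y j)) ∧
      ∀ j z, z ∉ Set.range y → NormedSpace.exp a (y j) z = 0 := by
  -- The isometry that includes the coordinates of the block; invariance of the block says that it
  -- intertwines `a` with its submatrix.
  let V : Matrix ι κ ℝ := Matrix.of fun z j => if z = y j then 1 else 0
  have hmulV : ∀ (B : Matrix ι ι ℝ) z j, (B * V) z j = B z (y j) := fun B z j => by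
    simp [Matrix.mul_apply, V]
  have hVmul : ∀ (B : Matrix κ κ ℝ) i j, (V * B) (y i) j = B i j := fun B i j => by
    simp [Matrix.mul_apply, V, hy.eq_iff]
  have hVmul' : ∀ (B : Matrix κ κ ℝ) z j, z ∉ Set.range y → (V * B) z j = 0 := fun B z j hz => by
    rw [Matrix.mul_apply]
    refine Finset.sum_eq_zero fun i _ => ?_
    have : z ≠ y i := fun h => hz ⟨i, h.symm⟩
    simp [V, this]
  have hint : a * V = V * a.submatrix y y := by
    ext z j
    rw [hmulV]
    by_cases hz : z ∈ Set.range y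
    · obtain ⟨i, rfl⟩ := hz
      rw [hVmul]; rfl
    · rw [hVmul' _ _ _ hz, ← ha.apply, hc j z hz]
  have hexp := exp_mul_eq_mul_exp hint
  have hsymm : (NormedSpace.exp a).IsSymm := ha.exp
  refine ⟨fun i j => ?_, fun j z hz => ?_⟩
  · rw [← hVmul (NormedSpace.exp (a.submatrix y y)) i j, ← hexp, hmulV]
  · rw [← hsymm.apply, ← hmulV (NormedSpace.exp a) z j, hexp, hVmul' _ _ _ hz]

/-- A matrix with non-negative entries and column sums at most one. -/
def IsColSubstochastic {ι : Type*} [Fintype ι] (T : Matrix ι ι ℝ) : Prop :=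
  (∀ i j, 0 ≤ T i j) ∧ ∀ j, ∑ i, T i j ≤ 1

theorem IsColSubstochastic.one {ι : Type*} [Fintype ι] [DecidableEq ι] :
    IsColSubstochastic (1 : Matrix ι ι ℝ) :=
  ⟨fun i j => by rw [Matrix.one_apply]; split_ifs <;> norm_num, fun j => by
    simp [Matrix.one_apply]⟩

theorem IsColSubstochastic.mul {ι : Type*} [Fintype ι] {S T : Matrix ι ι ℝ}
    (hS : IsColSubstochastic S) (hT : IsColSubstochastic T) : IsColSubstochastic (S * T) := by
  refine ⟨fun i j => ?_, fun j => ?_⟩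
  · rw [Matrix.mul_apply]
    exact Finset.sum_nonneg fun l _ => mul_nonneg (hS.1 i l) (hT.1 l j)
  · simp only [Matrix.mul_apply]
    rw [Finset.sum_comm]
    refine le_trans (Finset.sum_le_sum fun l _ => ?_) (hT.2 j)
    rw [← Finset.sum_mul]
    exact mul_le_of_le_one_left (hT.1 l j) (hS.2 l)

/-- The first two moments of the weight that a random step `f` accumulates. -/
def HasMoments (f : Bits n × ℝ → Prog n N (Bits n × ℝ)) (G T : Matrix (Bits n) (Bits n) ℝ) :
    Prop :=
  ∀ x R F, (f (x, R)).ev I (fun o => o.2 * F o.1) = R * G.mulVec F x ∧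
    (f (x, R)).ev I (fun o => o.2 ^ 2 * F o.1) = R ^ 2 * T.mulVec F x

/-- The Markov property. As `F` is arbitrary in `HasMoments`, the moment of the remaining steps can
serve as test function for the first one, and the kernels multiply in the order of the list. -/
theorem HasMoments.passThrough {ι : Type} {f : ι → Bits n × ℝ → Prog n N (Bits n × ℝ)}
    {G T : ι → Matrix (Bits n) (Bits n) ℝ} (l : List ι)
    (h : ∀ j ∈ l, HasMoments I (f j) (G j) (T j)) :
    HasMoments I (passThrough f l) (l.map G).prod (l.map T).prod := by
  induction l with
  | nil => intro x R F; simp [StoqMC.passThrough]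
  | cons j l ih =>
    intro x R F
    have ih' := ih fun i hi => h i (List.mem_cons_of_mem _ hi)
    have e : ∀ H : Bits n × ℝ → ℝ, (StoqMC.passThrough f (j :: l) (x, R)).ev I H =
        (f j (x, R)).ev I fun o => (StoqMC.passThrough f l (o.1, o.2)).ev I H := fun H =>
      Prog.ev_bind I _ _ _
    have hj := h j (by simp) x R
    simp only [List.map_cons, List.prod_cons, ← Matrix.mulVec_mulVec]
    exact ⟨by rw [e]; simp only [fun x R => (ih' x R F).1]; exact (hj _).1,
      by rw [e]; simp only [fun x R => (ih' x R F).2]; exact (hj _).2⟩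

open scoped Matrix.Norms.L2Operator in
/-- The moments of the weight in one step of the random walk. -/
theorem Params.walkStep_moments {p : Params n N} {A : Piece n N}
    {a : Matrix (Bits n) (Bits n) ℝ} (h : p.Represents I A a) {t : ℝ} (ht : 0 ≤ t) :
    ∃ T, IsColSubstochastic T ∧
      HasMoments I (p.walkStep t A) (NormedSpace.exp (-(t • a))) T := by
  classical
  have hsa : a.IsSymm := by
    rw [← Matrix.isHermitian_iff_isSymm]; exact h.posSemidef.isHermitian
  have hst : (-(t • a)).IsSymm := (hsa.smul t).neg
  set G := NormedSpace.exp (-(t • a)) with hGdef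
  have hGs : G.IsSymm := hst.exp
  obtain ⟨hG0, hGd⟩ := exp_neg_nonneg (A := t • a) fun x y hxy => by
    rw [Matrix.smul_apply, smul_eq_mul]
    exact mul_nonpos_of_nonneg_of_nonpos ht (h.off_diag x y hxy)
  have hGn : ‖G‖ ≤ 1 := (exp_neg_sub_bounds (h.posSemidef.smul ht)).1
  -- Perron data of the full propagator serve as a reference that does not depend on the current
  -- string. Here `Φ` and `Λ` denote these data, not the state and the scale.
  obtain ⟨Φ, Λ, hΦ, hΛ, hGΦ⟩ := exists_perron hGs hG0
  have hΛpos : ∀ x, 0 < Λ x := by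
    intro x
    have h1 : G x x * Φ x ≤ G.mulVec Φ x :=
      Finset.single_le_sum (f := fun y => G x y * Φ y)
        (fun y _ => mul_nonneg (hG0 x y) (hΦ y).le) (Finset.mem_univ x)
    rw [hGΦ] at h1
    exact pos_of_mul_pos_left (lt_of_lt_of_le (mul_pos (hGd x) (hΦ x)) h1) (hΦ x).le
  have hΛ1 : ∀ x, Λ x ^ 2 ≤ 1 := perron_abs_le_one hGn hΦ hΛ hGΦ
  -- A step to `z` has probability `GΦ(z)/(ΛΦ(x))` and weight `ΛΦ(x)/Φ(z)`, so probability times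
  -- squared weight is this kernel. By symmetry of `G` and constancy of `Λ` on blocks, column `z`
  -- sums to `Λ(z)²`.
  refine ⟨Matrix.of fun x z => G x z * (Λ x * Φ x / Φ z), ⟨fun x z => ?_, fun z => ?_⟩, ?_⟩
  · exact mul_nonneg (hG0 x z) (div_nonneg (mul_nonneg (hΛpos x).le (hΦ x).le) (hΦ z).le)
  · refine le_trans (le_of_eq ?_) (hΛ1 z)
    have e : ∀ x, Matrix.of (fun x z => G x z * (Λ x * Φ x / Φ z)) x z =
        Λ z / Φ z * (G z x * Φ x) := by
      intro x
      by_cases hg : G x z = 0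
      · have : G z x = 0 := by rw [hGs.apply, hg]
        simp [hg, this]
      · simp only [Matrix.of_apply]
        rw [hΛ x z hg, hGs.apply z x]
        ring
    simp only [e]
    rw [← Finset.mul_sum, show ∑ x, G z x * Φ x = _ from hGΦ z]
    have := (hΦ z).ne'
    field_simp
  · intro x R F
    set l := p.moves A with hl
    let y : Fin (l.length + 1) → Bits n := fun j => flipAt ((∅ :: l).get j) x
    have hy : Function.Injective y := (flipAt_injective x).comp h.nodup.injective_get
    have hy0 : y 0 = x := flipAt_empty x
    have hmem : ∀ j, (∅ :: l).get j ∈ ∅ :: l := fun j => List.get_mem _ _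
    have hclosed : ∀ j z, z ∉ Set.range y → (-(t • a)) (y j) z = 0 := by
      intro j z hz
      have : a (y j) z = 0 := by
        by_contra hne
        obtain ⟨s', hs', rfl⟩ := h.closed x _ (hmem j) z hne
        obtain ⟨i, rfl⟩ := List.get_of_mem hs'
        exact hz ⟨i, rfl⟩
      simp [this]
    obtain ⟨hblk, hblk0⟩ := exp_submatrix hst hy hclosed
    rw [← hGdef] at hblk hblk0
    have hsum : ∀ i (f : Bits n → ℝ), ∑ j, G (y i) (y j) * f (y j) = G.mulVec f (y i) := by
      intro i f
      rw [Matrix.mulVec, dotProduct, ← Finset.sum_image (s := Finset.univ) (g := y)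
        (f := fun z => G (y i) z * f z) fun _ _ _ _ hh => hy hh]
      refine Finset.sum_subset (Finset.subset_univ _) fun z _ hz => ?_
      rw [hblk0 i z fun ⟨j, hj⟩ => hz (Finset.mem_image.2 ⟨j, Finset.mem_univ _, hj⟩), zero_mul]
    let ab : Matrix (Fin (l.length + 1)) (Fin (l.length + 1)) ℝ :=
      Matrix.of fun i j => a (y i) (y j)
    set Gb := NormedSpace.exp (-(t • ab)) with hGb
    have hGbij : ∀ i j, Gb i j = G (y i) (y j) := hblk
    -- The restricted reference data witness that Perron data of the block exist. The chosen data
    -- may differ by a factor on each irreducible block, but the step uses only ratios within one,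
    -- which `perron_unique` identifies.
    have hspec : IsPerron Gb (perron Gb).1 (perron Gb).2 := by
      refine Classical.epsilon_spec
        (p := fun d : (Fin (l.length + 1) → ℝ) × (Fin (l.length + 1) → ℝ) => IsPerron Gb d.1 d.2)
        ⟨(Φ ∘ y, Λ ∘ y), fun i => hΦ _, fun i j hij => hΛ _ _ (by rwa [hGbij] at hij), fun i => ?_⟩
      simp only [Matrix.mulVec, dotProduct, hGbij, Function.comp]
      rw [hsum i Φ, hGΦ]
    set φ := (perron Gb).1
    set lam := (perron Gb).2
    obtain ⟨hφ, hlam, hGφ⟩ := hspec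
    have hGbs : Gb.IsSymm := by ext i j; rw [Matrix.transpose_apply, hGbij, hGbij, hGs.apply]
    obtain ⟨hlamΛ, hratio⟩ := perron_unique hGbs (fun i j => by rw [hGbij]; exact hG0 _ _) hφ hlam
      hGφ (ψ := Φ ∘ y) (μ := Λ ∘ y) (fun i => hΦ _)
      (fun i j hij => hΛ _ _ (by rwa [hGbij] at hij)) fun i => by
        simp only [Matrix.mulVec, dotProduct, hGbij, Function.comp]
        rw [hsum i Φ, hGΦ]
    let w : Fin (l.length + 1) → ℝ := fun j => Gb 0 j * φ j / (lam 0 * φ 0)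
    let W : Fin (l.length + 1) → ℝ := fun j => lam 0 * φ 0 / φ j
    have hlam0 : 0 < lam 0 := by rw [hlamΛ]; exact hΛpos _
    have hwW : ∀ j, w j * W j = G x (y j) := by
      intro j
      have h1 := (hφ j).ne'
      have h2 := (hφ 0).ne'
      have h3 := hlam0.ne'
      simp only [w, W]
      rw [← hy0, ← hGbij]
      field_simp
    have hwW2 : ∀ j, w j * W j ^ 2 = G x (y j) * (Λ x * Φ x / Φ (y j)) := by
      intro j
      rw [pow_two, ← mul_assoc, hwW]
      by_cases hg : G x (y j) = 0
      · simp [hg]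
      · congr 1
        have hr := hratio 0 j (by rwa [hGbij, hy0])
        simp only [Function.comp, hy0] at hr
        simp only [W]
        rw [hlamΛ, Function.comp, hy0, div_eq_div_iff (hφ j).ne' (hΦ (y j)).ne', mul_assoc, hr]
        ring
    have hw1 : ∑ j, w j = 1 := by
      rw [← Finset.sum_div, show ∑ j, Gb 0 j * φ j = _ from hGφ 0]
      exact div_self (mul_pos hlam0 (hφ 0)).ne'
    have hw0 : ∀ j, 0 ≤ w j := fun j => div_nonneg
      (mul_nonneg (by rw [hGbij]; exact hG0 _ _) (hφ j).le) (mul_pos hlam0 (hφ 0)).le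
    have hev : ∀ H : Bits n × ℝ → ℝ, (p.walkStep t A (x, R)).ev I H =
        ∑ j, w j * H (y j, R * W j) := by
      intro H
      have d1 : (tab fun j : Fin (l.length + 1) =>
          op (n := n) (N := N) (.flipBits ((∅ :: l).get j) x)).Det I y :=
        det_tab I fun j => det_op I _ _ rfl
      have d2 : (tab fun i => tab fun j => p.pieceEntry A (y i) (y j)).Det I
          fun i j => a (y i) (y j) :=
        det_tab I fun i => det_tab I fun j => h.entry x _ (hmem i) _ (hmem j)
      have d3 : (op (n := n) (N := N) (.expNeg t ab)).Det I Gb := det_op I _ _ rfl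
      have d4 : (op (n := n) (N := N) (.perron Gb)).Det I (φ, lam) := det_op I _ _ rfl
      have d5 : (tab fun j => do
          let u ← op (n := n) (N := N) (.mul (Gb 0 j) (φ j))
          let v ← op (.mul (lam 0) (φ 0))
          op (.div u v)).Det I w :=
        det_tab I fun j => (det_op I _ _ rfl).bind I ((det_op I _ _ rfl).bind I (det_op I _ _ rfl))
      unfold Params.walkStep
      simp only []
      rw [Prog.ev_bind, Prog.Det.ev I d1, Prog.ev_bind, Prog.Det.ev I d2, Prog.ev_bind,
        Prog.Det.ev I d3, Prog.ev_bind, Prog.Det.ev I d4]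
      simp only []
      rw [Prog.ev_bind, Prog.Det.ev I d5, Prog.ev_bind, ev_draw I w hw0 hw1]
      refine Finset.sum_congr rfl fun j _ => ?_
      congr 1
      simp only [Prog.ev_bind, ev_mul, ev_div, Prog.ev_pure, W]
    constructor
    · rw [hev, ← hy0, ← hsum, Finset.mul_sum]
      refine Finset.sum_congr rfl fun j _ => ?_
      rw [hy0, ← hwW]; ring
    · rw [hev, Matrix.mulVec, dotProduct, Finset.mul_sum]
      have e : ∑ z, R ^ 2 * (Matrix.of (fun x z => G x z * (Λ x * Φ x / Φ z)) x z * F z) =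
          ∑ z, G x z * (R ^ 2 * (Λ x * Φ x / Φ z) * F z) :=
        Finset.sum_congr rfl fun z _ => by simp only [Matrix.of_apply]; ring
      rw [e]
      have e2 := hsum 0 fun z => R ^ 2 * (Λ x * Φ x / Φ z) * F z
      rw [Matrix.mulVec, dotProduct, hy0] at e2
      rw [← e2]
      refine Finset.sum_congr rfl fun j _ => ?_
      have := hwW2 j
      linear_combination (R ^ 2 * F (y j)) * this

/-- The mean and the second moment of a sampled path. -/
theorem Params.pathSample_moments {p : Params n N} {a : Piece n N → Matrix (Bits n) (Bits n) ℝ}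
    (h : ∀ A ∈ p.pieces, p.Represents I A (a A)) {t : ℝ} (ht : 0 ≤ t) (M : ℕ) :
    (p.pathSample M t).ev I (fun v => v) =
        (fun x => (I.Φ x).re) ⬝ᵥ ((p.pieces.map fun A => NormedSpace.exp (-(t • a A))).prod ^
          M).mulVec (fun x => (I.Φ x).re) +
        (fun x => (I.Φ x).im) ⬝ᵥ ((p.pieces.map fun A => NormedSpace.exp (-(t • a A))).prod ^
          M).mulVec (fun x => (I.Φ x).im) ∧
      (p.pathSample M t).ev I (fun v => v ^ 2) ≤ 1 := by
  classical
  have hT : ∀ A, ∃ T, A ∈ p.pieces → IsColSubstochastic T ∧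
      HasMoments I (p.walkStep t A) (NormedSpace.exp (-(t • a A))) T := fun A => by
    by_cases hA : A ∈ p.pieces
    · obtain ⟨T, hT⟩ := Params.walkStep_moments I (h A hA) ht
      exact ⟨T, fun _ => hT⟩
    · exact ⟨0, fun h => absurd h hA⟩
  choose T hT using hT
  set P := (p.pieces.map fun A => NormedSpace.exp (-(t • a A))).prod
  set T₁ := (p.pieces.map T).prod
  have hm1 : HasMoments I (StoqMC.passThrough (p.walkStep t) p.pieces) P T₁ :=
    HasMoments.passThrough I _ fun A hA => (hT A hA).2
  have hT1 : IsColSubstochastic T₁ := by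
    have : ∀ l : List (Piece n N), (∀ A ∈ l, A ∈ p.pieces) →
        IsColSubstochastic (l.map T).prod := by
      intro l hl
      induction l with
      | nil => exact IsColSubstochastic.one
      | cons A l ih =>
        rw [List.map_cons, List.prod_cons]
        exact (hT A (hl A (by simp))).1.mul (ih fun B hB => hl B (List.mem_cons_of_mem _ hB))
    exact this _ fun _ hA => hA
  have hTM : IsColSubstochastic (T₁ ^ M) := by
    induction M with
    | zero => rw [pow_zero]; exact IsColSubstochastic.one
    | succ M ih => rw [pow_succ]; exact ih.mul hT1
  have hm : HasMoments I (StoqMC.passThrough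
      (fun (_ : ℕ) => StoqMC.passThrough (p.walkStep t) p.pieces) (List.range M)) (P ^ M)
      (T₁ ^ M) := by
    have := HasMoments.passThrough I (List.range M)
      (f := fun _ => StoqMC.passThrough (p.walkStep t) p.pieces) (G := fun _ => P)
      (T := fun _ => T₁) fun _ _ => hm1
    simpa using this
  have hev : ∀ H : ℝ → ℝ, (p.pathSample M t).ev I H = ∑ x, ‖I.Φ x‖ ^ 2 *
      (StoqMC.passThrough (fun (_ : ℕ) => StoqMC.passThrough (p.walkStep t) p.pieces)
        (List.range M) (x, 1)).ev I fun o => H ((I.Φ o.1 / I.Φ x).re * o.2) := by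
    intro H
    unfold Params.pathSample
    rw [Prog.ev_bind, ev_sample]
    refine Finset.sum_congr rfl fun x _ => ?_
    congr 1
    rw [Prog.ev_bind]
    congr 1
    ext o
    simp only [Prog.ev_bind, ev_ratio, ev_mul]
  constructor
  · rw [hev, dotProduct, dotProduct, ← Finset.sum_add_distrib]
    refine Finset.sum_congr rfl fun x _ => ?_
    have h1 := (hm x 1 fun z => (I.Φ z / I.Φ x).re).1
    simp only [mul_comm (I.Φ _ / I.Φ x).re] at h1 ⊢
    rw [h1, one_mul, Matrix.mulVec, Matrix.mulVec, Matrix.mulVec, dotProduct, dotProduct,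
      dotProduct, Finset.mul_sum, Finset.mul_sum, Finset.mul_sum, ← Finset.sum_add_distrib]
    refine Finset.sum_congr rfl fun z _ => ?_
    -- This is the real part of `conj(Φ x) Φ z`. It remains true for `Φ x = 0`, where both sides
    -- vanish.
    have e : ‖I.Φ x‖ ^ 2 * (I.Φ z / I.Φ x).re =
        (I.Φ x).re * (I.Φ z).re + (I.Φ x).im * (I.Φ z).im := by
      by_cases hx : I.Φ x = 0
      · simp [hx]
      · have : Complex.normSq (I.Φ x) ≠ 0 := by simpa using hx
        rw [Complex.sq_norm, Complex.div_re]
        field_simp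
    linear_combination ((P ^ M) x z) * e
  · rw [hev]
    have h2 : ∀ x, ‖I.Φ x‖ ^ 2 * (StoqMC.passThrough
        (fun (_ : ℕ) => StoqMC.passThrough (p.walkStep t) p.pieces) (List.range M) (x, 1)).ev I
          (fun o => ((I.Φ o.1 / I.Φ x).re * o.2) ^ 2) ≤ ∑ z, (T₁ ^ M) x z * ‖I.Φ z‖ ^ 2 := by
      intro x
      have h1 := (hm x 1 fun z => (I.Φ z / I.Φ x).re ^ 2).2
      simp only [mul_comm (I.Φ _ / I.Φ x).re, mul_pow] at h1 ⊢
      rw [h1, one_pow, one_mul, Matrix.mulVec, dotProduct, Finset.mul_sum]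
      refine Finset.sum_le_sum fun z _ => ?_
      have e : ‖I.Φ x‖ ^ 2 * (I.Φ z / I.Φ x).re ^ 2 ≤ ‖I.Φ z‖ ^ 2 := by
        by_cases hx : I.Φ x = 0
        · simp [hx]
        · have h3 : |(I.Φ z / I.Φ x).re| ≤ ‖I.Φ z / I.Φ x‖ := Complex.abs_re_le_norm _
          have h4 := pow_le_pow_left₀ (abs_nonneg _) h3 2
          rw [sq_abs, norm_div, div_pow, le_div_iff₀ (by positivity)] at h4
          linarith
      have := mul_le_mul_of_nonneg_left e (hTM.1 x z)
      linarith
    -- The factor `|Φ x|²` has cancelled against the ratio. Summing over the starting point first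
    -- leaves the column sums of the kernel, so the bound does not grow with `M`.
    refine (Finset.sum_le_sum fun x _ => h2 x).trans ?_
    rw [Finset.sum_comm]
    refine le_trans (Finset.sum_le_sum fun z _ => ?_) I.norm_Φ.le
    rw [← Finset.sum_mul]
    exact mul_le_of_le_one_left (sq_nonneg _) (hTM.2 z)

end Walk

/-! ### The pieces of the Hamiltonian -/

theorem norm_entry_le_opNorm {n : ℕ} (A : Matrix (Bits n) (Bits n) ℂ) (x y : Bits n) :
    ‖A x y‖ ≤ opNorm A := by
  have h1 := (Matrix.toEuclideanCLM (𝕜 := ℂ) A).le_opNorm (EuclideanSpace.single y 1)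
  rw [PiLp.norm_single, norm_one, mul_one] at h1
  refine le_trans ?_ h1
  have h2 := PiLp.norm_apply_le (Matrix.toEuclideanCLM (𝕜 := ℂ) A (EuclideanSpace.single y 1)) x
  simpa [Matrix.ofLp_toEuclideanCLM] using h2

/-- The positions at which two strings differ. -/
def diffSet {n : ℕ} (x y : Bits n) : Finset (Fin n) := Finset.univ.filter fun i => x i ≠ y i

theorem flipAt_diffSet {n : ℕ} (x y : Bits n) : flipAt (diffSet x y) x = y := by
  ext i
  by_cases h : x i = y i
  · simp [flipAt, diffSet, h]
  · cases hx : x i <;> cases hy : y i <;> simp_all [flipAt, diffSet]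

theorem diffSet_flipAt {n : ℕ} (s : Finset (Fin n)) (x : Bits n) :
    diffSet x (flipAt s x) = s :=
  flipAt_injective x (flipAt_diffSet x (flipAt s x))

theorem flipAt_ne_self {n : ℕ} {s : Finset (Fin n)} (hs : s ≠ ∅) (x : Bits n) :
    flipAt s x ≠ x := fun h =>
  hs (flipAt_injective x (by simpa using h))

theorem eq_flipAt_comm {n : ℕ} (s : Finset (Fin n)) (x y : Bits n) :
    y = flipAt s x ↔ x = flipAt s y := by
  constructor <;> rintro rfl <;> rw [flipAt_flipAt]

section Pieces

variable {n k N : ℕ} {I : Input n k N} {b : ℕ}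

variable (I) in
theorem det_add (x y : ℝ) : (op (.add x y)).Det I (x + y) := det_op I (.add x y) _ rfl

variable (I) in
theorem det_sub (x y : ℝ) : (op (.sub x y)).Det I (x - y) := det_op I (.sub x y) _ rfl

theorem diffSet_subset_supp {i : Fin N} {x y : Bits n} (h : I.ham.term i x y ≠ 0) :
    diffSet x y ⊆ I.ham.supp i := by
  obtain ⟨a, ha⟩ := I.ham.actsOn i
  rw [ha] at h
  intro j hj
  by_contra hjs
  exact (Finset.mem_filter.1 hj).2 ((ite_ne_right_iff.1 h).1 j hjs)

/-- A row has at most `2^k` non-zero entries, one for each set of flips within the support, and each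
is at most the norm. This is the source of the factor `2^k` in the shift. -/
theorem term_row_sum (hb : ∀ i, opNorm (I.ham.term i) ≤ b) (i : Fin N) (x : Bits n) :
    ∑ y, ‖I.ham.term i x y‖ ≤ 2 ^ k * b := by
  classical
  have hsub : ∀ y ∉ (I.ham.supp i).powerset.image fun s => flipAt s x, ‖I.ham.term i x y‖ = 0 := by
    intro y hy
    rw [norm_eq_zero]
    by_contra h
    exact hy (Finset.mem_image.2 ⟨diffSet x y, Finset.mem_powerset.2 (diffSet_subset_supp h),
      flipAt_diffSet x y⟩)
  rw [← Finset.sum_subset (Finset.subset_univ _) fun y _ hy => hsub y hy]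
  refine (Finset.sum_le_card_nsmul _ _ (b : ℝ) fun y _ =>
    (norm_entry_le_opNorm _ x y).trans (hb i)).trans ?_
  rw [nsmul_eq_mul]
  gcongr
  refine (Nat.cast_le.2 (Finset.card_image_le.trans ?_)).trans_eq (Nat.cast_pow 2 k)
  rw [Finset.card_powerset]
  exact Nat.pow_le_pow_right (by norm_num) (I.ham.card_supp_le i)

theorem term_re_symm (i : Fin N) (x y : Bits n) :
    (I.ham.term i x y).re = (I.ham.term i y x).re := by
  rw [← (I.ham.isHermitian i).apply x y]; simp

variable (I) in
/-- The real part of the Hamiltonian. -/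
def hamRe : Matrix (Bits n) (Bits n) ℝ := Matrix.of fun x y => (I.ham.total x y).re

theorem hamRe_apply (x y : Bits n) : hamRe I x y = ∑ i, (I.ham.term i x y).re := by
  simp [hamRe, LocalHamiltonian.total, Matrix.sum_apply]

theorem hamRe_symm (x y : Bits n) : hamRe I x y = hamRe I y x := by
  simp only [hamRe_apply, term_re_symm _ x y]

theorem hamRe_row_sum (hb : ∀ i, opNorm (I.ham.term i) ≤ b) (x : Bits n) :
    ∑ y, |hamRe I x y| ≤ N * (2 ^ k * b) := by
  simp only [hamRe_apply]
  refine (Finset.sum_le_sum fun y _ => Finset.abs_sum_le_sum_abs _ _).trans ?_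
  rw [Finset.sum_comm]
  refine (Finset.sum_le_card_nsmul _ _ ((2 : ℝ) ^ k * b) fun i _ => ?_).trans ?_
  · exact (Finset.sum_le_sum fun y _ => Complex.abs_re_le_norm _).trans (term_row_sum hb i x)
  · simp

theorem card_diffSet_le {x y : Bits n} (h : hamRe I x y ≠ 0) : (diffSet x y).card ≤ k := by
  rw [hamRe_apply] at h
  obtain ⟨i, -, hi⟩ := Finset.exists_ne_zero_of_sum_ne_zero h
  have : I.ham.term i x y ≠ 0 := fun h0 => hi (by rw [h0]; rfl)
  exact (Finset.card_le_card (diffSet_subset_supp this)).trans (I.ham.card_supp_le i)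

theorem stoquastic_total {σ : Scheme} (h : I.ham.Stoquastic σ) : IsStoquastic I.ham.total := by
  cases σ with
  | globally => exact h
  | termwise =>
    intro x y hxy
    have h1 : I.ham.total x y = ∑ i, I.ham.term i x y := by
      simp [LocalHamiltonian.total, Matrix.sum_apply]
    rw [h1, Complex.im_sum, Complex.re_sum]
    exact ⟨Finset.sum_eq_zero fun i _ => (h i x y hxy).1,
      Finset.sum_nonpos fun i _ => (h i x y hxy).2⟩

theorem hamRe_nonpos {σ : Scheme} (h : I.ham.Stoquastic σ) {x y : Bits n} (hxy : x ≠ y) :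
    hamRe I x y ≤ 0 :=
  (stoquastic_total h x y hxy).2

theorem total_eq_map_hamRe {σ : Scheme} (h : I.ham.Stoquastic σ) :
    I.ham.total = (hamRe I).map (algebraMap ℝ ℂ) := by
  ext x y
  have him : (I.ham.total x y).im = 0 := by
    by_cases hxy : x = y
    · subst hxy
      have hh : I.ham.total.IsHermitian := by
        unfold LocalHamiltonian.total
        rw [Matrix.IsHermitian, Matrix.conjTranspose_sum]
        exact Finset.sum_congr rfl fun i _ => I.ham.isHermitian i
      exact Complex.conj_eq_iff_im.1 (hh.apply x x)
    · exact (stoquastic_total h x y hxy).1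
  exact Complex.ext (by simp [hamRe]) (by simp [him])

theorem det_hamEntry (x y : Bits n) : (hamEntry x y : Prog n N ℝ).Det I (hamRe I x y) := by
  have := det_sumOver I (f := fun i : Fin N => do
    let z ← op (n := n) (N := N) (.entry i x y)
    pure z.re) (a := fun i => (I.ham.term i x y).re)
    (fun i => (det_op I _ _ rfl).bind I (det_pure I _)) (List.finRange N)
  rwa [← Fin.sum_univ_def, ← hamRe_apply] at this

variable (I) in
/-- The matrix of a piece of the Hamiltonian. -/
def pieceMatrix (p : Params n N) : Piece n N → Matrix (Bits n) (Bits n) ℝ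
  | .term i => Matrix.of fun x y => (I.ham.term i x y).re +
      if x = y then (2 : ℝ) ^ p.k * p.b else 0
  | .hop s => Matrix.of fun x y =>
      if x = y then -hamRe I x (flipAt s x) else if y = flipAt s x then hamRe I x y else 0
  | .diag => Matrix.diagonal fun x =>
      ((∅ :: p.hops).map fun s => hamRe I x (flipAt s x)).sum + p.shift

/-- The added constant dominates the absolute row sums of `H_i`, which gives diagonal dominance. The
strings obtained by flips within the support form an invariant block. -/
theorem represents_term (hb : ∀ i, opNorm (I.ham.term i) ≤ b)
    (hst : I.ham.Stoquastic .termwise) (i : Fin N) :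
    (I.params b .termwise).Represents I (.term i) (pieceMatrix I (I.params b .termwise) (.term i)) ∧
      ∀ x, ∑ y, |pieceMatrix I (I.params b .termwise) (.term i) x y| ≤ 2 * (2 ^ k * b) := by
  classical
  set a := pieceMatrix I (I.params b .termwise) (.term i) with ha
  have hdiag : ∀ x, a x x = (I.ham.term i x x).re + 2 ^ k * b := fun x => by
    simp [ha, pieceMatrix, Input.params]
  have hoff : ∀ x y, x ≠ y → a x y = (I.ham.term i x y).re := fun x y h => by
    simp [ha, pieceMatrix, h]
  have hsymm : a.IsSymm := by
    ext x y
    by_cases h : x = y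
    · subst h; rfl
    · rw [Matrix.transpose_apply, hoff _ _ h, hoff _ _ (Ne.symm h), term_re_symm]
  have hrow : ∀ x, ∑ y, |(I.ham.term i x y).re| ≤ 2 ^ k * b := fun x =>
    (Finset.sum_le_sum fun y _ => Complex.abs_re_le_norm _).trans (term_row_sum hb i x)
  have hmem : ∀ s, s ∈ ∅ :: (I.params b .termwise).moves (.term i) ↔ s ⊆ I.ham.supp i := by
    intro s
    by_cases h : s = ∅ <;> simp [Params.moves, Input.params, h]
  refine ⟨⟨posSemidef_of_diag_dominant hsymm fun x => ?_, fun x y h => ?_, ?_, ?_, ?_⟩, fun x => ?_⟩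
  · rw [Finset.sum_congr rfl (g := fun y => |(I.ham.term i x y).re|) fun y hy => by
      rw [hoff x y (Finset.mem_erase.1 hy).1.symm], hdiag]
    have := Finset.add_sum_erase Finset.univ (fun y => |(I.ham.term i x y).re|) (Finset.mem_univ x)
    linarith [hrow x, neg_abs_le (I.ham.term i x x).re]
  · rw [hoff x y h]; exact (hst i x y h).2
  · simp [Params.moves, Finset.nodup_toList]
  · intro x s _ s' _
    simp only [Params.pieceEntry]
    refine (det_op I _ _ rfl).bind I ?_
    by_cases h : flipAt s x = flipAt s' x
    · rw [if_pos h]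
      convert det_add I _ _ using 1
      simp [ha, pieceMatrix, h]
    · rw [if_neg h, hoff _ _ h]
      exact det_pure I _
  · intro x s hs z hz
    by_cases h : flipAt s x = z
    · exact ⟨s, hs, h.symm⟩
    · rw [hoff _ _ h] at hz
      have h1 : I.ham.term i (flipAt s x) z ≠ 0 := fun h0 => hz (by rw [h0]; rfl)
      have h2 := diffSet_subset_supp h1
      rw [hmem] at hs
      refine ⟨diffSet x z, (hmem _).2 fun j hj => ?_, (flipAt_diffSet x z).symm⟩
      by_contra hjs
      have h3 : j ∉ s := fun hj' => hjs (hs hj')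
      refine hjs (h2 (Finset.mem_filter.2 ⟨Finset.mem_univ _, ?_⟩))
      have h4 : flipAt s x j = x j := if_neg h3
      rw [h4]
      exact (Finset.mem_filter.1 hj).2
  · have h1 : ∀ y, |a x y| ≤ |(I.ham.term i x y).re| + if x = y then (2 : ℝ) ^ k * b else 0 := by
      intro y
      refine (abs_add_le _ _).trans (add_le_add_right (le_of_eq ?_) _)
      simp only [Input.params]
      split_ifs
      · exact abs_of_nonneg (by positivity)
      · exact abs_zero
    refine (Finset.sum_le_sum fun y _ => h1 y).trans ?_
    rw [Finset.sum_add_distrib, Finset.sum_ite_eq, if_pos (Finset.mem_univ x)]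
    linarith [hrow x]

theorem abs_hamRe_le (hb : ∀ i, opNorm (I.ham.term i) ≤ b) (x y : Bits n) :
    |hamRe I x y| ≤ N * (2 ^ k * b) :=
  (Finset.single_le_sum (f := fun y => |hamRe I x y|) (fun _ _ => abs_nonneg _)
    (Finset.mem_univ y)).trans (hamRe_row_sum hb x)

/-- On each pair `{x, x ⊕ s}` the piece is `[[a, -a], [-a, a]]` with `a = -⟨x|H|x ⊕ s⟩ ≥ 0`, hence
positive semidefinite with the pair as an invariant block. -/
theorem represents_hop (hb : ∀ i, opNorm (I.ham.term i) ≤ b)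
    (hst : I.ham.Stoquastic .globally) {s : Finset (Fin n)} (hs : s ≠ ∅) :
    (I.params b .globally).Represents I (.hop s) (pieceMatrix I (I.params b .globally) (.hop s)) ∧
      ∀ x, ∑ y, |pieceMatrix I (I.params b .globally) (.hop s) x y| ≤ 2 * (N * (2 ^ k * b)) := by
  classical
  set a := pieceMatrix I (I.params b .globally) (.hop s) with ha
  have hne : ∀ x, x ≠ flipAt s x := fun x => (flipAt_ne_self hs x).symm
  have hform : ∀ x y, a x y = (if y = x then -hamRe I x (flipAt s x) else 0) +
      if y = flipAt s x then hamRe I x (flipAt s x) else 0 := by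
    intro x y
    simp only [ha, pieceMatrix, Matrix.of_apply]
    by_cases h : x = y
    · subst h; simp [hne x]
    · by_cases h2 : y = flipAt s x
      · subst h2; simp [hne x, (hne x).symm]
      · simp [h, Ne.symm h, h2]
  have hoff : ∀ x y, y ≠ x → a x y = if y = flipAt s x then hamRe I x (flipAt s x) else 0 :=
    fun x y h => by rw [hform, if_neg h, zero_add]
  have hdiag : ∀ x, a x x = -hamRe I x (flipAt s x) := fun x => by simp [hform, hne x]
  have hnp : ∀ x, hamRe I x (flipAt s x) ≤ 0 := fun x => hamRe_nonpos hst (hne x)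
  have hsymm : a.IsSymm := by
    ext x y
    rw [Matrix.transpose_apply]
    by_cases h : x = y
    · subst h; rfl
    · rw [hoff _ _ h, hoff _ _ (Ne.symm h)]
      by_cases h2 : y = flipAt s x
      · rw [if_pos h2, if_pos ((eq_flipAt_comm s x y).1 h2), ← h2, hamRe_symm,
          ← (eq_flipAt_comm s x y).1 h2]
      · rw [if_neg h2, if_neg fun h3 => h2 ((eq_flipAt_comm s x y).2 h3)]
  refine ⟨⟨posSemidef_of_diag_dominant hsymm fun x => ?_, fun x y h => ?_, ?_, ?_, ?_⟩, fun x => ?_⟩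
  · rw [Finset.sum_eq_single (flipAt s x), hoff _ _ (hne x).symm, if_pos rfl, hdiag,
      abs_of_nonpos (hnp x)]
    · intro y hy hy2
      rw [hoff _ _ (Finset.mem_erase.1 hy).1, if_neg hy2, abs_zero]
    · exact fun h => absurd (Finset.mem_erase.2 ⟨(hne x).symm, Finset.mem_univ _⟩) h
  · rw [hoff x y (Ne.symm h)]
    split_ifs
    · exact hnp x
    · exact le_rfl
  · simpa [Params.moves] using hs.symm
  · intro x s₁ h₁ s₂ h₂
    simp only [Params.pieceEntry]
    by_cases h : flipAt s₁ x = flipAt s₂ x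
    · rw [if_pos h, ← h, hdiag]
      refine (det_op I _ _ rfl).bind I ((det_hamEntry _ _).bind I ?_)
      convert det_sub I _ _ using 1
      simp
    · rw [if_neg h]
      have h3 : flipAt s₂ x = flipAt s (flipAt s₁ x) := by
        simp only [Params.moves, List.mem_cons, List.not_mem_nil, or_false] at h₁ h₂
        rcases h₁ with rfl | rfl <;> rcases h₂ with rfl | rfl <;> simp_all [flipAt_flipAt]
      rw [hoff _ _ (Ne.symm h), if_pos h3, ← h3]
      exact det_hamEntry _ _
  · intro x s₁ h₁ z hz
    by_cases h : z = flipAt s₁ x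
    · exact ⟨s₁, h₁, h⟩
    · rw [hoff _ _ h] at hz
      have h3 := (ite_ne_right_iff.1 hz).1
      simp only [Params.moves, List.mem_cons, List.not_mem_nil, or_false] at h₁ ⊢
      rcases h₁ with rfl | rfl
      · exact ⟨s, Or.inr rfl, by simpa using h3⟩
      · exact ⟨∅, Or.inl rfl, by simpa [flipAt_flipAt] using h3⟩
  · have h1 : ∀ y, |a x y| ≤ (if y = x then |hamRe I x (flipAt s x)| else 0) +
      if y = flipAt s x then |hamRe I x (flipAt s x)| else 0 := by
      intro y
      rw [hform]
      refine (abs_add_le _ _).trans (add_le_add (le_of_eq ?_) (le_of_eq ?_)) <;>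
        split_ifs <;> simp
    refine (Finset.sum_le_sum fun y _ => h1 y).trans ?_
    rw [Finset.sum_add_distrib, Finset.sum_ite_eq', Finset.sum_ite_eq',
      if_pos (Finset.mem_univ _), if_pos (Finset.mem_univ _)]
    linarith [abs_hamRe_le hb x (flipAt s x)]

/-- Distinct flips lead to distinct columns, so this is part of a row sum of `H`. The shift
therefore makes the remaining diagonal piece non-negative. -/
theorem abs_sum_hops_le (hb : ∀ i, opNorm (I.ham.term i) ≤ b) (p : Params n N) (x : Bits n) :
    |((∅ :: p.hops).map fun s => hamRe I x (flipAt s x)).sum| ≤ N * (2 ^ k * b) := by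
  classical
  have hnd : (∅ :: p.hops).Nodup := by
    simp [Params.hops, Finset.nodup_toList]
  rw [← List.sum_toFinset _ hnd]
  refine (Finset.abs_sum_le_sum_abs _ _).trans (le_trans ?_ (hamRe_row_sum hb x))
  rw [← Finset.sum_image (s := (∅ :: p.hops).toFinset) (g := fun s => flipAt s x)
    (f := fun y => |hamRe I x y|) fun _ _ _ _ h => flipAt_injective x h]
  exact Finset.sum_le_sum_of_subset_of_nonneg (Finset.subset_univ _) fun _ _ _ => abs_nonneg _

theorem represents_diag (hb : ∀ i, opNorm (I.ham.term i) ≤ b) :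
    (I.params b .globally).Represents I .diag (pieceMatrix I (I.params b .globally) .diag) ∧
      ∀ x, ∑ y, |pieceMatrix I (I.params b .globally) .diag x y| ≤ 2 * (N * (2 ^ k * b)) := by
  classical
  set p := I.params b .globally with hp
  have hshift : (p.shift : ℝ) = N * (2 ^ k * b) := by simp [hp, Params.shift, Input.params]
  have hnn : ∀ x, 0 ≤ ((∅ :: p.hops).map fun s => hamRe I x (flipAt s x)).sum + p.shift := by
    intro x
    have := abs_le.1 (abs_sum_hops_le hb p x)
    rw [hshift]; linarith [this.1]
  refine ⟨⟨?_, fun x y h => ?_, ?_, ?_, ?_⟩, fun x => ?_⟩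
  · exact Matrix.PosSemidef.diagonal fun x => hnn x
  · simp [pieceMatrix, h]
  · simp [Params.moves]
  · intro x s h₁ s' h₂
    simp only [Params.moves, List.mem_singleton] at h₁ h₂
    subst h₁; subst h₂
    simp only [Params.pieceEntry, pieceMatrix, Matrix.diagonal_apply_eq]
    refine (det_sumOver I (a := fun s' => hamRe I (flipAt ∅ x) (flipAt s' (flipAt ∅ x)))
      (fun s => ?_) _).bind I (det_add I _ _)
    exact (det_op I _ _ rfl).bind I (det_hamEntry _ _)
  · intro x s hs z hz
    refine ⟨s, hs, ?_⟩
    by_contra h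
    exact hz (Matrix.diagonal_apply_ne _ (Ne.symm h))
  · rw [Finset.sum_eq_single x]
    · simp only [pieceMatrix, Matrix.diagonal_apply_eq]
      rw [abs_of_nonneg (hnn x), hshift]
      linarith [le_abs_self ((∅ :: p.hops).map fun s => hamRe I x (flipAt s x)).sum,
        abs_sum_hops_le hb p x]
    · intro y _ hy
      simp [pieceMatrix, Ne.symm hy]
    · simp

/-- The pieces are read correctly, and they have bounded norm. -/
theorem represents_pieces {σ : Scheme} (hb : ∀ i, opNorm (I.ham.term i) ≤ b)
    (hst : I.ham.Stoquastic σ) {A : Piece n N} (hA : A ∈ (I.params b σ).pieces) :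
    (I.params b σ).Represents I A (pieceMatrix I (I.params b σ) A) ∧
      ∀ x, ∑ y, |pieceMatrix I (I.params b σ) A x y| ≤ 2 * (I.params b σ).scale := by
  have hscale : ((I.params b σ).scale : ℝ) = (N + 1) * (2 ^ k * b) := by
    simp [Params.scale, Input.params]
  have h0 : (0 : ℝ) ≤ 2 ^ k * b := by positivity
  have hN : (0 : ℝ) ≤ N * (2 ^ k * b) := by positivity
  -- The factor `N + 1` in the scale covers both the factor 1 of the termwise bound and the factor
  -- `N` of the global one.
  have l1 : 2 * ((2 : ℝ) ^ k * b) ≤ 2 * (I.params b σ).scale := by rw [hscale]; linarith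
  have l2 : 2 * (N * ((2 : ℝ) ^ k * b)) ≤ 2 * (I.params b σ).scale := by rw [hscale]; linarith
  cases σ with
  | termwise =>
    obtain ⟨i, -, rfl⟩ := List.mem_map.1 hA
    obtain ⟨h1, h2⟩ := represents_term hb hst i
    exact ⟨h1, fun x => (h2 x).trans l1⟩
  | globally =>
    rcases List.mem_cons.1 hA with rfl | hA
    · obtain ⟨h1, h2⟩ := represents_diag hb
      exact ⟨h1, fun x => (h2 x).trans l2⟩
    · obtain ⟨s, hs, rfl⟩ := List.mem_map.1 hA
      have hs' : s ≠ ∅ := by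
        rintro rfl
        simp [Params.hops] at hs
      obtain ⟨h1, h2⟩ := represents_hop hb hst hs'
      exact ⟨h1, fun x => (h2 x).trans l2⟩

/-- The pieces add up to the shifted Hamiltonian. -/
theorem sum_pieceMatrix (σ : Scheme) :
    ((I.params b σ).pieces.map (pieceMatrix I (I.params b σ))).sum =
      hamRe I + ((I.params b σ).shift : ℝ) • 1 := by
  classical
  cases σ with
  | termwise =>
    simp only [Params.pieces, Input.params, List.map_map]
    rw [← Fin.sum_univ_def]
    ext x y
    rw [Matrix.sum_apply, Matrix.add_apply, hamRe_apply]
    by_cases h : x = y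
    · simp [pieceMatrix, h, Finset.sum_add_distrib, Params.shift]
    · simp [pieceMatrix, h]
  | globally =>
    set p := I.params b .globally with hp
    have hpc : p.pieces = Piece.diag :: p.hops.map Piece.hop := rfl
    rw [hpc, List.map_cons, List.sum_cons, List.map_map]
    set h := Finset.univ.filter fun s : Finset (Fin n) => 1 ≤ s.card ∧ s.card ≤ p.k with hh
    have hhops : p.hops = h.toList := rfl
    have h0 : ∅ ∉ h := by simp [hh]
    rw [hhops, Finset.sum_map_toList]
    ext x y
    rw [Matrix.add_apply, Matrix.sum_apply, Matrix.add_apply]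
    by_cases hxy : x = y
    · subst hxy
      have e : ∀ s ∈ h, (pieceMatrix I p ∘ Piece.hop) s x x = -hamRe I x (flipAt s x) :=
        fun s _ => by simp [pieceMatrix]
      rw [Finset.sum_congr rfl e]
      simp only [pieceMatrix, Matrix.diagonal_apply_eq, hhops, List.map_cons, List.sum_cons,
        Finset.sum_map_toList, Finset.sum_neg_distrib, Matrix.smul_apply, Matrix.one_apply_eq,
        flipAt_empty, smul_eq_mul]
      ring
    · have e : ∀ s ∈ h, (pieceMatrix I p ∘ Piece.hop) s x y =
          if s = diffSet x y then hamRe I x y else 0 := fun s _ => by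
        simp only [Function.comp, pieceMatrix, Matrix.of_apply, if_neg hxy]
        by_cases hs : s = diffSet x y
        · rw [if_pos hs, if_pos (by rw [hs, flipAt_diffSet])]
        · rw [if_neg hs, if_neg fun h2 => hs (by rw [h2, diffSet_flipAt])]
      rw [Finset.sum_congr rfl e, Finset.sum_ite_eq']
      simp only [pieceMatrix, Matrix.diagonal_apply_ne _ hxy, Matrix.smul_apply,
        Matrix.one_apply_ne hxy, smul_zero, add_zero, zero_add]
      -- A non-zero off-diagonal entry flips between `1` and `k` bits, so it belongs to exactly one
      -- hop.
      by_cases hd : hamRe I x y = 0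
      · simp [hd]
      · rw [if_pos]
        refine Finset.mem_filter.2 ⟨Finset.mem_univ _, ?_, card_diffSet_le hd⟩
        rw [Nat.one_le_iff_ne_zero, Finset.card_ne_zero]
        by_contra hemp
        rw [Finset.not_nonempty_iff_eq_empty] at hemp
        exact hxy (by rw [← flipAt_diffSet x y, hemp, flipAt_empty])

end Pieces

/-! ### The imaginary-time signal -/

section Signal

variable {n k N S : ℕ} {I : Input n k N} {b : ℕ} {σ : Scheme} {E : Fin S → ℝ}
  {ψ : Fin S → Bits n → ℂ}

/-- Gershgorin's argument: compare the eigenvalue equation at the largest component of the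
eigenvector with the row sum. -/
theorem abs_eigenvalue_le (hb : ∀ i, opNorm (I.ham.term i) ≤ b) (hst : I.ham.Stoquastic σ)
    (hsup : SupportedOn I.ham.total I.Φ E ψ) (j : Fin S) : |E j| ≤ N * (2 ^ k * b) := by
  obtain ⟨x, -, hx⟩ := Finset.exists_max_image Finset.univ (fun x => ‖ψ j x‖)
    Finset.univ_nonempty
  have hpos : 0 < ‖ψ j x‖ := by
    by_contra h
    have h0 : ψ j = 0 := by
      ext y
      have := hx y (Finset.mem_univ y)
      exact norm_le_zero_iff.1 (this.trans (not_lt.1 h))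
    have := hsup.orthonormal j j
    simp [h0] at this
  have h1 := congrFun (hsup.eigen j) x
  rw [total_eq_map_hamRe hst, Pi.smul_apply, smul_eq_mul] at h1
  have h2 : |E j| * ‖ψ j x‖ ≤ (N * (2 ^ k * b)) * ‖ψ j x‖ := by
    have e : |E j| * ‖ψ j x‖ = ‖(E j : ℂ) * ψ j x‖ := by simp
    rw [e, ← h1]
    refine (norm_sum_le _ _).trans ?_
    refine (Finset.sum_le_sum (g := fun y => |hamRe I x y| * ‖ψ j x‖) fun y _ => ?_).trans ?_
    · simp only [norm_mul, Matrix.map_apply]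
      refine mul_le_mul (by simp) (hx y (Finset.mem_univ y)) (norm_nonneg _) (abs_nonneg _)
    · rw [← Finset.sum_mul]
      exact mul_le_mul_of_nonneg_right (hamRe_row_sum hb x) (norm_nonneg _)
  exact le_of_mul_le_mul_right h2 hpos

/-- Used with `d = 1` for the normalization of the weights and with exponentials for the signal. -/
theorem sum_weights (d : Fin S → ℂ) :
    star I.Φ ⬝ᵥ (∑ j, (d j * (star (ψ j) ⬝ᵥ I.Φ)) • ψ j) =
      ∑ j, d j * (‖star (ψ j) ⬝ᵥ I.Φ‖ ^ 2 : ℝ) := by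
  rw [dotProduct_sum]
  refine Finset.sum_congr rfl fun j _ => ?_
  rw [dotProduct_smul, smul_eq_mul, mul_assoc]
  congr 1
  have h1 : star I.Φ ⬝ᵥ ψ j = star (star (ψ j) ⬝ᵥ I.Φ) := by
    rw [Matrix.star_dotProduct, dotProduct_comm]
  rw [h1, Complex.star_def, Complex.mul_conj, Complex.normSq_eq_norm_sq]

theorem sum_norm_sq_weights (hsup : SupportedOn I.ham.total I.Φ E ψ) :
    ∑ j, ‖star (ψ j) ⬝ᵥ I.Φ‖ ^ 2 = 1 := by
  have h1 := sum_weights (I := I) (ψ := ψ) fun _ => 1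
  simp only [one_mul] at h1
  rw [← hsup.expansion] at h1
  have h2 : star I.Φ ⬝ᵥ I.Φ = ((∑ x, ‖I.Φ x‖ ^ 2 : ℝ) : ℂ) := by
    rw [dotProduct, Complex.ofReal_sum]
    refine Finset.sum_congr rfl fun x _ => ?_
    rw [Pi.star_apply, Complex.star_def, mul_comm, Complex.mul_conj, Complex.normSq_eq_norm_sq]
  rw [h2, I.norm_Φ] at h1
  exact_mod_cast h1.symm

/-- The imaginary-time signal as a sum of decaying exponentials. -/
theorem signal_eq (hst : I.ham.Stoquastic σ) (hsup : SupportedOn I.ham.total I.Φ E ψ)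
    (τ c : ℝ) :
    (fun x => (I.Φ x).re) ⬝ᵥ (NormedSpace.exp (-(τ • (hamRe I + c • 1)))).mulVec
        (fun x => (I.Φ x).re) +
      (fun x => (I.Φ x).im) ⬝ᵥ (NormedSpace.exp (-(τ • (hamRe I + c • 1)))).mulVec
        (fun x => (I.Φ x).im) =
      ∑ j, ‖star (ψ j) ⬝ᵥ I.Φ‖ ^ 2 * Real.exp (-(τ * (E j + c))) := by
  set X := NormedSpace.exp (-(τ • (hamRe I + c • 1)))
  have hre : (fun x => (I.Φ x).re) ⬝ᵥ X.mulVec (fun x => (I.Φ x).re) +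
      (fun x => (I.Φ x).im) ⬝ᵥ X.mulVec (fun x => (I.Φ x).im) =
      (star I.Φ ⬝ᵥ (X.map (algebraMap ℝ ℂ)).mulVec I.Φ).re := by
    simp only [dotProduct, Matrix.mulVec, Finset.mul_sum, Complex.re_sum]
    rw [← Finset.sum_add_distrib]
    refine Finset.sum_congr rfl fun x _ => ?_
    rw [← Finset.sum_add_distrib]
    refine Finset.sum_congr rfl fun y _ => ?_
    simp
  -- Its columns are only the eigenvectors present in `Φ`; no complete eigenbasis is needed.
  let V : Matrix (Bits n) (Fin S) ℂ := Matrix.of fun x j => ψ j x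
  let d : Fin S → ℂ := fun j => -(τ * (E j + c))
  have hint : (-(τ • (hamRe I + c • 1))).map (algebraMap ℝ ℂ) * V = V * Matrix.diagonal d := by
    ext x j
    rw [Matrix.mul_diagonal]
    have h1 : (I.ham.total * V) x j = E j * ψ j x := by
      have := congrFun (hsup.eigen j) x
      rwa [Pi.smul_apply, smul_eq_mul] at this
    have h2 : (-(τ • (hamRe I + c • 1))).map (algebraMap ℝ ℂ) =
        -((τ : ℂ) • (I.ham.total + (c : ℂ) • 1)) := by
      rw [total_eq_map_hamRe hst]
      ext y z
      by_cases hyz : y = z <;> simp [hyz]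
    rw [h2, Matrix.neg_mul, Matrix.smul_mul, Matrix.add_mul, Matrix.smul_mul, Matrix.one_mul,
      Matrix.neg_apply, Matrix.smul_apply, Matrix.add_apply, h1, Matrix.smul_apply]
    simp only [V, d, Matrix.of_apply, smul_eq_mul]
    ring
  have hexp := exp_mul_eq_mul_exp hint
  rw [← exp_map_ofReal, Matrix.exp_diagonal] at hexp
  have hXψ : ∀ j, (X.map (algebraMap ℝ ℂ)).mulVec (ψ j) = Complex.exp (d j) • ψ j := by
    intro j
    ext x
    have := congrFun (congrFun hexp x) j
    rw [Matrix.mul_diagonal, Pi.exp_def, ← Complex.exp_eq_exp_ℂ] at this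
    rw [Pi.smul_apply, smul_eq_mul, mul_comm]
    exact this
  rw [hre]
  have h3 : (X.map (algebraMap ℝ ℂ)).mulVec I.Φ =
      ∑ j, (Complex.exp (d j) * (star (ψ j) ⬝ᵥ I.Φ)) • ψ j := by
    conv_lhs => rw [hsup.expansion]
    rw [Matrix.mulVec_sum]
    refine Finset.sum_congr rfl fun j _ => ?_
    rw [Matrix.mulVec_smul, hXψ, smul_smul, mul_comm]
  rw [h3, sum_weights, Complex.re_sum]
  refine Finset.sum_congr rfl fun j _ => ?_
  have e : Complex.exp (d j) = (Real.exp (-(τ * (E j + c))) : ℝ) := by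
    simp [d]
  rw [e, ← Complex.ofReal_mul, Complex.ofReal_re, mul_comm]

open scoped Matrix.Norms.L2Operator in
/-- The samples estimate the signal, up to the Trotter error. -/
theorem pathSample_estimates (hb : ∀ i, opNorm (I.ham.term i) ≤ b) (hst : I.ham.Stoquastic σ)
    (hsup : SupportedOn I.ham.total I.Φ E ψ) (hscale : 0 < (I.params b σ).scale) {M : ℕ}
    (hM : 0 < M) (κ : ℕ) :
    ∃ μ, ((I.params b σ).pathSample M (κ / ((I.params b σ).scale * M))).ev I (fun v => v) = μ ∧
      ((I.params b σ).pathSample M (κ / ((I.params b σ).scale * M))).ev I (fun v => v ^ 2) ≤ 1 ∧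
      |μ - ∑ j, ‖star (ψ j) ⬝ᵥ I.Φ‖ ^ 2 *
        Real.exp (-(κ / (I.params b σ).scale * (E j + (I.params b σ).shift)))| ≤
        8 * ((I.params b σ).pieces.length * κ) ^ 2 / M := by
  set p := I.params b σ
  have hs : (0 : ℝ) < p.scale := by exact_mod_cast hscale
  have hM' : (0 : ℝ) < M := by exact_mod_cast hM
  set t : ℝ := κ / (p.scale * M) with ht
  have ht0 : 0 ≤ t := by positivity
  obtain ⟨h1, h2⟩ := Params.pathSample_moments I (p := p) (a := pieceMatrix I p)
    (fun A hA => (represents_pieces hb hst hA).1) ht0 M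
  refine ⟨_, h1, h2, ?_⟩
  rw [← signal_eq hst hsup, ← sum_pieceMatrix]
  set P := (p.pieces.map fun A => NormedSpace.exp (-(t • pieceMatrix I p A))).prod ^ M
  set X := NormedSpace.exp (-(((κ : ℝ) / p.scale) • (p.pieces.map (pieceMatrix I p)).sum)) with hX
  -- The value of `β` is `t = κ/(ΛM)` times the bound `2Λ` on the norm of a piece, where `Λ` is the
  -- scale.
  have htrot := norm_trotter_le (fun A => t • pieceMatrix I p A) (β := 2 * κ / M) p.pieces
    (fun A hA => by
      obtain ⟨hr, hrow⟩ : p.Represents I A (pieceMatrix I p A) ∧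
          ∀ x, ∑ y, |pieceMatrix I p A x y| ≤ 2 * p.scale := represents_pieces hb hst hA
      refine ⟨hr.posSemidef.smul ht0, ?_⟩
      have hsymm : (pieceMatrix I p A).IsSymm := by
        rw [← Matrix.isHermitian_iff_isSymm]; exact hr.posSemidef.isHermitian
      rw [norm_smul, Real.norm_of_nonneg ht0]
      refine (mul_le_mul_of_nonneg_left (norm_le_of_row_sum_le hsymm (by positivity) hrow)
        ht0).trans (le_of_eq ?_)
      rw [ht]; field_simp) M
  have hXeq : NormedSpace.exp (-(M • (p.pieces.map fun A => t • pieceMatrix I p A).sum)) = X := by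
    rw [hX, List.smul_sum, ← List.smul_sum, ← Nat.cast_smul_eq_nsmul ℝ]
    have : (p.pieces.map fun A => t • pieceMatrix I p A).sum =
        t • (p.pieces.map (pieceMatrix I p)).sum := by
      rw [List.smul_sum, List.map_map]; rfl
    rw [this, smul_smul]
    congr 3
    rw [ht]; field_simp
  rw [hXeq] at htrot
  have e : ∀ u : Bits n → ℝ, u ⬝ᵥ P.mulVec u - u ⬝ᵥ X.mulVec u = u ⬝ᵥ (P - X).mulVec u := by
    intro u; rw [Matrix.sub_mulVec, dotProduct_sub]
  rw [add_sub_add_comm, e, e]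
  refine (abs_add_le _ _).trans ((add_le_add (dotProduct_mulVec_le_norm _ _)
    (dotProduct_mulVec_le_norm _ _)).trans ?_)
  have hnorm : ∑ x, (I.Φ x).re ^ 2 + ∑ x, (I.Φ x).im ^ 2 = 1 := by
    rw [← Finset.sum_add_distrib, ← I.norm_Φ]
    refine Finset.sum_congr rfl fun x _ => ?_
    rw [Complex.sq_norm, Complex.normSq_apply]; ring
  rw [← mul_add, hnorm, mul_one]
  refine htrot.trans (le_of_eq ?_)
  field_simp
  ring

end Signal

/-! ### Numerical linear algebra routines -/

/-- For a symmetric matrix the spectral theorem suffices: sort the eigenvalues by decreasing modulus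
and move their signs into the right factor. -/
theorem exists_svd {m : ℕ} {A : Matrix (Fin m) (Fin m) ℝ} (hA : A.IsSymm) :
    ∃ U s W, IsSVD A U s W := by
  have hH : A.IsHermitian := by rwa [Matrix.isHermitian_iff_isSymm]
  let Q : Matrix (Fin m) (Fin m) ℝ := hH.eigenvectorUnitary
  have hQ : Q.transpose * Q = 1 := by
    have := Unitary.coe_star_mul_self hH.eigenvectorUnitary
    rwa [Matrix.star_eq_conjTranspose, Matrix.conjTranspose_eq_transpose_of_trivial] at this
  have hAQ : A = Q * Matrix.diagonal hH.eigenvalues * Q.transpose := by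
    have := hH.spectral_theorem
    rw [Unitary.conjStarAlgAut_apply, Matrix.star_eq_conjTranspose,
      Matrix.conjTranspose_eq_transpose_of_trivial] at this
    simpa using this
  let τ := Tuple.sort fun i => -|hH.eigenvalues i|
  have hτ : Monotone ((fun i => -|hH.eigenvalues i|) ∘ τ) := Tuple.monotone_sort _
  let U := Q.submatrix id τ
  have hU : U.transpose * U = 1 := by
    ext i j
    have := congrFun (congrFun hQ (τ i)) (τ j)
    rw [Matrix.mul_apply, Matrix.one_apply] at this
    rw [Matrix.mul_apply, Matrix.one_apply]
    simpa [τ.injective.eq_iff, U] using this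
  have hUU : U * U.transpose = 1 := mul_eq_one_comm.1 hU
  let e : Fin m → ℝ := fun i => if 0 ≤ hH.eigenvalues (τ i) then 1 else -1
  have he : ∀ i, e i * e i = 1 := fun i => by simp only [e]; split_ifs <;> norm_num
  have hse : ∀ i, |hH.eigenvalues (τ i)| * e i = hH.eigenvalues (τ i) := fun i => by
    simp only [e]; split_ifs with h
    · rw [abs_of_nonneg h, mul_one]
    · rw [abs_of_neg (not_le.1 h)]; ring
  refine ⟨U, fun i => |hH.eigenvalues (τ i)|, Matrix.diagonal e * U.transpose, hU, ?_, ?_,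
    fun i => abs_nonneg _, ?_⟩
  · rw [Matrix.transpose_mul, Matrix.transpose_transpose, Matrix.diagonal_transpose,
      Matrix.mul_assoc, ← Matrix.mul_assoc (Matrix.diagonal e), Matrix.diagonal_mul_diagonal]
    simp only [he]
    rw [Matrix.diagonal_one, Matrix.one_mul, hUU]
  · intro i j hij
    have := hτ hij
    simp only [Function.comp] at this
    linarith
  · rw [← Matrix.mul_assoc, Matrix.mul_assoc U, Matrix.diagonal_mul_diagonal]
    simp only [hse]
    refine hAQ.trans ?_
    ext i j
    rw [Matrix.mul_apply, Matrix.mul_apply]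
    simp only [Matrix.mul_diagonal, Matrix.transpose_apply, U, Matrix.submatrix_apply, id]
    exact (Equiv.sum_comp τ fun l => Q i l * hH.eigenvalues l * Q j l).symm

theorem svd_spec {m : ℕ} {A : Matrix (Fin m) (Fin m) ℝ} (hA : A.IsSymm) :
    IsSVD A (svd A).1 (svd A).2.1 (svd A).2.2 := by
  obtain ⟨U, s, W, h⟩ := exists_svd hA
  exact Classical.epsilon_spec
    (p := fun d : Matrix (Fin m) (Fin m) ℝ × (Fin m → ℝ) × Matrix (Fin m) (Fin m) ℝ =>
      IsSVD A d.1 d.2.1 d.2.2) ⟨(U, s, W), h⟩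

/-- For invertible `A` the Penrose equation `ABA = A` alone determines `B`; the inverse itself shows
that a solution exists. -/
theorem pinv_eq_inv {m : ℕ} {A : Matrix (Fin m) (Fin m) ℝ} (hA : A.det ≠ 0) : pinv A = A⁻¹ := by
  have hu : IsUnit A.det := isUnit_iff_ne_zero.2 hA
  have h1 : A * A⁻¹ = 1 := Matrix.mul_nonsing_inv A hu
  have h2 : A⁻¹ * A = 1 := Matrix.nonsing_inv_mul A hu
  have hex : IsPinv A A⁻¹ := by
    refine ⟨?_, ?_, ?_, ?_⟩ <;> simp [h1, h2]
  have hs : IsPinv A (pinv A) := Classical.epsilon_spec ⟨_, hex⟩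
  calc pinv A = A⁻¹ * (A * pinv A * A) * A⁻¹ := by
        rw [Matrix.mul_assoc A, ← Matrix.mul_assoc A⁻¹, h2, Matrix.one_mul, Matrix.mul_assoc, h1,
          Matrix.mul_one]
    _ = A⁻¹ := by rw [hs.1, h2, Matrix.one_mul]

/-- Over `ℂ` the characteristic polynomial splits and has `m` roots with multiplicity, so the choice
in `eigenvalueList` has a witness. -/
theorem charpoly_eigenvalueList {m : ℕ} (A : Matrix (Fin m) (Fin m) ℝ) :
    (A.map (algebraMap ℝ ℂ)).charpoly =
      ∏ j, (Polynomial.X - Polynomial.C (eigenvalueList A j)) := by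
  set p := (A.map (algebraMap ℝ ℂ)).charpoly with hp
  have hsplit : p = (p.roots.map fun a => Polynomial.X - Polynomial.C a).prod :=
    (IsAlgClosed.splits p).eq_prod_roots_of_monic (Matrix.charpoly_monic _)
  have hcard : p.roots.toList.length = m := by
    rw [Multiset.length_toList, ← (IsAlgClosed.splits p).natDegree_eq_card_roots, hp,
      Matrix.charpoly_natDegree_eq_dim, Fintype.card_fin]
  refine Classical.epsilon_spec
    (p := fun z : Fin m → ℂ => p = ∏ j, (Polynomial.X - Polynomial.C (z j)))
    ⟨fun j => p.roots.toList.get (j.cast hcard.symm), ?_⟩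
  refine Eq.trans ?_ (Equiv.prod_comp (finCongr hcard.symm)
    (fun j => Polynomial.X - Polynomial.C (p.roots.toList.get j))).symm
  conv_lhs => rw [hsplit, ← Multiset.coe_toList p.roots, Multiset.map_coe, Multiset.prod_coe]
  rw [← List.prod_ofFn]
  congr 1
  conv_lhs => rw [← List.ofFn_get p.roots.toList, List.map_ofFn]
  rfl

/-! ### Bounds for determinants -/

section Determinants

variable {m : ℕ}

theorem abs_det_le {A : Matrix (Fin m) (Fin m) ℝ} {c : ℝ} (h : ∀ i j, |A i j| ≤ c) :
    |A.det| ≤ m.factorial * c ^ m := by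
  have := Matrix.det_le (A := A) (abv := AbsoluteValue.abs) (x := c) h
  simpa [nsmul_eq_mul] using this

theorem abs_adjugate_le {A : Matrix (Fin m) (Fin m) ℝ} {c : ℝ} (hc : 1 ≤ c)
    (h : ∀ i j, |A i j| ≤ c) (i j : Fin m) : |A.adjugate i j| ≤ m.factorial * c ^ m := by
  rw [Matrix.adjugate_apply]
  refine abs_det_le fun a l => ?_
  rw [Matrix.updateRow_apply]
  split_ifs
  · rw [Pi.single_apply]; split_ifs
    · simpa using hc
    · simpa using zero_le_one.trans hc
  · exact h a l

theorem abs_prod_sub_prod_le {ι : Type*} (s : Finset ι) {a b : ι → ℝ} {c η : ℝ} (hc : 1 ≤ c)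
    (ha : ∀ i, |a i| ≤ c) (hb : ∀ i, |b i| ≤ c) (h : ∀ i, |a i - b i| ≤ η) :
    |∏ i ∈ s, a i - ∏ i ∈ s, b i| ≤ s.card * c ^ s.card * η := by
  classical
  have hc0 : 0 ≤ c := zero_le_one.trans hc
  induction s using Finset.induction_on with
  | empty => simp
  | insert i s hi ih =>
    have hη : 0 ≤ η := (abs_nonneg _).trans (h i)
    rw [Finset.prod_insert hi, Finset.prod_insert hi, Finset.card_insert_of_notMem hi]
    have e : a i * ∏ j ∈ s, a j - b i * ∏ j ∈ s, b j =
        a i * (∏ j ∈ s, a j - ∏ j ∈ s, b j) + (a i - b i) * ∏ j ∈ s, b j := by ring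
    have hpb : |∏ j ∈ s, b j| ≤ c ^ s.card := by
      rw [Finset.abs_prod]
      exact (Finset.prod_le_prod (fun _ _ => abs_nonneg _) fun j _ => hb j).trans_eq (by simp)
    have h1 : |a i * (∏ j ∈ s, a j - ∏ j ∈ s, b j)| ≤ c * (s.card * c ^ s.card * η) := by
      rw [abs_mul]; exact mul_le_mul (ha i) ih (abs_nonneg _) hc0
    have h2 : |(a i - b i) * ∏ j ∈ s, b j| ≤ c * c ^ s.card * η := by
      rw [abs_mul]
      calc |a i - b i| * |∏ j ∈ s, b j| ≤ η * c ^ s.card :=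
            mul_le_mul (h i) hpb (abs_nonneg _) hη
        _ ≤ c * (η * c ^ s.card) := le_mul_of_one_le_left (by positivity) hc
        _ = _ := by ring
    rw [e]
    refine (abs_add_le _ _).trans ((add_le_add h1 h2).trans (le_of_eq ?_))
    push_cast; ring

theorem abs_det_sub_det_le {A B : Matrix (Fin m) (Fin m) ℝ} {c η : ℝ} (hc : 1 ≤ c)
    (hA : ∀ i j, |A i j| ≤ c) (hB : ∀ i j, |B i j| ≤ c) (h : ∀ i j, |A i j - B i j| ≤ η) :
    |A.det - B.det| ≤ m.factorial * (m * c ^ m * η) := by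
  rw [Matrix.det_apply', Matrix.det_apply', ← Finset.sum_sub_distrib]
  refine (Finset.abs_sum_le_sum_abs _ _).trans ?_
  refine (Finset.sum_le_card_nsmul _ _ (m * c ^ m * η) fun σ _ => ?_).trans ?_
  · rw [← mul_sub, abs_mul]
    have hs : |((Equiv.Perm.sign σ : ℤ) : ℝ)| = 1 := by
      rcases Int.units_eq_one_or (Equiv.Perm.sign σ) with h | h <;> simp [h]
    rw [hs, one_mul]
    simpa using abs_prod_sub_prod_le Finset.univ (a := fun i => A (σ i) i)
      (b := fun i => B (σ i) i) hc (fun i => hA _ _) (fun i => hB _ _) fun i => h _ _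
  · rw [Finset.card_univ, Fintype.card_perm, Fintype.card_fin, nsmul_eq_mul]

/-- Every factor of the Vandermonde product is at least `γ ≤ 1`. The exponent is the crude count of
at most `m` factors in each of `m` rows. -/
theorem abs_det_vandermonde_ge {z : Fin m → ℝ} {γ : ℝ} (hγ : 0 ≤ γ) (hγ1 : γ ≤ 1)
    (h : ∀ i j, i ≠ j → γ ≤ |z i - z j|) : (γ ^ m) ^ m ≤ |(Matrix.vandermonde z).det| := by
  rw [Matrix.det_vandermonde, Finset.abs_prod]
  have h1 : (γ ^ m) ^ m = ∏ _i : Fin m, γ ^ m := by simp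
  rw [h1]
  refine Finset.prod_le_prod (fun i _ => by positivity) fun i _ => ?_
  rw [Finset.abs_prod]
  calc γ ^ m ≤ γ ^ (Finset.Ioi i).card :=
        pow_le_pow_of_le_one hγ hγ1 ((Finset.card_le_univ _).trans_eq (Fintype.card_fin m))
    _ = ∏ _j ∈ Finset.Ioi i, γ := by simp
    _ ≤ _ := Finset.prod_le_prod (fun _ _ => hγ) fun j hj =>
        h j i (Finset.mem_Ioi.1 hj).ne'

/-- A determinant is small if the matrix nearly annihilates a vector. -/
theorem abs_det_mul_le {D : Matrix (Fin m) (Fin m) ℝ} {c : ℝ} (hc : 1 ≤ c)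
    (hD : ∀ i j, |D i j| ≤ c) {u : Fin m → ℝ} {η : ℝ} (h : ∀ i, |D.mulVec u i| ≤ η) (i : Fin m) :
    |D.det| * |u i| ≤ m * (m.factorial * c ^ m * η) := by
  have h1 : D.det * u i = ∑ j, D.adjugate i j * D.mulVec u j := by
    have : (D.adjugate * D).mulVec u = D.det • u := by
      rw [Matrix.adjugate_mul, Matrix.smul_mulVec, Matrix.one_mulVec]
    rw [← Matrix.mulVec_mulVec] at this
    exact (congrFun this i).symm
  rw [← abs_mul, h1]
  refine (Finset.abs_sum_le_sum_abs _ _).trans ?_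
  refine (Finset.sum_le_card_nsmul _ _ (m.factorial * c ^ m * η) fun j _ => ?_).trans (by simp)
  rw [abs_mul]
  exact mul_le_mul (abs_adjugate_le hc hD i j) (h j) (abs_nonneg _) (by positivity)

theorem sum_sq_mulVec_of_orthogonal {U : Matrix (Fin m) (Fin m) ℝ} (hU : U.transpose * U = 1)
    (v : Fin m → ℝ) : ∑ i, U.mulVec v i ^ 2 = ∑ i, v i ^ 2 := by
  have h : U.mulVec v ⬝ᵥ U.mulVec v = v ⬝ᵥ v := by
    rw [Matrix.dotProduct_mulVec, Matrix.vecMul_mulVec, ← Matrix.mulVec_transpose,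
      Matrix.transpose_mul, Matrix.transpose_transpose, hU, Matrix.one_mulVec]
  simpa [dotProduct, pow_two] using h

theorem abs_entry_le_one_of_orthogonal {U : Matrix (Fin m) (Fin m) ℝ}
    (hU : U.transpose * U = 1) (i j : Fin m) : |U i j| ≤ 1 := by
  have h := congrFun (congrFun hU j) j
  rw [Matrix.mul_apply, Matrix.one_apply_eq] at h
  have h1 : U.transpose j i * U i j ≤ 1 := h ▸ Finset.single_le_sum
    (f := fun i => U.transpose j i * U i j) (fun i _ => mul_self_nonneg (U i j))
    (Finset.mem_univ i)
  exact abs_le_one_iff_mul_self_le_one.2 h1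

theorem abs_sum_mul_le {c d : ℝ} {f g : Fin m → ℝ} (hf : ∀ i, |f i| ≤ c) (hg : ∀ i, |g i| ≤ d) :
    |∑ i, f i * g i| ≤ m * (c * d) := by
  refine (Finset.abs_sum_le_sum_abs _ _).trans ?_
  refine (Finset.sum_le_card_nsmul _ _ (c * d) fun i _ => ?_).trans (by simp)
  rw [abs_mul]
  exact mul_le_mul (hf i) (hg i) (abs_nonneg _) ((abs_nonneg _).trans (hf i))

end Determinants

/-! ### Stability of ESPRIT -/

section Esprit

variable {S : ℕ} {w z : Fin S → ℝ} {y : Fin (2 * S + 1) → ℝ} {ω γ ε : ℝ}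
  {U W : Matrix (Fin (S + 1)) (Fin (S + 1)) ℝ} {s : Fin (S + 1) → ℝ}

theorem hankel_isSymm (y : Fin (2 * S + 1) → ℝ) : (hankel y).IsSymm := by
  ext i j
  simp only [hankel, Matrix.transpose_apply, Matrix.of_apply]
  congr 2
  exact Nat.add_comm _ _

/-- The smallest singular value of the perturbed Hankel matrix is small. -/
theorem last_singular_value_le (hε : 0 ≤ ε)
    (hy : ∀ κ : Fin (2 * S + 1), |y κ - ∑ j, w j * z j ^ (κ : ℕ)| ≤ ε)
    (h : IsSVD (hankel y) U s W) : s (Fin.last S) ≤ (S + 1) * ε := by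
  obtain ⟨hU, hW, hanti, hs0, hA⟩ := h
  -- Its coefficient vector lies in the kernel of the exact Hankel matrix and is non-zero because
  -- its leading entry is 1.
  let P : Polynomial ℝ := ∏ j, (Polynomial.X - Polynomial.C (z j))
  have hmonic : P.Monic := Polynomial.monic_prod_of_monic _ _ fun j _ => Polynomial.monic_X_sub_C _
  have hdeg : P.natDegree = S := by
    rw [Polynomial.natDegree_prod_of_monic _ _ fun j _ => Polynomial.monic_X_sub_C _]
    simp
  let x : Fin (S + 1) → ℝ := fun l => P.coeff l
  have hroot : ∀ j, ∑ l, x l * z j ^ (l : ℕ) = 0 := by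
    intro j
    have h1 := Polynomial.eval_eq_sum_range' (p := P) (n := S + 1) (by omega) (z j)
    have h2 : P.eval (z j) = 0 := by
      rw [Polynomial.eval_prod]
      exact Finset.prod_eq_zero (Finset.mem_univ j) (by simp)
    rw [← h2, h1, Finset.sum_range]
  have hx : 0 < ∑ l, x l ^ 2 := by
    refine Finset.sum_pos' (fun l _ => sq_nonneg _) ⟨Fin.last S, Finset.mem_univ _, ?_⟩
    have : x (Fin.last S) = 1 := by
      simp only [x, Fin.val_last]
      rw [← hdeg]; exact hmonic
    rw [this]; norm_num
  have hker : ∀ i : Fin (S + 1), ∑ l : Fin (S + 1), (∑ j, w j * z j ^ ((i : ℕ) + l)) * x l = 0 := by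
    intro i
    simp only [Finset.sum_mul]
    rw [Finset.sum_comm]
    refine Finset.sum_eq_zero fun j _ => ?_
    have e : ∀ l : Fin (S + 1), w j * z j ^ ((i : ℕ) + l) * x l =
        (w j * z j ^ (i : ℕ)) * (x l * z j ^ (l : ℕ)) := fun l => by rw [pow_add]; ring
    simp only [e]
    rw [← Finset.mul_sum, hroot, mul_zero]
  have hrow : ∀ i, (hankel y).mulVec x i ^ 2 ≤ (S + 1) * ε ^ 2 * ∑ l, x l ^ 2 := by
    intro i
    have e : (hankel y).mulVec x i =
        ∑ l, (hankel y i l - ∑ j, w j * z j ^ ((i : ℕ) + l)) * x l := by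
      simp only [sub_mul, Finset.sum_sub_distrib, hker, sub_zero]
      rfl
    rw [e]
    refine (Finset.sum_mul_sq_le_sq_mul_sq _ _ _).trans (mul_le_mul_of_nonneg_right ?_ hx.le)
    refine (Finset.sum_le_card_nsmul _ _ (ε ^ 2) fun l _ => ?_).trans (by simp)
    rw [← sq_abs]
    exact pow_le_pow_left₀ (abs_nonneg _) (hy _) 2
  have hlow : s (Fin.last S) ^ 2 * ∑ l, x l ^ 2 ≤ ∑ i, (hankel y).mulVec x i ^ 2 := by
    rw [hA, Matrix.mul_assoc, ← Matrix.mulVec_mulVec, sum_sq_mulVec_of_orthogonal hU,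
      ← sum_sq_mulVec_of_orthogonal hW x, ← Matrix.mulVec_mulVec, Finset.mul_sum]
    refine Finset.sum_le_sum fun i _ => ?_
    rw [Matrix.mulVec_diagonal, mul_pow]
    exact mul_le_mul_of_nonneg_right
      (pow_le_pow_left₀ (hs0 _) (hanti (Fin.le_last i)) 2) (sq_nonneg _)
  have hup : ∑ i, (hankel y).mulVec x i ^ 2 ≤ ((S + 1) * ε) ^ 2 * ∑ l, x l ^ 2 := by
    refine (Finset.sum_le_card_nsmul _ _ _ fun i _ => hrow i).trans (le_of_eq ?_)
    simp; ring
  exact (pow_le_pow_iff_left₀ (hs0 _) (by positivity) two_ne_zero).1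
    (le_of_mul_le_mul_right (hlow.trans hup) hx)

/-- The signal vector `(1, z_j, …, z_j ^ S)` is nearly orthogonal to the last singular vector. -/
theorem last_singular_vector_le (hω : 0 < ω) (hw : ∀ j, ω ≤ w j) (hγ : 0 < γ) (hγ1 : γ ≤ 1)
    (hz : ∀ j, |z j| ≤ 1) (hgap : ∀ i j, i ≠ j → γ ≤ |z i - z j|) (hε : 0 ≤ ε)
    (hy : ∀ κ : Fin (2 * S + 1), |y κ - ∑ j, w j * z j ^ (κ : ℕ)| ≤ ε)
    (h : IsSVD (hankel y) U s W) (j : Fin S) :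
    |∑ r, U r (Fin.last S) * z j ^ (r : ℕ)| ≤
      2 * (S + 1) ^ 2 * S.factorial * (ε / (ω * (γ ^ S) ^ S)) := by
  have hs := last_singular_value_le hε hy h
  obtain ⟨hU, hW, hanti, hs0, hA⟩ := h
  set V := Matrix.vandermonde z with hV
  have hg : 0 < (γ ^ S) ^ S := by positivity
  have hdet := abs_det_vandermonde_ge hγ.le hγ1 hgap
  have hdet0 : V.det ≠ 0 := abs_pos.1 (hg.trans_le hdet)
  have hwj : 0 < w j := hω.trans_le (hw j)
  -- Column `j` of the inverse Vandermonde matrix divided by `w j`, padded with a zero: the exact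
  -- Hankel matrix maps `a` to `(1, z_j, …, z_j^S)`.
  let a' : Fin S → ℝ := fun l => V.adjugate l j / (V.det * w j)
  let a : Fin (S + 1) → ℝ := Fin.snoc a' 0
  set B : ℝ := S.factorial / (ω * (γ ^ S) ^ S) with hB
  have hB0 : 0 ≤ B := by positivity
  have ha' : ∀ i, ∑ l : Fin S, z i ^ (l : ℕ) * a' l = if i = j then 1 / w j else 0 := by
    intro i
    have h1 := congrFun (congrFun (Matrix.mul_adjugate V) i) j
    rw [Matrix.mul_apply, Matrix.smul_apply, Matrix.one_apply, smul_eq_mul] at h1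
    simp only [a', ← mul_div_assoc, ← Finset.sum_div]
    rw [show ∑ l : Fin S, z i ^ (l : ℕ) * V.adjugate l j = _ from h1]
    split_ifs
    · field_simp
    · simp
  have ha : ∀ i, ∑ l : Fin (S + 1), z i ^ (l : ℕ) * a l = if i = j then 1 / w j else 0 := by
    intro i
    rw [Fin.sum_univ_castSucc]
    simp only [a, Fin.snoc_castSucc, Fin.snoc_last, mul_zero, add_zero, Fin.val_castSucc]
    exact ha' i
  have hab : ∀ l, |a l| ≤ B := by
    intro l
    refine Fin.lastCases ?_ (fun l => ?_) l
    · simpa [a] using hB0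
    · simp only [a, Fin.snoc_castSucc, a']
      rw [abs_div, abs_mul, abs_of_pos hwj, hB]
      have h1 := abs_adjugate_le (A := V) (c := 1) le_rfl (fun i l => by
        rw [hV, Matrix.vandermonde_apply, abs_pow]
        exact pow_le_one₀ (abs_nonneg _) (hz i)) l j
      rw [one_pow, mul_one] at h1
      have h2 : ω * (γ ^ S) ^ S ≤ |V.det| * w j := by
        rw [mul_comm]; exact mul_le_mul hdet (hw j) hω.le (abs_nonneg _)
      exact div_le_div₀ (by positivity) h1 (by positivity) h2
  have hv : ∀ r : Fin (S + 1), z j ^ (r : ℕ) = (hankel y).mulVec a r -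
      ∑ l, (hankel y r l - ∑ i, w i * z i ^ ((r : ℕ) + l)) * a l := by
    intro r
    have e : ∑ l : Fin (S + 1), (∑ i, w i * z i ^ ((r : ℕ) + l)) * a l = z j ^ (r : ℕ) := by
      simp only [Finset.sum_mul]
      rw [Finset.sum_comm]
      have e1 : ∀ i, ∑ l : Fin (S + 1), w i * z i ^ ((r : ℕ) + l) * a l =
          if i = j then z j ^ (r : ℕ) else 0 := by
        intro i
        have e2 : ∀ l : Fin (S + 1), w i * z i ^ ((r : ℕ) + l) * a l =
            (w i * z i ^ (r : ℕ)) * (z i ^ (l : ℕ) * a l) := fun l => by rw [pow_add]; ring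
        simp only [e2]
        rw [← Finset.mul_sum, ha]
        split_ifs with hij
        · subst hij; field_simp
        · simp
      simp only [e1]
      simp
    simp only [sub_mul, Finset.sum_sub_distrib, e]
    rw [show ∑ l, hankel y r l * a l = (hankel y).mulVec a r from rfl]
    ring
  -- From `UᵀA = ΣW`: on the range of the noisy matrix the last singular vector sees only the small
  -- last singular value.
  have hUa : ∑ r, U r (Fin.last S) * (hankel y).mulVec a r =
      s (Fin.last S) * W.mulVec a (Fin.last S) := by
    have h1 : U.transpose.mulVec ((hankel y).mulVec a) = (Matrix.diagonal s).mulVec (W.mulVec a) := by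
      rw [Matrix.mulVec_mulVec, Matrix.mulVec_mulVec, hA, Matrix.mul_assoc, ← Matrix.mul_assoc, hU,
        Matrix.one_mul]
    have h2 := congrFun h1 (Fin.last S)
    rw [Matrix.mulVec_diagonal] at h2
    exact h2
  have e : ∑ r, U r (Fin.last S) * z j ^ (r : ℕ) = s (Fin.last S) * W.mulVec a (Fin.last S) -
      ∑ r, U r (Fin.last S) *
        ∑ l, (hankel y r l - ∑ i, w i * z i ^ ((r : ℕ) + l)) * a l := by
    rw [← hUa, ← Finset.sum_sub_distrib]
    refine Finset.sum_congr rfl fun r _ => ?_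
    rw [← mul_sub, ← hv]
  have b1 : |W.mulVec a (Fin.last S)| ≤ (S + 1 : ℕ) * (1 * B) :=
    abs_sum_mul_le (fun l => abs_entry_le_one_of_orthogonal hW _ l) hab
  have b2 : ∀ r : Fin (S + 1), |∑ l, (hankel y r l - ∑ i, w i * z i ^ ((r : ℕ) + l)) * a l| ≤
      (S + 1 : ℕ) * (ε * B) := fun r => abs_sum_mul_le (fun l => hy _) hab
  have b3 : |∑ r, U r (Fin.last S) *
      ∑ l, (hankel y r l - ∑ i, w i * z i ^ ((r : ℕ) + l)) * a l| ≤
      (S + 1 : ℕ) * (1 * ((S + 1 : ℕ) * (ε * B))) :=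
    abs_sum_mul_le (fun r => abs_entry_le_one_of_orthogonal hU _ _) b2
  rw [e]
  refine (abs_sub _ _).trans ?_
  have b4 : |s (Fin.last S) * W.mulVec a (Fin.last S)| ≤
      ((S + 1) * ε) * ((S + 1 : ℕ) * (1 * B)) := by
    rw [abs_mul, abs_of_nonneg (hs0 _)]
    exact mul_le_mul hs b1 (abs_nonneg _) (by positivity)
  refine (add_le_add b4 b3).trans (le_of_eq ?_)
  rw [hB]; push_cast; ring

/-- The characteristic polynomial of the ESPRIT matrix is small at the true decay factors. -/
theorem abs_charpoly_esprit_le (hS : 0 < S) {η : ℝ} (hη : η ≤ 1 / 2)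
    (hγ : 0 < γ) (hγ1 : γ ≤ 1) (hz : ∀ j, |z j| ≤ 1)
    (hgap : ∀ i j, i ≠ j → γ ≤ |z i - z j|) (hU : U.transpose * U = 1)
    (ht : ∀ j, |∑ r, U r (Fin.last S) * z j ^ (r : ℕ)| ≤ η)
    (hηγ : S.factorial * (S * 2 ^ S * η) ≤ (γ ^ S) ^ S / 2) (j : Fin S) :
    (U.submatrix Fin.castSucc Fin.castSucc).det ≠ 0 ∧
      |((U.submatrix Fin.castSucc Fin.castSucc)⁻¹ *
        (U.submatrix Fin.succ Fin.castSucc)).charpoly.eval (z j)| ≤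
        8 * S ^ 2 * S.factorial ^ 2 * 2 ^ S * (S + 1) ^ S * (η / (γ ^ S) ^ S) := by
  set U₀ := U.submatrix (Fin.castSucc : Fin S → Fin (S + 1)) Fin.castSucc with hU₀
  set U₁ := U.submatrix (Fin.succ : Fin S → Fin (S + 1)) Fin.castSucc with hU₁
  have hUU : U * U.transpose = 1 := mul_eq_one_comm.1 hU
  have hent := abs_entry_le_one_of_orthogonal hU
  have hη0 : 0 ≤ η := (abs_nonneg _).trans (ht j)
  have hg : 0 < (γ ^ S) ^ S := by positivity
  -- The coordinates of the signal vectors in the basis of left singular vectors: `t` along the last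
  -- one, `u` along the first `S`.
  let t : Fin S → ℝ := fun i => ∑ r, U r (Fin.last S) * z i ^ (r : ℕ)
  let u : Matrix (Fin S) (Fin S) ℝ :=
    Matrix.of fun c i => ∑ r, U r (Fin.castSucc c) * z i ^ (r : ℕ)
  have hzp : ∀ i (r : ℕ), |z i ^ r| ≤ 1 := fun i r => by
    rw [abs_pow]; exact pow_le_one₀ (abs_nonneg _) (hz i)
  have hdecomp : ∀ i (r : Fin (S + 1)),
      ∑ c : Fin S, U r c.castSucc * u c i = z i ^ (r : ℕ) - U r (Fin.last S) * t i := by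
    intro i r
    have h1 : (U * U.transpose).mulVec (fun r : Fin (S + 1) => z i ^ (r : ℕ)) r = z i ^ (r : ℕ) := by
      rw [hUU, Matrix.one_mulVec]
    rw [← Matrix.mulVec_mulVec, Matrix.mulVec, dotProduct, Fin.sum_univ_castSucc] at h1
    exact eq_sub_of_add_eq h1
  have hu : ∀ c i, |u c i| ≤ S + 1 := by
    intro c i
    have := abs_sum_mul_le (f := fun r : Fin (S + 1) => U r c.castSucc)
      (g := fun r : Fin (S + 1) => z i ^ (r : ℕ)) (fun r => hent _ _) fun r => hzp _ _
    simpa [u] using this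
  have hlt : ∀ (r : Fin (S + 1)) i, |U r (Fin.last S) * t i| ≤ η := fun r i => by
    rw [abs_mul]
    exact (mul_le_mul (hent _ _) (ht i) (abs_nonneg _) zero_le_one).trans_eq (one_mul _)
  -- the denominator
  have hprod : U₀ * u = Matrix.of fun (r i : Fin S) =>
      z i ^ (r : ℕ) - U r.castSucc (Fin.last S) * t i := by
    ext r i
    rw [Matrix.mul_apply]
    exact hdecomp i r.castSucc
  have hdiff : |(U₀ * u).det - (Matrix.vandermonde z).transpose.det| ≤
      S.factorial * (S * 2 ^ S * η) := by
    refine abs_det_sub_det_le (by norm_num) (fun r i => ?_) (fun r i => ?_) fun r i => ?_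
    · rw [hprod, Matrix.of_apply]
      refine (abs_sub _ _).trans ?_
      linarith [hzp i r, hlt r.castSucc i]
    · rw [Matrix.transpose_apply, Matrix.vandermonde_apply]
      linarith [hzp i r]
    · rw [hprod, Matrix.of_apply, Matrix.transpose_apply, Matrix.vandermonde_apply, sub_sub_cancel_left,
        abs_neg]
      exact hlt _ _
  -- `U₀ u` is a transposed Vandermonde matrix up to `η`. Since `det u` is bounded, this keeps `det
  -- U₀` away from zero.
  have hlow : (γ ^ S) ^ S / 2 ≤ |(U₀ * u).det| := by
    have h1 := abs_det_vandermonde_ge hγ.le hγ1 hgap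
    rw [Matrix.det_transpose] at hdiff
    have h2 := abs_sub_abs_le_abs_sub (Matrix.vandermonde z).det (U₀ * u).det
    rw [abs_sub_comm] at h2
    linarith
  have hudet : |u.det| ≤ S.factorial * (S + 1) ^ S := abs_det_le hu
  rw [Matrix.det_mul, abs_mul] at hlow
  set F : ℝ := S.factorial * (S + 1) ^ S with hF
  have hFpos : 0 < F := by
    have : (0 : ℝ) < S.factorial := by exact_mod_cast S.factorial_pos
    positivity
  have hU0F : (γ ^ S) ^ S / 2 ≤ |U₀.det| * F :=
    hlow.trans (mul_le_mul_of_nonneg_left hudet (abs_nonneg _))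
  have hU0pos : 0 < |U₀.det| := by
    by_contra hneg
    have h0 : |U₀.det| = 0 := le_antisymm (not_lt.1 hneg) (abs_nonneg _)
    rw [h0, zero_mul] at hU0F
    linarith
  have hU0ne : U₀.det ≠ 0 := abs_pos.1 hU0pos
  refine ⟨hU0ne, ?_⟩
  -- the numerator
  set D := z j • U₀ - U₁ with hD
  have hDent : ∀ r c, |D r c| ≤ 2 := by
    intro r c
    rw [hD, Matrix.sub_apply, Matrix.smul_apply, smul_eq_mul]
    refine (abs_sub _ _).trans ?_
    rw [abs_mul]
    have h1 : |z j| * |U₀ r c| ≤ 1 := mul_le_one₀ (hz j) (abs_nonneg _) (hent _ _)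
    have h2 : |U₁ r c| ≤ 1 := hent _ _
    linarith
  -- Shift invariance: without the terms containing `t`, rows `r` and `r + 1` would give `z_j ·
  -- z_j^r - z_j^(r+1) = 0`.
  have hDu : ∀ r, |D.mulVec (fun c => u c j) r| ≤ 2 * η := by
    intro r
    have e : D.mulVec (fun c => u c j) r =
        U r.succ (Fin.last S) * t j - z j * (U r.castSucc (Fin.last S) * t j) := by
      have h1 := hdecomp j r.castSucc
      have h2 := hdecomp j r.succ
      rw [hD, Matrix.sub_mulVec, Matrix.smul_mulVec, Pi.sub_apply, Pi.smul_apply, smul_eq_mul]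
      rw [show U₀.mulVec (fun c => u c j) r = _ from h1,
        show U₁.mulVec (fun c => u c j) r = _ from h2, Fin.val_succ, Fin.val_castSucc]
      ring
    rw [e]
    refine (abs_sub _ _).trans ?_
    have h3 : |z j * (U r.castSucc (Fin.last S) * t j)| ≤ 1 * η := by
      rw [abs_mul]
      exact mul_le_mul (hz j) (hlt _ _) (abs_nonneg _) zero_le_one
    linarith [hlt r.succ j]
  have hDdet := abs_det_mul_le (by norm_num) hDent hDu
  -- The first entry of every signal vector is 1, so the nearly annihilated vector is not small.
  have hone : 1 / 2 ≤ ∑ c, |u c j| := by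
    have h1 := hdecomp j 0
    rw [Fin.val_zero, pow_zero] at h1
    have h2 : |∑ c : Fin S, U 0 c.castSucc * u c j| ≤ ∑ c, |u c j| := by
      refine (Finset.abs_sum_le_sum_abs _ _).trans (Finset.sum_le_sum fun c _ => ?_)
      rw [abs_mul]
      exact mul_le_of_le_one_left (abs_nonneg _) (hent _ _)
    rw [h1] at h2
    have h3 := hlt 0 j
    have h4 := le_abs_self (1 - U 0 (Fin.last S) * t j)
    have h5 := le_abs_self (U 0 (Fin.last S) * t j)
    linarith
  have hDsmall : |D.det| ≤ 2 * (S * (S * (S.factorial * 2 ^ S * (2 * η)))) := by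
    have h1 : |D.det| * ∑ c, |u c j| ≤ S * (S * (S.factorial * 2 ^ S * (2 * η))) := by
      rw [Finset.mul_sum]
      exact (Finset.sum_le_card_nsmul _ _ _ fun c _ => hDdet c).trans_eq (by simp)
    have h2 := mul_le_mul_of_nonneg_left hone (abs_nonneg D.det)
    linarith
  have hchar : U₀.det * (U₀⁻¹ * U₁).charpoly.eval (z j) = D.det := by
    rw [Matrix.eval_charpoly, ← Matrix.det_mul, Matrix.mul_sub, ← Matrix.mul_assoc,
      Matrix.mul_nonsing_inv _ (isUnit_iff_ne_zero.2 hU0ne), Matrix.one_mul, hD]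
    congr 2
    rw [Matrix.scalar_apply, ← Matrix.smul_one_eq_diagonal, Matrix.mul_smul, Matrix.mul_one]
  have habs : |U₀.det| * |(U₀⁻¹ * U₁).charpoly.eval (z j)| = |D.det| := by
    rw [← abs_mul, hchar]
  set X := |(U₀⁻¹ * U₁).charpoly.eval (z j)|
  have hX : 0 ≤ X := abs_nonneg _
  have h1 : (γ ^ S) ^ S / 2 * X ≤ 2 * (S * (S * (S.factorial * 2 ^ S * (2 * η)))) * F := by
    calc (γ ^ S) ^ S / 2 * X ≤ |U₀.det| * F * X := mul_le_mul_of_nonneg_right hU0F hX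
      _ = |D.det| * F := by rw [← habs]; ring
      _ ≤ _ := mul_le_mul_of_nonneg_right hDsmall hFpos.le
  have h2 : X * (γ ^ S) ^ S ≤ 8 * S ^ 2 * S.factorial ^ 2 * 2 ^ S * (S + 1) ^ S * η := by
    rw [hF] at h1
    linarith
  rw [← mul_div_assoc, le_div_iff₀ hg]
  exact h2

theorem abs_log_sub_log_le {x y c : ℝ} (hc : 0 < c) (hx : c ≤ x) (hy : c ≤ y) :
    |Real.log x - Real.log y| ≤ |x - y| / c := by
  have key : ∀ {x y : ℝ}, c ≤ x → c ≤ y → Real.log x - Real.log y ≤ |x - y| / c := by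
    intro x y hx hy
    have hx0 := hc.trans_le hx
    have hy0 := hc.trans_le hy
    rw [← Real.log_div hx0.ne' hy0.ne']
    refine (Real.log_le_sub_one_of_pos (div_pos hx0 hy0)).trans ?_
    rw [div_sub_one hy0.ne']
    exact div_le_div₀ (abs_nonneg _) (le_abs_self _) hc hy
  rw [abs_le]
  refine ⟨?_, key hx hy⟩
  have := key hy hx
  rw [abs_sub_comm] at this
  linarith

/-- ESPRIT recovers the decay rates from a slightly perturbed signal. -/
theorem esprit_stable (S : ℕ) (hS : 0 < S) : ∃ K : ℝ, 0 < K ∧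
    ∀ (w z : Fin S → ℝ) (y : Fin (2 * S + 1) → ℝ) (ω γ η ε : ℝ), 0 < ω → (∀ j, ω ≤ w j) →
      0 < γ → γ ≤ 1 → (∀ j, 1 / 8 ≤ z j ∧ z j ≤ 1) → (∀ i j, i ≠ j → γ ≤ |z i - z j|) →
      0 < η → η ≤ 1 / 16 → 2 * η < γ → 0 ≤ ε →
      (∀ κ : Fin (2 * S + 1), |y κ - ∑ j, w j * z j ^ (κ : ℕ)| ≤ ε) →
      K * ε ≤ ω * ((γ ^ S) ^ S) ^ 2 * η ^ S →
      ∃ π : Equiv.Perm (Fin S), ∀ j, |Real.log ‖eigenvalueList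
        (pinv ((svd (hankel y)).1.submatrix (Fin.castSucc : Fin S → Fin (S + 1)) Fin.castSucc) *
          (svd (hankel y)).1.submatrix (Fin.succ : Fin S → Fin (S + 1)) Fin.castSucc) (π j)‖ -
        Real.log (z j)| ≤ 16 * η := by
  set K₁ : ℝ := 2 * (S + 1) ^ 2 * S.factorial with hK₁
  set K₂ : ℝ := 8 * S ^ 2 * S.factorial ^ 2 * 2 ^ S * (S + 1) ^ S with hK₂
  set K₃ : ℝ := S.factorial * (S * 2 ^ S) with hK₃
  have hK₂0 : 0 ≤ K₂ := by positivity
  have hK₃0 : 0 ≤ K₃ := by positivity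
  have hK₁0 : 0 < K₁ := by
    have : (0 : ℝ) < S.factorial := by exact_mod_cast S.factorial_pos
    positivity
  -- The summands `2`, `2K₃` and `K₂` secure, in this order, that `η₁ ≤ 1/2`, that `U₀` is
  -- invertible, and that the characteristic polynomial is at most `η^S` at the nodes.
  refine ⟨K₁ * (2 + 2 * K₃ + K₂), by positivity, ?_⟩
  intro w z y ω γ η ε hω hw hγ hγ1 hz hgap hη hη16 hηγ hε hy hK
  set g : ℝ := (γ ^ S) ^ S with hg
  have hg0 : 0 < g := by positivity
  have hg1 : g ≤ 1 := pow_le_one₀ (by positivity) (pow_le_one₀ hγ.le hγ1)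
  have hηS1 : η ^ S ≤ 1 := pow_le_one₀ hη.le (by linarith)
  have hηS0 : 0 < η ^ S := by positivity
  have hzabs : ∀ j, |z j| ≤ 1 := fun j => abs_le.2 ⟨by linarith [(hz j).1], (hz j).2⟩
  have hsvd := svd_spec (hankel_isSymm y)
  set U := (svd (hankel y)).1
  set η₁ : ℝ := K₁ * (ε / (ω * g)) with hη₁
  have hη₁0 : 0 ≤ η₁ := by positivity
  have ht : ∀ j, |∑ r, U r (Fin.last S) * z j ^ (r : ℕ)| ≤ η₁ :=
    last_singular_vector_le hω hw hγ hγ1 hzabs hgap hε hy hsvd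
  have hmain : (2 + 2 * K₃ + K₂) * η₁ ≤ g * η ^ S := by
    have e : (2 + 2 * K₃ + K₂) * η₁ = K₁ * (2 + 2 * K₃ + K₂) * ε / (ω * g) := by
      rw [hη₁]; ring
    rw [e, div_le_iff₀ (by positivity)]
    refine hK.trans (le_of_eq ?_)
    ring
  have hgη : g * η ^ S ≤ 1 := mul_le_one₀ hg1 hηS0.le hηS1
  have hgη2 : g * η ^ S ≤ g := mul_le_of_le_one_right hg0.le hηS1
  have c2 : 0 ≤ K₃ * η₁ := by positivity
  have c3 : 0 ≤ K₂ * η₁ := by positivity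
  have hhalf : η₁ ≤ 1 / 2 := by linarith
  have hcond : S.factorial * (S * 2 ^ S * η₁) ≤ g / 2 := by
    have : S.factorial * (S * 2 ^ S * η₁) = K₃ * η₁ := by rw [hK₃]; ring
    rw [this]; linarith
  have hchar := abs_charpoly_esprit_le hS hhalf hγ hγ1 hzabs hgap hsvd.1 ht hcond
  set U₀ := U.submatrix (Fin.castSucc : Fin S → Fin (S + 1)) Fin.castSucc
  set U₁ := U.submatrix (Fin.succ : Fin S → Fin (S + 1)) Fin.castSucc
  have hU₀ : U₀.det ≠ 0 := (hchar ⟨0, hS⟩).1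
  rw [pinv_eq_inv hU₀]
  set Z := eigenvalueList (U₀⁻¹ * U₁)
  have hprod : ∀ j, ∏ i, ‖(z j : ℂ) - Z i‖ ≤ η ^ S := by
    intro j
    have h1 : (((U₀⁻¹ * U₁).charpoly.eval (z j) : ℝ) : ℂ) = ∏ i, ((z j : ℂ) - Z i) := by
      have h2 := congrArg (Polynomial.eval (z j : ℂ)) (charpoly_eigenvalueList (U₀⁻¹ * U₁))
      rw [Polynomial.eval_prod, Matrix.charpoly_map] at h2
      rw [show (z j : ℂ) = algebraMap ℝ ℂ (z j) from rfl, Polynomial.eval_map_algebraMap,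
        Polynomial.aeval_algebraMap_apply] at h2
      simpa [Polynomial.aeval_def] using h2
    rw [← norm_prod, ← h1, Complex.norm_real, Real.norm_eq_abs]
    refine ((hchar j).2).trans ?_
    rw [← mul_div_assoc, div_le_iff₀ hg0]
    linarith
  -- A product of `S` factors that is at most `η^S` has a factor that is at most `η`.
  have hnear : ∀ j, ∃ i, ‖(z j : ℂ) - Z i‖ ≤ η := by
    intro j
    by_contra hcon
    push Not at hcon
    have : ∏ _i : Fin S, η < ∏ i, ‖(z j : ℂ) - Z i‖ :=
      Finset.prod_lt_prod_of_nonempty (fun _ _ => hη) (fun i _ => hcon i) ⟨⟨0, hS⟩, Finset.mem_univ _⟩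
    rw [Finset.prod_const, Finset.card_univ, Fintype.card_fin] at this
    exact absurd (hprod j) (not_le.2 this)
  choose f hf using hnear
  have hinj : Function.Injective f := by
    intro i j hij
    by_contra hne
    have h1 := hgap i j hne
    have h2 : ‖(z i : ℂ) - z j‖ ≤ 2 * η := by
      have e : (z i : ℂ) - z j = ((z i : ℂ) - Z (f i)) - ((z j : ℂ) - Z (f j)) := by rw [hij]; ring
      rw [e]
      exact (norm_sub_le _ _).trans (by linarith [hf i, hf j])
    rw [← Complex.ofReal_sub, Complex.norm_real, Real.norm_eq_abs] at h2
    linarith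
  refine ⟨Equiv.ofBijective f (Finite.injective_iff_bijective.1 hinj), fun j => ?_⟩
  rw [Equiv.ofBijective_apply]
  have h1 : |‖Z (f j)‖ - z j| ≤ η := by
    have h2 := abs_norm_sub_norm_le (Z (f j)) (z j : ℂ)
    rw [Complex.norm_real, Real.norm_eq_abs,
      abs_of_nonneg (show (0 : ℝ) ≤ z j by linarith [(hz j).1]),
      norm_sub_rev] at h2
    exact h2.trans (hf j)
  have h3 := (abs_le.1 h1).1
  -- Both moduli are at least `1/8 - 1/16`, so the logarithm has Lipschitz constant 16 there.
  refine (abs_log_sub_log_le (c := 1 / 16) (by norm_num) (by linarith [(hz j).1])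
    (by linarith [(hz j).1])).trans ?_
  rw [div_div_eq_mul_div, div_one]
  linarith

end Esprit

/-! ### The cost of the algorithm -/

section Cost

variable {n k N : ℕ} {I : Input n k N}

theorem costLE_hamEntry (x y : Bits n) : (hamEntry x y : Prog n N ℝ).CostLE I (N * (n + 2)) := by
  have := costLE_sumOver I (f := fun i : Fin N => do
    let z ← op (n := n) (N := N) (.entry i x y)
    pure z.re) (c := n + 1) (fun i => (costLE_op I _).bind I fun _ => costLE_pure I _)
    (List.finRange N)
  rwa [List.length_finRange] at this

/-- A bound for the cost of a matrix element of a piece; `h` is the number of hops. -/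
def entryCost (n N h : ℕ) : ℕ := (h + 1) * (n + 1 + N * (n + 2) + 1) + 1

theorem costLE_pieceEntry (p : Params n N) (A : Piece n N) (x y : Bits n) :
    (p.pieceEntry A x y).CostLE I (entryCost n N p.hops.length) := by
  have hle : n + 1 + N * (n + 2) + 1 ≤ entryCost n N p.hops.length := by
    unfold entryCost
    nlinarith [Nat.zero_le (p.hops.length * (n + 1 + N * (n + 2) + 1))]
  cases A with
  | term i =>
    refine Prog.CostLE.mono I (c := n + 1 + 1) ?_ (by omega)
    refine (costLE_op I _).bind I fun z => ?_
    split_ifs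
    · exact costLE_op I _
    · exact (costLE_pure I _).mono I (Nat.zero_le 1)
  | hop s =>
    simp only [Params.pieceEntry]
    split_ifs
    · refine Prog.CostLE.mono I (c := n + 1 + (N * (n + 2) + 1)) ?_ (by omega)
      exact (costLE_op I _).bind I fun _ => (costLE_hamEntry _ _).bind I fun _ => costLE_op I _
    · exact (costLE_hamEntry _ _).mono I (by omega)
  | diag =>
    simp only [Params.pieceEntry, entryCost]
    refine Prog.CostLE.bind I ?_ fun _ => costLE_op I _
    exact costLE_sumOver I (c := n + 1 + N * (n + 2))
      (fun s => Prog.CostLE.bind I (costLE_op I _) fun _ => costLE_hamEntry _ _) _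

/-- A bound for the cost of one step of the random walk with blocks of size at most `w`. -/
def stepCost (n N h w : ℕ) : ℕ :=
  w * (n + 1) + (w * (w * entryCost n N h) + ((w + 1) ^ 3 + ((w + 1) ^ 3 + (w * 3 + (w + 3)))))

theorem costLE_walkStep (p : Params n N) {w : ℕ} (t : ℝ) (A : Piece n N)
    (hA : (p.moves A).length + 1 ≤ w) (xR : Bits n × ℝ) :
    (p.walkStep t A xR).CostLE I (stepCost n N p.hops.length w) := by
  set l := p.moves A with hl
  refine Prog.CostLE.mono I (c := (l.length + 1) * (n + 1) + ((l.length + 1) *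
    ((l.length + 1) * entryCost n N p.hops.length) + ((l.length + 1 + 1) ^ 3 +
    ((l.length + 1 + 1) ^ 3 + ((l.length + 1) * 3 + (l.length + 1 + (1 + (1 + (1 + 0))))))))) ?_ ?_
  · unfold Params.walkStep
    refine Prog.CostLE.bind I (costLE_tab I (c := n + 1) fun j => costLE_op I _) fun y => ?_
    refine Prog.CostLE.bind I (costLE_tab I fun i => costLE_tab I fun j =>
      costLE_pieceEntry p A _ _) fun a => ?_
    refine Prog.CostLE.bind I (costLE_op I _) fun G => ?_
    refine Prog.CostLE.bind I (costLE_op I _) fun d => ?_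
    refine Prog.CostLE.bind I (costLE_tab I (c := 3) fun j => ?_) fun _ => ?_
    · refine Prog.CostLE.bind I (c := 1) (d := 2) (costLE_op I _) fun _ => ?_
      exact Prog.CostLE.bind I (c := 1) (d := 1) (costLE_op I _) fun _ => costLE_op I _
    · refine Prog.CostLE.bind I (costLE_op I _) fun _ => ?_
      refine Prog.CostLE.bind I (costLE_op I _) fun _ => ?_
      refine Prog.CostLE.bind I (costLE_op I _) fun _ => ?_
      exact Prog.CostLE.bind I (costLE_op I _) fun _ => costLE_pure I _
  · unfold stepCost
    have h3 : l.length + 1 + (1 + (1 + (1 + 0))) ≤ w + 3 := by omega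
    gcongr

/-- A bound for the cost of a sampled path. -/
def pathCost (n N h w len M s ρ : ℕ) : ℕ :=
  s + 1 + (M * (len * stepCost n N h w) + (ρ + 1 + 1))

theorem costLE_pathSample (p : Params n N) {w : ℕ}
    (hw : ∀ A ∈ p.pieces, (p.moves A).length + 1 ≤ w) (M : ℕ) (t : ℝ) :
    (p.pathSample M t).CostLE I
      (pathCost n N p.hops.length w p.pieces.length M I.sampleCost I.ratioCost) := by
  unfold Params.pathSample pathCost
  refine (costLE_op I _).bind I fun x => Prog.CostLE.bind I ?_ fun o =>
    (costLE_op I _).bind I fun _ => costLE_op I _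
  have := costLE_passThrough I (σ := Bits n × ℝ) (List.range M)
    (f := fun _ => passThrough (p.walkStep t) p.pieces)
    (fun j _ x => costLE_passThrough I p.pieces
      (fun A hA x => costLE_walkStep p t A (hw A hA) x) x) (x, 1)
  rwa [List.length_range] at this

theorem costLE_monteCarlo (p : Params n N) {w : ℕ}
    (hw : ∀ A ∈ p.pieces, (p.moves A).length + 1 ≤ w) (S M m : ℕ) (δ : ℝ) {q : ℕ}
    (hq : ⌈8 * Real.log ((2 * S + 1) / δ)⌉₊ ≤ q) :
    (p.monteCarlo S M m δ).CostLE I ((2 * S + 1) * (1 + (1 + (q * (m * (pathCost n N p.hops.length w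
      p.pieces.length M I.sampleCost I.ratioCost + 1) + 1) + (q + 1) ^ 2)))) := by
  refine costLE_tab I fun κ => (costLE_op I _).bind I fun d => (costLE_op I _).bind I fun t => ?_
  refine Prog.CostLE.mono I ?_ (show ⌈8 * Real.log ((2 * S + 1) / δ)⌉₊ * _ +
    (⌈8 * Real.log ((2 * S + 1) / δ)⌉₊ + 1) ^ 2 ≤ _ by gcongr)
  unfold Params.medianOfMeans
  refine Prog.CostLE.bind I (costLE_tab I fun j => Prog.CostLE.bind I ?_ fun s => costLE_op I _)
    fun f => costLE_op I _
  have := costLE_sumOver I (f := fun _ : ℕ => p.pathSample M t)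
    (fun _ => costLE_pathSample p hw M t) (List.range m)
  rwa [List.length_range] at this

theorem costLE_energyStage (p : Params n N) {S : ℕ} (y : Fin (2 * S + 1) → ℝ) :
    (p.energyStage y).CostLE I ((S + 1 + 1) ^ 3 + ((S + S + 1) ^ 3 + ((S + S + S + 1) ^ 3 +
      (S + 1) ^ 3)) + S * 4) := by
  unfold Params.energyStage Params.energies
  refine Prog.CostLE.bind I ?_ fun z => costLE_tab I (c := 4) fun j => ?_
  · unfold esprit
    refine Prog.CostLE.bind I (costLE_op I (.svd (hankel y))) fun d => ?_
    refine Prog.CostLE.bind I (costLE_op I (.pinv _)) fun P => ?_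
    exact Prog.CostLE.bind I (costLE_op I (.matMul P _)) fun _ => costLE_op I (.eigenvalues _)
  · refine Prog.CostLE.bind I (c := 1) (d := 3) (costLE_op I (.logAbs _)) fun _ => ?_
    refine Prog.CostLE.bind I (c := 1) (d := 2) (costLE_op I (.mul _ _)) fun _ => ?_
    exact Prog.CostLE.bind I (c := 1) (d := 1) (costLE_op I (.sub _ _)) fun _ =>
      costLE_op I (.sub _ _)

theorem length_hops_le (p : Params n N) : p.hops.length ≤ (p.k + 1) * (n + 1) ^ p.k := by
  classical
  unfold Params.hops
  rw [Finset.length_toList]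
  have hsub : (Finset.univ.filter fun s : Finset (Fin n) => 1 ≤ s.card ∧ s.card ≤ p.k) ⊆
      (Finset.range (p.k + 1)).biUnion fun j => Finset.powersetCard j Finset.univ := by
    intro s hs
    have := (Finset.mem_filter.1 hs).2
    exact Finset.mem_biUnion.2 ⟨s.card, Finset.mem_range.2 (by omega),
      Finset.mem_powersetCard.2 ⟨Finset.subset_univ _, rfl⟩⟩
  refine (Finset.card_le_card hsub).trans (Finset.card_biUnion_le.trans ?_)
  refine (Finset.sum_le_card_nsmul _ _ ((n + 1) ^ p.k) fun j hj => ?_).trans (by simp)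
  rw [Finset.card_powersetCard, Finset.card_univ, Fintype.card_fin]
  refine (Nat.choose_le_pow n j).trans ((Nat.pow_le_pow_left (Nat.le_succ n) j).trans ?_)
  exact Nat.pow_le_pow_right (Nat.succ_pos n) (Nat.lt_succ_iff.1 (Finset.mem_range.1 hj))

theorem length_pieces_le (p : Params n N) :
    p.pieces.length ≤ N + ((p.k + 1) * (n + 1) ^ p.k + 1) := by
  unfold Params.pieces
  have := length_hops_le p
  cases p.scheme
  · simp
  · simp; omega

theorem length_moves_le (b : ℕ) (σ : Scheme) (A : Piece n N) :
    ((I.params b σ).moves A).length + 1 ≤ 2 ^ k + 1 := by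
  cases A with
  | term i =>
    simp only [Params.moves, Finset.length_toList, Input.params]
    refine Nat.succ_le_succ ((Finset.card_erase_le).trans ?_)
    rw [Finset.card_powerset]
    exact Nat.pow_le_pow_right (by norm_num) (I.ham.card_supp_le i)
  | hop s => simpa [Params.moves] using Nat.one_le_two_pow
  | diag => simp [Params.moves]

/-- Since `log(2S + 1) ≤ 2S`, the number of groups is linear in `⌈log(1/δ)⌉`. -/
theorem ceil_log_le (S : ℕ) {δ : ℝ} (h0 : 0 < δ) :
    ⌈8 * Real.log ((2 * S + 1) / δ)⌉₊ ≤ 16 * S + 8 * ⌈Real.log (1 / δ)⌉₊ := by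
  rw [Nat.ceil_le]
  have hS : (0 : ℝ) < 2 * S + 1 := by positivity
  have h1 : Real.log ((2 * S + 1) / δ) = Real.log (2 * S + 1) + Real.log (1 / δ) := by
    rw [← Real.log_mul hS.ne' (by positivity)]; congr 1; ring
  have h2 := Real.log_le_sub_one_of_pos hS
  have h3 := Nat.le_ceil (Real.log (1 / δ))
  rw [h1]; push_cast; linarith

end Cost

theorem polynomial_eval_mono (P : Polynomial ℕ) {a b : ℕ} (h : a ≤ b) : P.eval a ≤ P.eval b := by
  rw [Polynomial.eval_eq_sum_range, Polynomial.eval_eq_sum_range]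
  gcongr

/-! ### Accuracy of the two stages -/

section Accuracy

variable {n k N S : ℕ} {I : Input n k N} {b : ℕ} {σ : Scheme} {E : Fin S → ℝ}
  {ψ : Fin S → Bits n → ℂ}

theorem det_energyStage (p : Params n N) (y : Fin (2 * S + 1) → ℝ) :
    (p.energyStage y).Det I fun j => 0 - p.scale * Real.log ‖eigenvalueList
      (pinv ((svd (hankel y)).1.submatrix (Fin.castSucc : Fin S → Fin (S + 1)) Fin.castSucc) *
        (svd (hankel y)).1.submatrix (Fin.succ : Fin S → Fin (S + 1)) Fin.castSucc) j‖ -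
      p.shift := by
  refine Prog.Det.bind I (a := eigenvalueList
      (pinv ((svd (hankel y)).1.submatrix (Fin.castSucc : Fin S → Fin (S + 1)) Fin.castSucc) *
        (svd (hankel y)).1.submatrix (Fin.succ : Fin S → Fin (S + 1)) Fin.castSucc)) ?_
    (det_tab I fun j => ?_)
  · refine (det_op I (.svd (hankel y)) _ rfl).bind I ?_
    refine (det_op I (.pinv _) _ rfl).bind I ?_
    refine (det_op I (.matMul _ _) _ rfl).bind I ?_
    exact det_op I (.eigenvalues _) _ rfl
  · refine (det_op I (.logAbs _) _ rfl).bind I ?_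
    refine (det_op I (.mul _ _) _ rfl).bind I ?_
    refine (det_op I (.sub _ _) _ rfl).bind I ?_
    exact det_op I (.sub _ _) _ rfl

open Classical in
/-- The failure probability of one of the estimates of the signal. -/
theorem ev_medianOfMeans_le (p : Params n N) {M m q : ℕ} {t g μ ε : ℝ} (hq : 0 < q) (hm : 0 < m)
    (hε : 0 < ε) (h1 : (p.pathSample M t).ev I (fun v => v) = μ)
    (h2 : (p.pathSample M t).ev I (fun v => v ^ 2) ≤ 1) (hμ : |μ - g| ≤ ε / 2)
    (hmε : 16 ≤ m * ε ^ 2) :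
    (p.medianOfMeans M m q t).ev I (fun v => if ε < |v - g| then 1 else 0) ≤
      Real.exp (-(q / 8)) := by
  refine ev_median_le I hq ?_
  refine le_trans (Prog.ev_mono I _ (g := fun v => if ε / 2 < |v - μ| then 1 else 0) fun v => ?_)
    ((ev_mean_le I hm (half_pos hε) h1 h2).trans ?_)
  · by_cases h : ε < |v - g|
    · have h3 := abs_sub_le v μ g
      rw [if_pos h, if_pos (by linarith)]
    · rw [if_neg h]; split_ifs <;> norm_num
  · have hm' : (0 : ℝ) < m := by exact_mod_cast hm
    rw [div_le_div_iff₀ (by positivity) (by norm_num)]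
    nlinarith

theorem monteCarlo_ev_apply (p : Params n N) (M m : ℕ) (δ : ℝ) (κ : Fin (2 * S + 1)) (f : ℝ → ℝ) :
    (p.monteCarlo S M m δ).ev I (fun y => f (y κ)) =
      (p.medianOfMeans M m ⌈8 * Real.log ((2 * S + 1) / δ)⌉₊ ((κ : ℕ) / (p.scale * M))).ev I f := by
  unfold Params.monteCarlo Params.mcSignal
  rw [ev_tab_apply, Prog.ev_bind, ev_mul, Prog.ev_bind, ev_div]

/-- If all estimates of the signal are accurate enough for the energies to lie in `F`, then they
do so with probability at least `1 - δ`. -/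
theorem prob_ge (p : Params n N) {M m : ℕ} {δ : ℝ} (hδ : 0 < δ) (hδ1 : δ < 1) {ε : ℝ} (hε : 0 < ε)
    (hm : 0 < m) (hmε : 16 ≤ m * ε ^ 2) (g : ℕ → ℝ)
    (hmean : ∀ κ : Fin (2 * S + 1), ∃ μ,
      (p.pathSample M ((κ : ℕ) / (p.scale * M))).ev I (fun v => v) = μ ∧
      (p.pathSample M ((κ : ℕ) / (p.scale * M))).ev I (fun v => v ^ 2) ≤ 1 ∧ |μ - g κ| ≤ ε / 2)
    {F : Set (Fin S → ℝ)} {r : (Fin (2 * S + 1) → ℝ) → Fin S → ℝ}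
    (hr : ∀ y, (p.energyStage y).Det I (r y))
    (hF : ∀ y : Fin (2 * S + 1) → ℝ, (∀ κ : Fin (2 * S + 1), |y κ - g κ| ≤ ε) → r y ∈ F) :
    ENNReal.ofReal (1 - δ) ≤ (p.monteCarlo S M m δ >>= p.energyStage).prob I F := by
  classical
  refine ENNReal.ofReal_le_of_le_toReal ?_
  rw [Prog.prob_toReal, Prog.ev_bind]
  simp only [fun y => (hr y).ev]
  set q := ⌈8 * Real.log ((2 * S + 1) / δ)⌉₊ with hqdef
  have hx1 : 1 < (2 * S + 1) / δ := by
    rw [one_lt_div hδ]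
    have : (0 : ℝ) ≤ S := Nat.cast_nonneg S
    linarith
  have hq : 0 < q := Nat.ceil_pos.2 (mul_pos (by norm_num) (Real.log_pos hx1))
  have hbad : ∀ κ : Fin (2 * S + 1), (p.monteCarlo S M m δ).ev I
      (fun y => if ε < |y κ - g κ| then 1 else 0) ≤ δ / (2 * S + 1) := by
    intro κ
    obtain ⟨μ, h1, h2, h3⟩ := hmean κ
    rw [monteCarlo_ev_apply p M m δ κ fun v => if ε < |v - g κ| then 1 else 0]
    refine (ev_medianOfMeans_le p hq hm hε h1 h2 h3 hmε).trans ?_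
    have h4 : 8 * Real.log ((2 * S + 1) / δ) ≤ q := Nat.le_ceil _
    have h5 : δ / (2 * S + 1) = Real.exp (-Real.log ((2 * S + 1) / δ)) := by
      rw [Real.exp_neg, Real.exp_log (by linarith), inv_div]
    rw [h5]
    exact Real.exp_le_exp.2 (by linarith)
  -- The union bound over the `2S + 1` values of `κ`, as a pointwise inequality between test
  -- functions.
  have hlow : (p.monteCarlo S M m δ).ev I (fun y => 1 + (-1) *
      ∑ κ : Fin (2 * S + 1), if ε < |y κ - g κ| then 1 else 0) ≤
      (p.monteCarlo S M m δ).ev I fun y => F.indicator 1 (r y) := by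
    refine Prog.ev_mono I _ fun y => ?_
    by_cases hy : ∀ κ : Fin (2 * S + 1), |y κ - g κ| ≤ ε
    · rw [Set.indicator_of_mem (hF y hy), Finset.sum_eq_zero fun κ _ => if_neg (not_lt.2 (hy κ))]
      simp
    · push Not at hy
      obtain ⟨κ, hκ⟩ := hy
      have h1 : (1 : ℝ) ≤ ∑ κ : Fin (2 * S + 1), if ε < |y κ - g κ| then 1 else 0 := by
        refine le_trans (by rw [if_pos hκ]) (Finset.single_le_sum
          (f := fun κ : Fin (2 * S + 1) => if ε < |y κ - g κ| then (1 : ℝ) else 0)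
          (fun κ _ => by split_ifs <;> norm_num) (Finset.mem_univ κ))
      have h2 : (0 : ℝ) ≤ F.indicator 1 (r y) := Set.indicator_nonneg (fun _ _ => zero_le_one) _
      linarith
  refine le_trans ?_ hlow
  rw [Prog.ev_add, Prog.ev_const, Prog.ev_const_mul, Prog.ev_sum]
  have hsum : ∑ κ : Fin (2 * S + 1), (p.monteCarlo S M m δ).ev I
      (fun y => if ε < |y κ - g κ| then 1 else 0) ≤ δ := by
    refine (Finset.sum_le_card_nsmul _ _ _ fun κ _ => hbad κ).trans (le_of_eq ?_)
    have : (0 : ℝ) < 2 * S + 1 := by positivity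
    simp
    field_simp
  linarith

/-- On `(-∞, 2]` the slope of `exp(-x)` has modulus at least `exp(-2) ≥ 1/8`, so energy gaps become
gaps between decay factors. -/
theorem abs_exp_neg_sub_ge {x y : ℝ} (hx : x ≤ 2) (hy : y ≤ 2) :
    |x - y| / 8 ≤ |Real.exp (-x) - Real.exp (-y)| := by
  have h8 : 1 / 8 ≤ Real.exp (-2) := by
    rw [Real.exp_neg, one_div]
    refine inv_anti₀ (Real.exp_pos _) ?_
    have h1 := Real.exp_one_lt_d9
    have h2 : Real.exp 2 = Real.exp 1 * Real.exp 1 := by rw [← Real.exp_add]; norm_num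
    rw [h2]; nlinarith [Real.exp_pos 1]
  have key : ∀ {x y : ℝ}, x ≤ y → y ≤ 2 → |x - y| / 8 ≤ |Real.exp (-x) - Real.exp (-y)| := by
    intro x y hxy hy
    have h1 : Real.exp (-x) = Real.exp (-y) * Real.exp (y - x) := by
      rw [← Real.exp_add]; congr 1; ring
    have h2 := Real.add_one_le_exp (y - x)
    have h3 : 1 / 8 ≤ Real.exp (-y) := h8.trans (Real.exp_le_exp.2 (by linarith))
    rw [abs_of_nonpos (by linarith)]
    refine le_trans ?_ (le_abs_self _)
    have h4 : (1 / 8) * (y - x) ≤ Real.exp (-y) * (Real.exp (y - x) - 1) :=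
      mul_le_mul h3 (by linarith) (by linarith) (Real.exp_pos _).le
    rw [h1]; linarith
  rcases le_total x y with h | h
  · exact key h hy
  · rw [abs_sub_comm, abs_sub_comm (Real.exp _)]; exact key h hx

theorem one_div_eight_le_exp_neg {x : ℝ} (hx : x ≤ 2) : 1 / 8 ≤ Real.exp (-x) := by
  have h1 := Real.exp_one_lt_d9
  have h2 : Real.exp 2 = Real.exp 1 * Real.exp 1 := by rw [← Real.exp_add]; norm_num
  have h3 : 1 / 8 ≤ Real.exp (-2) := by
    rw [Real.exp_neg, one_div]
    exact inv_anti₀ (Real.exp_pos _) (by rw [h2]; nlinarith [Real.exp_pos 1])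
  exact h3.trans (Real.exp_le_exp.2 (by linarith))

theorem matchingDist_le {S : ℕ} (hS : 0 < S) {E F : Fin S → ℝ} {c : ℝ} (π : Equiv.Perm (Fin S))
    (h : ∀ j, |F (π j) - E j| ≤ c) : matchingDist E F ≤ c / (2 * Real.pi) := by
  have : Nonempty (Fin S) := ⟨⟨0, hS⟩⟩
  unfold matchingDist
  rw [div_eq_mul_one_div c, mul_comm c]
  refine mul_le_mul_of_nonneg_left ?_ (by positivity)
  exact (ciInf_le (Set.finite_range _).bddBelow π).trans (ciSup_le h)

/-- The eigenvalues are recovered from an accurate signal. -/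
theorem energies_accurate (hS : 0 < S) {K : ℝ} {b : ℕ} {ω γ η ε : ℝ}
    (hK : ∀ (w z : Fin S → ℝ) (y : Fin (2 * S + 1) → ℝ) (ω γ η ε : ℝ), 0 < ω → (∀ j, ω ≤ w j) →
      0 < γ → γ ≤ 1 → (∀ j, 1 / 8 ≤ z j ∧ z j ≤ 1) → (∀ i j, i ≠ j → γ ≤ |z i - z j|) →
      0 < η → η ≤ 1 / 16 → 2 * η < γ → 0 ≤ ε →
      (∀ κ : Fin (2 * S + 1), |y κ - ∑ j, w j * z j ^ (κ : ℕ)| ≤ ε) →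
      K * ε ≤ ω * ((γ ^ S) ^ S) ^ 2 * η ^ S →
      ∃ π : Equiv.Perm (Fin S), ∀ j, |Real.log ‖eigenvalueList
        (pinv ((svd (hankel y)).1.submatrix (Fin.castSucc : Fin S → Fin (S + 1)) Fin.castSucc) *
          (svd (hankel y)).1.submatrix (Fin.succ : Fin S → Fin (S + 1)) Fin.castSucc) (π j)‖ -
        Real.log (z j)| ≤ 16 * η)
    (hscale : 0 < (I.params b σ).scale) (hb : ∀ i, opNorm (I.ham.term i) ≤ b)
    (hst : I.ham.Stoquastic σ) (hsup : SupportedOn I.ham.total I.Φ E ψ)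
    (hω : 0 < ω) (hw : ∀ j, ω ≤ ‖star (ψ j) ⬝ᵥ I.Φ‖ ^ 2) (hγ : 0 < γ) (hγ1 : γ ≤ 1)
    (hgap : ∀ i j, i ≠ j → γ ≤ |E i - E j| / (I.params b σ).scale / 8)
    (hη : 0 < η) (hη16 : η ≤ 1 / 16) (hηγ : 2 * η < γ) (hε : 0 ≤ ε)
    (hKε : K * ε ≤ ω * ((γ ^ S) ^ S) ^ 2 * η ^ S) (y : Fin (2 * S + 1) → ℝ)
    (hy : ∀ κ : Fin (2 * S + 1), |y κ - ∑ j, ‖star (ψ j) ⬝ᵥ I.Φ‖ ^ 2 *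
      Real.exp (-((κ : ℕ) / (I.params b σ).scale * (E j + (I.params b σ).shift)))| ≤ ε) :
    matchingDist E (fun j => 0 - (I.params b σ).scale * Real.log ‖eigenvalueList
      (pinv ((svd (hankel y)).1.submatrix (Fin.castSucc : Fin S → Fin (S + 1)) Fin.castSucc) *
        (svd (hankel y)).1.submatrix (Fin.succ : Fin S → Fin (S + 1)) Fin.castSucc) j‖ -
      (I.params b σ).shift) ≤ (I.params b σ).scale * (16 * η) / (2 * Real.pi) := by
  set p := I.params b σ with hp
  have hs : (0 : ℝ) < p.scale := by exact_mod_cast hscale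
  have hshift : (p.shift : ℝ) = N * (2 ^ k * b) := by simp [hp, Params.shift, Input.params]
  have hsc : (p.scale : ℝ) = (N + 1) * (2 ^ k * b) := by simp [hp, Params.scale, Input.params]
  have hkb : (0 : ℝ) ≤ 2 ^ k * b := by positivity
  let e : Fin S → ℝ := fun j => (E j + p.shift) / p.scale
  -- Each `E j` lies in `[-shift, shift]`, and `shift ≤ scale`.
  have he : ∀ j, 0 ≤ e j ∧ e j ≤ 2 := by
    intro j
    have h1 := abs_le.1 (abs_eigenvalue_le hb hst hsup j)
    rw [← hshift] at h1
    refine ⟨div_nonneg (by linarith) hs.le, ?_⟩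
    rw [div_le_iff₀ hs]
    have : (p.shift : ℝ) ≤ p.scale := by rw [hshift, hsc]; linarith
    linarith
  obtain ⟨π, hπ⟩ := hK (fun j => ‖star (ψ j) ⬝ᵥ I.Φ‖ ^ 2) (fun j => Real.exp (-e j)) y ω γ η ε hω hw
    hγ hγ1 (fun j => ⟨one_div_eight_le_exp_neg (he j).2,
      Real.exp_le_one_iff.2 (by linarith [(he j).1])⟩)
    (fun i j hij => (hgap i j hij).trans (by
      refine le_trans (le_of_eq ?_) (abs_exp_neg_sub_ge (he i).2 (he j).2)
      simp only [e]
      rw [← sub_div, add_sub_add_right_eq_sub, abs_div, abs_of_pos hs]))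
    hη hη16 hηγ hε (fun κ => by
      refine le_trans (le_of_eq ?_) (hy κ)
      congr 2
      refine Finset.sum_congr rfl fun j _ => ?_
      rw [← Real.exp_nat_mul]
      congr 2
      simp only [e]
      ring) hKε
  refine matchingDist_le hS π fun j => ?_
  have h2 := hπ j
  rw [Real.log_exp] at h2
  set X := Real.log ‖eigenvalueList
    (pinv ((svd (hankel y)).1.submatrix (Fin.castSucc : Fin S → Fin (S + 1)) Fin.castSucc) *
      (svd (hankel y)).1.submatrix (Fin.succ : Fin S → Fin (S + 1)) Fin.castSucc) (π j)‖
  have e2 : 0 - p.scale * X - p.shift - E j = -(p.scale * (X - -e j)) := by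
    simp only [e]; field_simp; ring
  rw [e2, abs_neg, abs_mul, abs_of_pos hs]
  exact mul_le_mul_of_nonneg_left h2 hs.le

end Accuracy

/-! ### Polynomial cost bounds and the choice of the parameters -/

theorem pathCost_mono {n n' N N' h h' w len len' M M' s s' ρ ρ' : ℕ} (hn : n ≤ n') (hN : N ≤ N')
    (hh : h ≤ h') (hl : len ≤ len') (hM : M ≤ M') (hs : s ≤ s') (hρ : ρ ≤ ρ') :
    pathCost n N h w len M s ρ ≤ pathCost n' N' h' w len' M' s' ρ' := by
  unfold pathCost stepCost entryCost
  gcongr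

/-- A bound for the total cost of both stages. -/
def costPolynomial (k S₀ : ℕ) (p M m : Polynomial ℕ) : Polynomial ℕ :=
  let X : Polynomial ℕ := Polynomial.X
  let h : Polynomial ℕ := ((k : Polynomial ℕ) + 1) * (X + 1) ^ k
  let w : Polynomial ℕ := 2 ^ k + 1
  let entry := (h + 1) * (X + 1 + p * (X + 2) + 1) + 1
  let step := w * (X + 1) + (w * (w * entry) + ((w + 1) ^ 3 + ((w + 1) ^ 3 + (w * 3 + (w + 3)))))
  let path := p + 1 + (M * ((p + (h + 1)) * step) + (p + 1 + 1))
  let q := 16 * (S₀ : Polynomial ℕ) + 8 * X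
  let S : Polynomial ℕ := S₀
  (2 * S + 1) * (1 + (1 + (q * (m * (path + 1) + 1) + (q + 1) ^ 2))) +
    ((S + 1 + 1) ^ 3 + ((S + S + 1) ^ 3 + ((S + S + S + 1) ^ 3 + (S + 1) ^ 3)) + S * 4)

theorem eval_costPolynomial (k S₀ : ℕ) (p M m : Polynomial ℕ) (x : ℕ) :
    (costPolynomial k S₀ p M m).eval x =
      (2 * S₀ + 1) * (1 + (1 + ((16 * S₀ + 8 * x) * (m.eval x * (pathCost x (p.eval x)
        ((k + 1) * (x + 1) ^ k) (2 ^ k + 1) (p.eval x + ((k + 1) * (x + 1) ^ k + 1)) (M.eval x)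
        (p.eval x) (p.eval x) + 1) + 1) + (16 * S₀ + 8 * x + 1) ^ 2))) +
      ((S₀ + 1 + 1) ^ 3 + ((S₀ + S₀ + 1) ^ 3 + ((S₀ + S₀ + S₀ + 1) ^ 3 + (S₀ + 1) ^ 3)) +
        S₀ * 4) := by
  simp [costPolynomial, pathCost, stepCost, entryCost]

/-- All bounds are monotone, so for the Monte Carlo stage `n` may be replaced everywhere by `n +
⌈log(1/δ)⌉`, which also bounds the number of groups. -/
theorem costLE_both {n k N S S₀ : ℕ} {I : Input n k N} {σ : Scheme} {p M m : Polynomial ℕ} {δ : ℝ}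
    (hδ : 0 < δ) (hS : S ≤ S₀) (hN : N ≤ p.eval n) (hs : I.sampleCost ≤ p.eval n)
    (hr : I.ratioCost ≤ p.eval n) :
    ((I.params (p.eval n) σ).monteCarlo S (M.eval n) (m.eval n) δ).CostLE I
      ((costPolynomial k S₀ p M m).eval (n + ⌈Real.log (1 / δ)⌉₊)) ∧
    ∀ y : Fin (2 * S + 1) → ℝ, ((I.params (p.eval n) σ).energyStage y).CostLE I
      ((costPolynomial k S₀ p M m).eval n) := by
  constructor
  · set x := n + ⌈Real.log (1 / δ)⌉₊ with hx
    have hnx : n ≤ x := Nat.le_add_right _ _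
    have hp := polynomial_eval_mono p hnx
    have hM := polynomial_eval_mono M hnx
    have hm := polynomial_eval_mono m hnx
    have hq : ⌈8 * Real.log ((2 * S + 1) / δ)⌉₊ ≤ 16 * S₀ + 8 * x :=
      (ceil_log_le S hδ).trans (by omega)
    refine (costLE_monteCarlo (I.params (p.eval n) σ) (fun A _ => length_moves_le _ σ A) S (M.eval n)
      (m.eval n) δ hq).mono I ?_
    rw [eval_costPolynomial]
    refine le_trans ?_ (Nat.le_add_right _ _)
    have hpow : (k + 1) * (n + 1) ^ k ≤ (k + 1) * (x + 1) ^ k := by gcongr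
    have hhops : (I.params (p.eval n) σ).hops.length ≤ (k + 1) * (x + 1) ^ k :=
      (length_hops_le (I.params (p.eval n) σ)).trans hpow
    have hlen : (I.params (p.eval n) σ).pieces.length ≤
        p.eval x + ((k + 1) * (x + 1) ^ k + 1) :=
      (length_pieces_le (I.params (p.eval n) σ)).trans
        (Nat.add_le_add (hN.trans hp) (Nat.add_le_add_right hpow 1))
    have hpc := pathCost_mono (w := 2 ^ k + 1) hnx (hN.trans hp) hhops hlen hM (hs.trans hp)
      (hr.trans hp)
    gcongr
  · intro y
    refine (costLE_energyStage (I.params (p.eval n) σ) y).mono I ?_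
    rw [eval_costPolynomial]
    refine le_trans ?_ (Nat.le_add_left _ _)
    gcongr

/-- The parameters of the algorithm suffice for the precision `1 / r`. -/
theorem prob_accurate {n k N S S₀ : ℕ} {I : Input n k N} {σ : Scheme} {E : Fin S → ℝ}
    {ψ : Fin S → Bits n → ℂ} {δ K : ℝ} (hS : 0 < S) (hSS : S ≤ S₀)
    (hK : ∀ (w z : Fin S → ℝ) (y : Fin (2 * S + 1) → ℝ) (ω γ η ε : ℝ), 0 < ω → (∀ j, ω ≤ w j) →
      0 < γ → γ ≤ 1 → (∀ j, 1 / 8 ≤ z j ∧ z j ≤ 1) → (∀ i j, i ≠ j → γ ≤ |z i - z j|) →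
      0 < η → η ≤ 1 / 16 → 2 * η < γ → 0 ≤ ε →
      (∀ κ : Fin (2 * S + 1), |y κ - ∑ j, w j * z j ^ (κ : ℕ)| ≤ ε) →
      K * ε ≤ ω * ((γ ^ S) ^ S) ^ 2 * η ^ S →
      ∃ π : Equiv.Perm (Fin S), ∀ j, |Real.log ‖eigenvalueList
        (pinv ((svd (hankel y)).1.submatrix (Fin.castSucc : Fin S → Fin (S + 1)) Fin.castSucc) *
          (svd (hankel y)).1.submatrix (Fin.succ : Fin S → Fin (S + 1)) Fin.castSucc) (π j)‖ -
        Real.log (z j)| ≤ 16 * η)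
    {C P Λ Γ D Q M m r : ℕ} (hC : K ≤ C) (hC0 : 0 < C) (hP0 : 0 < P)
    (hΛ : Λ = (P + 1) * (2 ^ k * P)) (hΓ : Γ = 2 * P * Λ) (hD : D = 16 + 3 * Γ + 3 * Λ * r)
    (hQ : Q = C * P * Γ ^ (S₀ * S₀ * 2) * D ^ S₀) (hm : m = 16 * Q ^ 2)
    (hM : M = 16 * Q * ((P + ((k + 1) * (n + 1) ^ k + 1)) * (2 * S₀)) ^ 2 + 1)
    (hδ : 0 < δ) (hδ1 : δ < 1) (hst : I.ham.Stoquastic σ) (hN : N ≤ P)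
    (hb : ∀ i, opNorm (I.ham.term i) ≤ P) (hsup : SupportedOn I.ham.total I.Φ E ψ)
    (hw : ∀ j, 1 ≤ P * ‖star (ψ j) ⬝ᵥ I.Φ‖ ^ 2)
    (hgap : ∀ i j, i ≠ j → 1 ≤ P * (|E i - E j| / (2 * Real.pi))) :
    ENNReal.ofReal (1 - δ) ≤
      ((I.params P σ).monteCarlo S M m δ >>= (I.params P σ).energyStage).prob I
        {F | matchingDist E F * r ≤ 1} := by
  set q := I.params P σ with hq
  have hkP : 0 < 2 ^ k * P := by positivity
  have hscale_eq : q.scale = (N + 1) * (2 ^ k * P) := rfl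
  have hscale0 : 0 < q.scale := by rw [hscale_eq]; positivity
  have hscaleΛ : q.scale ≤ Λ := by rw [hscale_eq, hΛ]; gcongr
  have hΛ0 : 0 < Λ := hscale0.trans_le hscaleΛ
  have hΓ0 : 0 < Γ := by rw [hΓ]; positivity
  have hD0 : 0 < D := by omega
  have hQ0 : 0 < Q := by rw [hQ]; positivity
  have hm0 : 0 < m := by rw [hm]; positivity
  have hM0 : 0 < M := by omega
  have cP : (0 : ℝ) < P := by exact_mod_cast hP0
  have cC : (0 : ℝ) < C := by exact_mod_cast hC0
  have cs : (0 : ℝ) < q.scale := by exact_mod_cast hscale0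
  have csΛ : (q.scale : ℝ) ≤ Λ := by exact_mod_cast hscaleΛ
  have cΛ : (0 : ℝ) < Λ := by exact_mod_cast hΛ0
  have cΓ : (0 : ℝ) < Γ := by exact_mod_cast hΓ0
  have cΓ1 : (1 : ℝ) ≤ Γ := by exact_mod_cast hΓ0
  have cD : (0 : ℝ) < D := by exact_mod_cast hD0
  have cD1 : (1 : ℝ) ≤ D := by exact_mod_cast hD0
  have cQ : (0 : ℝ) < Q := by exact_mod_cast hQ0
  have cM : (0 : ℝ) < M := by exact_mod_cast hM0
  have cr : (0 : ℝ) ≤ r := Nat.cast_nonneg r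
  have eD : (D : ℝ) = 16 + 3 * Γ + 3 * Λ * r := by rw [hD]; push_cast; ring
  have eΓ : (Γ : ℝ) = 2 * P * Λ := by rw [hΓ]; push_cast; ring
  have hΛr : 0 ≤ Λ * (r : ℝ) := by positivity
  have hpi := Real.pi_gt_three
  -- The signal accuracy `1/Q` meets the condition of `esprit_stable` for `ω = 1/P`, `γ = 1/Γ`, `η =
  -- 1/D`, and `m = 16Q²` is the sample size that Chebyshev's inequality needs for it.
  refine prob_ge q hδ hδ1 (ε := 1 / Q) (by positivity) hm0 ?_
    (fun κ => ∑ j, ‖star (ψ j) ⬝ᵥ I.Φ‖ ^ 2 * Real.exp (-(κ / q.scale * (E j + q.shift)))) ?_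
    (fun y => det_energyStage q y) ?_
  · rw [hm]; push_cast; field_simp; exact le_rfl
  · intro κ
    obtain ⟨μ, h1, h2, h3⟩ := pathSample_estimates hb hst hsup hscale0 hM0 (κ : ℕ)
    refine ⟨μ, h1, h2, h3.trans ?_⟩
    have hlen : q.pieces.length ≤ P + ((k + 1) * (n + 1) ^ k + 1) :=
      (length_pieces_le q).trans (Nat.add_le_add_right hN _)
    have hκ : (κ : ℕ) ≤ 2 * S₀ := by omega
    have hle : 16 * Q * (q.pieces.length * κ) ^ 2 ≤ M := by
      rw [hM]
      refine le_trans ?_ (Nat.le_succ _)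
      gcongr
    have hle' : 16 * (Q : ℝ) * (q.pieces.length * (κ : ℕ)) ^ 2 ≤ M := by exact_mod_cast hle
    -- `M` is chosen so that the Trotter error uses at most half of the accuracy `1/Q`, even for the
    -- largest `κ = 2S`.
    rw [div_div, div_le_div_iff₀ cM (by positivity)]
    linarith
  · intro y hy
    have hγ : (0 : ℝ) < 1 / Γ := by positivity
    have hacc := energies_accurate (σ := σ) (b := P) (ω := 1 / P) (γ := 1 / Γ) (η := 1 / D)
      (ε := 1 / Q) hS hK hscale0 hb hst hsup (by positivity)
      (fun j => by rw [div_le_iff₀ cP, mul_comm]; exact hw j) hγ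
      (by rw [div_le_one cΓ]; exact cΓ1)
      (fun i j hij => by
        -- Only `2π ≥ 4` is used: then `|E_i - E_j|/(8Λ) ≥ 4/(8PΛ) = 1/Γ`.
        have h1 := hgap i j hij
        rw [← mul_div_assoc, one_le_div (by positivity)] at h1
        rw [div_div, div_le_div_iff₀ cΓ (by positivity), eΓ]
        have h2 : 4 ≤ P * |E i - E j| := by linarith
        have h3 := mul_le_mul_of_nonneg_left h2 cΛ.le
        change 1 * ((q.scale : ℝ) * 8) ≤ _
        linarith)
      (by positivity)
      (by rw [div_le_div_iff₀ cD (by norm_num)]; nlinarith)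
      (by rw [← mul_div_assoc, mul_one, div_lt_div_iff₀ cD cΓ]; nlinarith)
      (by positivity)
      (by
        have h1 : (((1 / (Γ : ℝ)) ^ S) ^ S) ^ 2 = 1 / Γ ^ (S * S * 2) := by
          rw [← pow_mul, ← pow_mul, one_div_pow, mul_assoc]
        have h2 : (1 / (D : ℝ)) ^ S = 1 / D ^ S := one_div_pow _ _
        rw [h1, h2, one_div_mul_one_div, one_div_mul_one_div, mul_one_div,
          div_le_div_iff₀ cQ (by positivity), one_mul]
        have eQ : (Q : ℝ) = C * P * Γ ^ (S₀ * S₀ * 2) * D ^ S₀ := by rw [hQ]; push_cast; ring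
        rw [eQ, mul_assoc (C : ℝ), mul_assoc (C : ℝ)]
        gcongr)
      y hy
    -- The term `3Λr` in `D` gives the target precision, since `16/(2π) ≤ 16/6 < 3`; the terms `16`
    -- and `3Γ` served for `η ≤ 1/16` and `2η < γ`.
    have hr1 : q.scale * (16 * (1 / (D : ℝ))) / (2 * Real.pi) * r ≤ 1 := by
      have e : q.scale * (16 * (1 / (D : ℝ))) / (2 * Real.pi) * r =
          16 * (q.scale * r) / (D * (2 * Real.pi)) := by
        field_simp
      rw [e, div_le_one (by positivity)]
      have h1 : (q.scale : ℝ) * r ≤ Λ * r := mul_le_mul_of_nonneg_right csΛ cr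
      have h2 : D * 6 ≤ D * (2 * Real.pi) := mul_le_mul_of_nonneg_left (by linarith) cD.le
      have h3 : 3 * (Λ * (r : ℝ)) ≤ D := by rw [eD]; linarith
      linarith
    exact (mul_le_mul_of_nonneg_right hacc cr).trans hr1

end StoqMC
end

/-! ### The main theorem -/

open StoqMC in
theorem theorem4 (k S₀ : ℕ) (p r : Polynomial ℕ) :
    ∃ M m T : Polynomial ℕ, ∀ (n N S : ℕ) (I : Input n k N) (σ : Scheme)
      (E : Fin S → ℝ) (ψ : Fin S → Bits n → ℂ) (δ : ℝ),
      0 < δ → δ < 1 → S ≤ S₀ →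
      -- a local stoquastic Hamiltonian
      I.ham.Stoquastic σ →
      N ≤ p.eval n → (∀ i, opNorm (I.ham.term i) ≤ (p.eval n : ℕ)) →
      -- efficient access to the state
      I.sampleCost ≤ p.eval n → I.ratioCost ≤ p.eval n →
      -- the eigenvectors supported in the state, their weights, and their eigenvalues
      SupportedOn I.ham.total I.Φ E ψ →
      (∀ j, 1 ≤ (p.eval n : ℕ) * ‖star (ψ j) ⬝ᵥ I.Φ‖ ^ 2) →
      (∀ j, E j ∈ Set.Ico 0 (2 * Real.pi)) →
      (∀ i j, i ≠ j → 1 ≤ (p.eval n : ℕ) * (|E i - E j| / (2 * Real.pi))) →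
      -- both stages take polynomial effort
      ((I.params (p.eval n) σ).monteCarlo S (M.eval n) (m.eval n) δ).CostLE I
        (T.eval (n + ⌈Real.log (1 / δ)⌉₊)) ∧
      (∀ y : Fin (2 * S + 1) → ℝ,
        ((I.params (p.eval n) σ).energyStage y).CostLE I (T.eval n)) ∧
      -- together they resolve the eigenvalues to precision `1 / r(n)`
      ENNReal.ofReal (1 - δ) ≤
        ((I.params (p.eval n) σ).monteCarlo S (M.eval n) (m.eval n) δ >>=
          (I.params (p.eval n) σ).energyStage).prob I
            {F | matchingDist E F * (r.eval n : ℕ) ≤ 1} := by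
  choose K hK0 hK using esprit_stable
  let K' : ℕ → ℝ := fun S => if h : 0 < S then K S h else 0
  have hK'0 : ∀ S, 0 ≤ K' S := fun S => by
    simp only [K']
    split_ifs with h
    · exact (hK0 S h).le
    · exact le_rfl
  -- The stability constant depends on `S`, while the polynomials may depend only on `S₀`; the sum
  -- dominates all cases and the final `+ 1` makes it positive.
  let C : ℕ := ⌈∑ S ∈ Finset.range (S₀ + 1), K' S⌉₊ + 1
  have hC : ∀ S (h : 0 < S), S ≤ S₀ → K S h ≤ C := by
    intro S h hS
    have h1 : K' S ≤ ∑ S ∈ Finset.range (S₀ + 1), K' S :=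
      Finset.single_le_sum (fun S _ => hK'0 S) (Finset.mem_range.2 (by omega))
    have h2 := Nat.le_ceil (∑ S ∈ Finset.range (S₀ + 1), K' S)
    have h3 : K' S = K S h := dif_pos h
    simp only [C]
    push_cast
    linarith
  let Λ : Polynomial ℕ := (p + 1) * (2 ^ k * p)
  let Γ : Polynomial ℕ := 2 * p * Λ
  let D : Polynomial ℕ := 16 + 3 * Γ + 3 * Λ * r
  let Q : Polynomial ℕ := (C : Polynomial ℕ) * p * Γ ^ (S₀ * S₀ * 2) * D ^ S₀
  let m : Polynomial ℕ := 16 * Q ^ 2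
  let M : Polynomial ℕ := 16 * Q *
    ((p + (((k : Polynomial ℕ) + 1) * (Polynomial.X + 1) ^ k + 1)) * (2 * (S₀ : Polynomial ℕ))) ^ 2 + 1
  refine ⟨M, m, costPolynomial k S₀ p M m, ?_⟩
  intro n N S I σ E ψ δ hδ hδ1 hS hst hN hb hs hr hsup hw _ hgap
  obtain ⟨h1, h2⟩ := costLE_both (σ := σ) (M := M) (m := m) hδ hS hN hs hr
  refine ⟨h1, h2, ?_⟩
  -- For `S = 0` the weights would sum to 0 instead of 1.
  have hSpos : 0 < S := by
    rcases Nat.eq_zero_or_pos S with rfl | h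
    · have := sum_norm_sq_weights hsup
      simp at this
    · exact h
  have hP : 0 < p.eval n := by
    rcases Nat.eq_zero_or_pos (p.eval n) with h | h
    · have := hw ⟨0, hSpos⟩
      rw [h] at this
      norm_num at this
    · exact h
  refine prob_accurate (S₀ := S₀) (C := C) (Λ := Λ.eval n) (Γ := Γ.eval n) (D := D.eval n)
    (Q := Q.eval n) hSpos hS (hK S hSpos) (hC S hSpos hS) (Nat.succ_pos _) hP ?_ ?_ ?_ ?_ ?_ ?_
    hδ hδ1 hst hN hb hsup hw hgap
  · simp [Λ]
  · simp [Γ]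
  · simp [D]
  · simp [Q]
  · simp [m]
  · simp [M]
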